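/- Let $\mathfrak{g}$ be a simple finite-dimensional complex Lie algebra with a triangular decomposition $\mathfrak{g}=\mathfrak{n}_-\oplus\mathfrak{h}\oplus\mathfrak{n}_+$ (given by a Cartan subalgebra $\mathfrak{h}$ and a base of the root system $\Phi$), and for each $\alpha\in\Phi$ fix a non-zero $X_\alpha\in\mathfrak{g}_\alpha$. Let $L(\mathfrak{g})=\mathfrak{g}\otimes\mathbb{C}[t,t^{-1}]$, and let $\hat{\mathfrak{g}}=L(\mathfrak{g})\oplus\mathbb{C}d\oplus\mathbb{C}c$ be the untwisted affine Lie algebra, with $c$ central, $[d,x\otimes t^i]=i\,(x\otimes t^i)$ and $$[x\otimes t^i,y\otimes t^j]=[x,y]\otimes t^{i+j}+i\,\delta_{i,-j}\,(x,y)\,c,$$ where $(\cdot,\cdot)$ is the Killing form. Let $\mathfrak{p}\neq\mathfrak{g}$ be a parabolic subalgebra of $\mathfrak{g}$ containing $\mathfrak{h}\oplus\mathfrak{n}_+$, let $\mathfrak{n}$ be its nilradical (its largest nilpotent ideal), and let $\Phi_{\mathfrak{n}}^0$ be the set of the roots that appear in $\mathfrak{n}$ but not in $[\mathfrak{n},\mathfrak{n}]$.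 Regard $L(\mathfrak{n})=\mathfrak{n}\otimes\mathbb{C}[t,t^{-1}]$ as a subalgebra of $\hat{\mathfrak{g}}$. Let $\theta\in\mathbb{C}$ and let $\Lambda:\Phi_{\mathfrak{n}}^0\to\mathbb{C}^{\mathbb{Z}}$ be a map. Let $U_\theta$ be the quotient of $U(\hat{\mathfrak{g}})$ by the two-sided ideal generated by $c-\theta$, and let $\mathbb{C}_\Lambda$ be the one-dimensional $L(\mathfrak{n})$-module annihilated by $[L(\mathfrak{n}),L(\mathfrak{n})]$ on which $X_\alpha\otimes t^j$ acts by $\Lambda(\alpha)_j$, for $\alpha\in\Phi_{\mathfrak{n}}^0$ and $j\in\mathbb{Z}$. Assume that the image of $\Lambda$, taken as a multiset, is strongly generic: the family consisting of all translates $(\Lambda(\alpha)_{i+n})_{i\in\mathbb{Z}}$, indexed by $(\alpha,n)\in\Phi_{\mathfrak{n}}^0\times\mathbb{Z}$, together with all $(i\,\Lambda(\alpha)_i)_{i\in\mathbb{Z}}$, indexed by $\alpha\in\Phi_{\mathfrak{n}}^0$, is linearly independent in $\mathbb{C}^{\mathbb{Z}}$. Then the induced module $$M(\Lambda,\theta)=U_\theta\otimes_{U(L(\mathfrak{n}))}\mathbb{C}_\Lambda$$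 is simple. -/

import Mathlib

open scoped TensorProduct

noncomputable section

namespace WhittakerInduction

open LieAlgebra LieModule LieAlgebra.IsKilling

/-! ### Loop algebras -/

section Loop

variable (g : Type*) [LieRing g] [LieAlgebra ℂ g]

/-- The loop algebra `L(g) = g ⊗ ℂ[t, t⁻¹]`. -/
def Loop : Type _ := loopAlgebra ℂ ℤ g

instance : LieRing (Loop g) := inferInstanceAs (LieRing (loopAlgebra ℂ ℤ g))

instance : LieAlgebra ℂ (Loop g) := inferInstanceAs (LieAlgebra ℂ (loopAlgebra ℂ ℤ g))

/-- The element `x ⊗ t ^ i` of the loop algebra, as a linear function of `x`. -/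
def loopElt {g : Type*} [LieRing g] [LieAlgebra ℂ g] (i : ℤ) : g →ₗ[ℂ] Loop g :=
  TensorProduct.mk ℂ (AddMonoidAlgebra ℂ ℤ) g (AddMonoidAlgebra.single i (1 : ℂ))

/-- The linear map `t d/dt` on the Laurent polynomials, `t ^ i ↦ i t ^ i`. -/
def eulerLaurent : AddMonoidAlgebra ℂ ℤ →ₗ[ℂ] AddMonoidAlgebra ℂ ℤ :=
  (AddMonoidAlgebra.basis ℤ ℂ).constr ℂ fun i => AddMonoidAlgebra.single i (i : ℂ)

/-- The derivation `x ⊗ t ^ i ↦ i (x ⊗ t ^ i)` of the loop algebra. -/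
def loopDeriv : Loop g →ₗ[ℂ] Loop g :=
  LinearMap.rTensor g eulerLaurent

/-- The bilinear form on `L(g)` with `(x ⊗ t ^ i, y ⊗ t ^ j) ↦ i δ_{i,-j} (x, y)`, where `(x, y)`
is the Killing form of `g`. -/
def loopCocycle : Loop g →ₗ[ℂ] Loop g →ₗ[ℂ] ℂ :=
  LinearMap.flip (LoopAlgebra.residuePairing ℂ ℤ g (killingForm ℂ g))

variable {g}

lemma loopElt_lie (x y : g) (i j : ℤ) : ⁅loopElt i x, loopElt j y⁆ = loopElt (i + j) ⁅x, y⁆ := by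
  change (⁅(AddMonoidAlgebra.single i (1 : ℂ) ⊗ₜ[ℂ] x : loopAlgebra ℂ ℤ g),
    (AddMonoidAlgebra.single j (1 : ℂ) ⊗ₜ[ℂ] y : loopAlgebra ℂ ℤ g)⁆ : loopAlgebra ℂ ℤ g) =
    AddMonoidAlgebra.single (i + j) (1 : ℂ) ⊗ₜ[ℂ] ⁅x, y⁆
  rw [ExtendScalars.bracket_tmul, AddMonoidAlgebra.single_mul_single, mul_one]

lemma eulerLaurent_single (i : ℤ) :
    eulerLaurent (AddMonoidAlgebra.single i (1 : ℂ)) = AddMonoidAlgebra.single i (i : ℂ) := by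
  have h := (AddMonoidAlgebra.basis ℤ ℂ).constr_basis ℂ
    (fun i : ℤ => (AddMonoidAlgebra.single i (i : ℂ) : AddMonoidAlgebra ℂ ℤ)) i
  have h2 : (AddMonoidAlgebra.basis ℤ ℂ) i = AddMonoidAlgebra.single i (1 : ℂ) := by simp
  rwa [h2] at h

lemma loopDeriv_loopElt (x : g) (i : ℤ) : loopDeriv g (loopElt i x) = (i : ℂ) • loopElt i x := by
  change (eulerLaurent (AddMonoidAlgebra.single i (1 : ℂ))) ⊗ₜ[ℂ] x =
    (i : ℂ) • (AddMonoidAlgebra.single i (1 : ℂ) ⊗ₜ[ℂ] x)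
  rw [eulerLaurent_single, TensorProduct.smul_tmul', AddMonoidAlgebra.smul_single, smul_eq_mul,
    mul_one]

lemma loopCocycle_loopElt (x y : g) (i j : ℤ) :
    loopCocycle g (loopElt i x) (loopElt j y) =
      if i = -j then (i : ℂ) * killingForm ℂ g x y else 0 := by
  change LoopAlgebra.residuePairing ℂ ℤ g (killingForm ℂ g)
    (AddMonoidAlgebra.single j (1 : ℂ) ⊗ₜ[ℂ] y) (AddMonoidAlgebra.single i (1 : ℂ) ⊗ₜ[ℂ] x) = _
  rw [LoopAlgebra.residuePairing_apply_apply]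
  simp only [LoopAlgebra.toFinsupp_single_tmul]
  rw [Finsupp.sum_single_index (by simp)]
  by_cases h : i = -j
  · subst h
    simp [LieModule.traceForm_comm ℂ g g x y]
  · have : j ≠ -i := fun h' => h (by omega)
    simp [h, this]

lemma loop_induction {p : Loop g → Prop} (h0 : p 0)
    (hadd : ∀ a b, p a → p b → p (a + b)) (hs : ∀ (x : g) (i : ℤ), p (loopElt i x))
    (a : Loop g) : p a := by
  induction a using TensorProduct.induction_on with
  | zero => exact h0
  | add a b ha hb => exact hadd a b ha hb
  | tmul f x =>
    induction f using AddMonoidAlgebra.induction_linear with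
    | zero => rw [TensorProduct.zero_tmul]; exact h0
    | add f f' hf hf' => rw [TensorProduct.add_tmul]; exact hadd _ _ hf hf'
    | single i r =>
      have : (AddMonoidAlgebra.single i r : AddMonoidAlgebra ℂ ℤ) ⊗ₜ[ℂ] x =
          (AddMonoidAlgebra.single i (1 : ℂ) : AddMonoidAlgebra ℂ ℤ) ⊗ₜ[ℂ] (r • x) := by
        rw [← TensorProduct.smul_tmul, AddMonoidAlgebra.smul_single, smul_eq_mul, mul_one]
      rw [this]; exact hs _ _

lemma loopDeriv_lie (a b : Loop g) :
    loopDeriv g ⁅a, b⁆ = ⁅loopDeriv g a, b⁆ + ⁅a, loopDeriv g b⁆ := by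
  induction a using loop_induction with
  | h0 => simp
  | hadd a a' h h' => simp only [add_lie, map_add, h, h']; abel
  | hs x i =>
    induction b using loop_induction with
    | h0 => simp
    | hadd a a' h h' => simp only [lie_add, map_add, h, h']; abel
    | hs y j =>
      simp only [loopElt_lie, loopDeriv_loopElt, smul_lie, lie_smul, ← add_smul]
      push_cast; rfl

lemma loopCocycle_deriv (a b : Loop g) :
    loopCocycle g (loopDeriv g a) b + loopCocycle g a (loopDeriv g b) = 0 := by
  induction a using loop_induction with
  | h0 => simp
  | hadd a a' h h' =>
    simp only [map_add, LinearMap.add_apply]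
    linear_combination h + h'
  | hs x i =>
    induction b using loop_induction with
    | h0 => simp
    | hadd a a' h h' =>
      simp only [map_add]
      linear_combination h + h'
    | hs y j =>
      simp only [loopDeriv_loopElt, map_smul, LinearMap.smul_apply, loopCocycle_loopElt,
        smul_eq_mul]
      split_ifs with h
      · subst h; push_cast; ring
      · ring

lemma loopCocycle_skew (a b : Loop g) :
    loopCocycle g a b + loopCocycle g b a = 0 := by
  induction a using loop_induction with
  | h0 => simp
  | hadd a a' h h' =>
    simp only [map_add, LinearMap.add_apply]
    linear_combination h + h'
  | hs x i =>
    induction b using loop_induction with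
    | h0 => simp
    | hadd a a' h h' =>
      simp only [map_add, LinearMap.add_apply]
      linear_combination h + h'
    | hs y j =>
      simp only [loopCocycle_loopElt, LieModule.traceForm_comm ℂ g g y x]
      by_cases h : i = -j
      · subst h; simp
      · have : j ≠ -i := fun h' => h (by omega)
        simp [h, this]

lemma loopCocycle_self (a : Loop g) : loopCocycle g a a = 0 := by
  have := loopCocycle_skew a a
  simpa using this

lemma loopCocycle_leibniz (a b c : Loop g) :
    loopCocycle g a ⁅b, c⁆ = loopCocycle g ⁅a, b⁆ c + loopCocycle g b ⁅a, c⁆ := by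
  induction a using loop_induction with
  | h0 => simp
  | hadd a a' h h' =>
    simp only [add_lie, map_add, LinearMap.add_apply]
    linear_combination h + h'
  | hs x i =>
    induction b using loop_induction with
    | h0 => simp
    | hadd a a' h h' =>
      simp only [add_lie, lie_add, map_add, LinearMap.add_apply]
      linear_combination h + h'
    | hs y j =>
      induction c using loop_induction with
      | h0 => simp
      | hadd a a' h h' =>
        simp only [lie_add, map_add]
        linear_combination h + h'
      | hs z k =>
        simp only [loopElt_lie, loopCocycle_loopElt]
        have h1 : killingForm ℂ g ⁅x, y⁆ z = killingForm ℂ g x ⁅y, z⁆ :=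
          LieModule.traceForm_apply_lie_apply ℂ g g x y z
        have h2 : killingForm ℂ g y ⁅x, z⁆ = - killingForm ℂ g x ⁅y, z⁆ := by
          rw [← LieModule.traceForm_apply_lie_apply ℂ g g y x z, ← h1, ← lie_skew x y, map_neg,
            LinearMap.neg_apply, neg_neg]
        rw [h1, h2]
        by_cases h : i + j + k = 0
        · rw [if_pos (by omega), if_pos (by omega), if_pos (by omega)]
          obtain rfl : k = -i - j := by omega
          push_cast; ring
        · rw [if_neg (by omega), if_neg (by omega), if_neg (by omega)]
          ring

end Loop

/-! ### The untwisted affine Lie algebra -/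

/-- The untwisted affine Lie algebra `L(g) ⊕ ℂ d ⊕ ℂ c`; an element is the triple of its
component in `L(g)`, its coefficient at `d` and its coefficient at `c`. -/
@[ext]
structure Affine (g : Type*) [LieRing g] [LieAlgebra ℂ g] where
  loop : Loop g
  dCoeff : ℂ
  cCoeff : ℂ

namespace Affine

variable {g : Type*} [LieRing g] [LieAlgebra ℂ g]

/-- The obvious bijection with triples; it carries the vector space structure over. -/
def equivProd (g : Type*) [LieRing g] [LieAlgebra ℂ g] :
    Affine g ≃ Loop g × ℂ × ℂ where
  toFun x := (x.loop, x.dCoeff, x.cCoeff)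
  invFun x := ⟨x.1, x.2.1, x.2.2⟩
  left_inv _ := rfl
  right_inv _ := rfl

instance : AddCommGroup (Affine g) := (equivProd g).addCommGroup

instance : Module ℂ (Affine g) := (equivProd g).module ℂ

@[simp] lemma loop_zero : (0 : Affine g).loop = 0 := rfl

@[simp] lemma dCoeff_zero : (0 : Affine g).dCoeff = 0 := rfl

@[simp] lemma cCoeff_zero : (0 : Affine g).cCoeff = 0 := rfl

@[simp] lemma loop_add (x y : Affine g) : (x + y).loop = x.loop + y.loop := rfl

@[simp] lemma dCoeff_add (x y : Affine g) : (x + y).dCoeff = x.dCoeff + y.dCoeff := rfl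

@[simp] lemma cCoeff_add (x y : Affine g) : (x + y).cCoeff = x.cCoeff + y.cCoeff := rfl

@[simp] lemma loop_smul (r : ℂ) (x : Affine g) : (r • x).loop = r • x.loop := rfl

@[simp] lemma dCoeff_smul (r : ℂ) (x : Affine g) : (r • x).dCoeff = r * x.dCoeff := rfl

@[simp] lemma cCoeff_smul (r : ℂ) (x : Affine g) : (r • x).cCoeff = r * x.cCoeff := rfl

/-- The bracket given by `[x ⊗ t ^ i, y ⊗ t ^ j] = [x, y] ⊗ t ^ (i + j) + i δ_{i,-j} (x, y) c`,
`[d, x ⊗ t ^ i] = i (x ⊗ t ^ i)` and the centrality of `c`. -/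
instance : Bracket (Affine g) (Affine g) where
  bracket x y :=
    { loop := ⁅x.loop, y.loop⁆ + x.dCoeff • loopDeriv g y.loop - y.dCoeff • loopDeriv g x.loop
      dCoeff := 0
      cCoeff := loopCocycle g x.loop y.loop }

@[simp] lemma loop_lie (x y : Affine g) : ⁅x, y⁆.loop =
    ⁅x.loop, y.loop⁆ + x.dCoeff • loopDeriv g y.loop - y.dCoeff • loopDeriv g x.loop := rfl

@[simp] lemma dCoeff_lie (x y : Affine g) : ⁅x, y⁆.dCoeff = 0 := rfl

@[simp] lemma cCoeff_lie (x y : Affine g) : ⁅x, y⁆.cCoeff = loopCocycle g x.loop y.loop := rfl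

instance : LieRing (Affine g) where
  add_lie x y z := by
    ext
    · simp only [loop_lie, loop_add, dCoeff_add, add_lie, add_smul, map_add, smul_add]; abel
    · simp
    · simp
  lie_add x y z := by
    ext
    · simp only [loop_lie, loop_add, dCoeff_add, lie_add, add_smul, map_add, smul_add]; abel
    · simp
    · simp
  lie_self x := by
    ext
    · simp
    · simp
    · simp [loopCocycle_self]
  leibniz_lie x y z := by
    ext
    · simp only [loop_lie, loop_add, dCoeff_lie, map_add, map_sub, map_smul, loopDeriv_lie, lie_add,
        lie_sub, add_lie, sub_lie, lie_smul, smul_lie, zero_smul, smul_add, smul_sub,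
        smul_comm y.dCoeff x.dCoeff, smul_comm z.dCoeff x.dCoeff,
        smul_comm z.dCoeff y.dCoeff]
      rw [← lie_skew (loopDeriv g x.loop) y.loop, leibniz_lie x.loop y.loop z.loop]
      simp only [smul_neg]
      abel
    · simp
    · simp only [loop_lie, cCoeff_lie, cCoeff_add, map_add, map_sub, map_smul, LinearMap.add_apply,
        LinearMap.sub_apply, LinearMap.smul_apply, smul_eq_mul]
      linear_combination loopCocycle_leibniz x.loop y.loop z.loop
        - x.dCoeff * loopCocycle_deriv y.loop z.loop
        + y.dCoeff * loopCocycle_deriv x.loop z.loop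
        + z.dCoeff * (loopCocycle_skew (loopDeriv g x.loop) y.loop
          - loopCocycle_deriv x.loop y.loop)

instance : LieAlgebra ℂ (Affine g) where
  lie_smul r x y := by
    ext
    · simp only [loop_lie, loop_smul, dCoeff_smul, lie_smul, map_smul, smul_add, smul_sub,
        mul_smul, smul_comm r]
    · simp
    · simp

/-- The central element `c`. -/
def c (g : Type*) [LieRing g] [LieAlgebra ℂ g] : Affine g := ⟨0, 0, 1⟩

/-- The element `d`. -/
def d (g : Type*) [LieRing g] [LieAlgebra ℂ g] : Affine g := ⟨0, 1, 0⟩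

/-- The element `x ⊗ t ^ i` of the affine Lie algebra. -/
def elt (x : g) (i : ℤ) : Affine g := ⟨loopElt i x, 0, 0⟩

lemma elt_lie_elt (x y : g) (i j : ℤ) : ⁅elt x i, elt y j⁆ =
    elt ⁅x, y⁆ (i + j) + (if i = -j then (i : ℂ) * killingForm ℂ g x y else 0) • c g := by
  ext
  · simp only [elt, c, loopElt_lie, loop_lie, loop_add, loop_smul]; simp
  · simp only [elt, c, dCoeff_lie, dCoeff_add, dCoeff_smul]; simp
  · simp only [elt, c, cCoeff_lie, cCoeff_add, cCoeff_smul, loopCocycle_loopElt]; simp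

lemma d_lie_elt (x : g) (i : ℤ) : ⁅d g, elt x i⁆ = (i : ℂ) • elt x i := by
  ext
  · simp [elt, d, loopDeriv_loopElt]
  · simp [elt, d]
  · simp [elt, d]

lemma c_lie (x : Affine g) : ⁅c g, x⁆ = 0 := by
  ext
  · simp [c]
  · simp [c]
  · simp [c]

end Affine

/-! ### Parabolic subalgebras, their nilradicals and roots -/

/-- The nilradical of a (finite dimensional) Lie algebra: the largest nilpotent ideal, that is, the
sum of all ideals which are nilpotent as Lie algebras. -/
def nilradical (L : Type*) [LieRing L] [LieAlgebra ℂ L] : LieIdeal ℂ L :=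
  sSup {I : LieIdeal ℂ L | LieRing.IsNilpotent I}

section Parabolic

variable {g : Type*} [LieRing g] [LieAlgebra ℂ g] [FiniteDimensional ℂ g]
  [LieAlgebra.IsSimple ℂ g] {H : LieSubalgebra ℂ g} [H.IsCartanSubalgebra]

/-- The space `h ⊕ n₊`, where `n₊` is the sum of the root spaces of the positive roots with respect
to a base of the root system. -/
def borel (b : (rootSystem H).Base) : Submodule ℂ g :=
  H.toSubmodule ⊔ ⨆ α : H.root, ⨆ _ : b.IsPos α, (rootSpace H α.1).toSubmodule

/-- A proper parabolic subalgebra of `g` containing the Borel subalgebra `h ⊕ n₊`. -/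
structure ProperParabolic (b : (rootSystem H).Base) where
  carrier : LieSubalgebra ℂ g
  borel_le : borel b ≤ carrier.toSubmodule
  ne_top : carrier ≠ ⊤

/-- The opposite root. -/
def negRoot (α : H.root) : H.root :=
  ⟨-α.1, by simpa using (LieSubalgebra.isNonZero_coe_root α)⟩

namespace ProperParabolic

variable {b : (rootSystem H).Base} (p : ProperParabolic b)

/-- The nilradical `n` of the parabolic subalgebra, as a subalgebra of `g`. -/
def nil : LieSubalgebra ℂ g :=
  (LieIdeal.toLieSubalgebra ℂ p.carrier (nilradical p.carrier)).map p.carrier.incl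

/-- The set `Φ_n` of the roots that appear in `n`. -/
def roots : Set H.root :=
  {α | ∃ x ∈ p.nil, x ≠ 0 ∧ x ∈ rootSpace H α.1}

/-- The set `Φ_n¹` of the roots that appear in `[n, n]`. -/
def rootsOne : Set H.root :=
  {α | ∃ x ∈ ⁅(⊤ : LieIdeal ℂ p.nil), (⊤ : LieIdeal ℂ p.nil)⁆,
    x ≠ 0 ∧ (x : g) ∈ rootSpace H α.1}

/-- The set `Φ_n⁰` of the roots that appear in `n` but not in `[n, n]`. -/
def rootsZero : Set H.root := p.roots \ p.rootsOne

lemma mem_nil {x : g} : x ∈ p.nil ↔ ∃ h : x ∈ p.carrier, (⟨x, h⟩ : p.carrier) ∈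
    nilradical p.carrier := by
  rw [nil, LieSubalgebra.mem_map]
  constructor
  · rintro ⟨y, hy, rfl⟩
    exact ⟨y.2, hy⟩
  · rintro ⟨h, hx⟩
    exact ⟨⟨x, h⟩, hx, rfl⟩

lemma cartan_le : H ≤ p.carrier := fun _ hx => p.borel_le (Submodule.mem_sup_left hx)

lemma lie_mem_nil {y x : g} (hy : y ∈ p.carrier) (hx : x ∈ p.nil) : ⁅y, x⁆ ∈ p.nil := by
  obtain ⟨h, hx⟩ := p.mem_nil.1 hx
  exact p.mem_nil.2 ⟨p.carrier.lie_mem hy h,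
    (nilradical p.carrier).lie_mem (x := ⟨y, hy⟩) hx⟩

lemma rootSpace_le_of_isPos {α : H.root} (hα : b.IsPos α) {x : g} (hx : x ∈ rootSpace H α.1) :
    x ∈ p.carrier := by
  refine p.borel_le (Submodule.mem_sup_right ?_)
  exact (le_iSup₂_of_le (f := fun (α : H.root) (_ : b.IsPos α) => (rootSpace H α.1).toSubmodule)
    α hα le_rfl) hx

lemma isPos_or_neg (α : H.root) : b.IsPos α ∨ b.IsPos (negRoot α) := by
  rcases RootPairing.Base.IsPos.or_neg b α with h | h
  · exact Or.inl h
  · right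
    convert h
    apply (rootSystem H).root.injective
    rw [RootPairing.indexNeg_neg, RootPairing.root_reflectionPerm, RootPairing.reflection_apply_self]
    rfl

/-- An ideal of the parabolic subalgebra is stable under the Cartan subalgebra. -/
def idealAsModule (I : LieIdeal ℂ p.carrier) : LieSubmodule ℂ H g where
  __ := I.toSubmodule.map p.carrier.toSubmodule.subtype
  lie_mem := by
    rintro h _ ⟨y, hy, rfl⟩
    exact ⟨⁅(⟨h, p.cartan_le h.2⟩ : p.carrier), y⁆, I.lie_mem hy, rfl⟩

lemma mem_idealAsModule {I : LieIdeal ℂ p.carrier} {x : g} :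
    x ∈ p.idealAsModule I ↔ ∃ h : x ∈ p.carrier, (⟨x, h⟩ : p.carrier) ∈ I := by
  constructor
  · rintro ⟨y, hy, rfl⟩
    exact ⟨y.2, hy⟩
  · rintro ⟨h, hx⟩
    exact ⟨⟨x, h⟩, hx, rfl⟩

lemma lie_mem_idealAsModule {I : LieIdeal ℂ p.carrier} {x y : g} (hx : x ∈ p.carrier)
    (hy : y ∈ p.idealAsModule I) : ⁅x, y⁆ ∈ p.idealAsModule I := by
  obtain ⟨h, hy⟩ := p.mem_idealAsModule.1 hy
  exact p.mem_idealAsModule.2 ⟨p.carrier.lie_mem hx h, I.lie_mem (x := ⟨x, hx⟩) hy⟩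

lemma exists_root_apply_ne_zero {h : H} (hh : h ≠ 0) : ∃ α : H.root, α.1 h ≠ 0 := by
  by_contra! hc
  apply hh
  have : h ∈ (⨅ α : Weight ℂ H g, α.ker : Submodule ℂ H) := by
    rw [Submodule.mem_iInf]
    intro α
    by_cases hα : α.IsZero
    · simp [Weight.ker, hα.eq]
    · exact hc ⟨α, by simpa using hα⟩
  rw [iInf_ker_weight_eq_bot] at this
  simpa using this

lemma exists_ne_zero_mem (α : H.root) : ∃ e ∈ rootSpace H α.1, e ≠ 0 :=
  α.1.exists_ne_zero

/-- A nilpotent ideal of a parabolic subalgebra meets the Cartan subalgebra trivially. -/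
lemma eq_zero_of_mem_cartan {I : LieIdeal ℂ p.carrier} (hI : LieRing.IsNilpotent I) {h : g}
    (hH : h ∈ H) (hh : h ∈ p.idealAsModule I) : h = 0 := by
  by_contra hne
  obtain ⟨α, hα⟩ := exists_root_apply_ne_zero (h := (⟨h, hH⟩ : H)) (fun h0 => hne (congrArg Subtype.val h0))
  obtain ⟨β, hβ, hpos⟩ : ∃ β : H.root, β.1 ⟨h, hH⟩ ≠ 0 ∧ b.IsPos β := by
    rcases isPos_or_neg (b := b) α with hp | hp
    · exact ⟨α, hα, hp⟩
    · exact ⟨negRoot α, by simpa [negRoot] using hα, hp⟩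
  obtain ⟨e, he, he0⟩ := exists_ne_zero_mem β
  have hep := p.rootSpace_le_of_isPos hpos he
  have hlie : ⁅h, e⁆ = β.1 ⟨h, hH⟩ • e := lie_eq_smul_of_mem_rootSpace he ⟨h, hH⟩
  have heI : e ∈ p.idealAsModule I := by
    have h1 : ⁅e, h⁆ ∈ p.idealAsModule I := p.lie_mem_idealAsModule hep hh
    have h2 : e = -(β.1 ⟨h, hH⟩)⁻¹ • ⁅e, h⁆ := by
      rw [← lie_skew, hlie, smul_neg, neg_smul, neg_neg, smul_smul, inv_mul_cancel₀ hβ, one_smul]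
    rw [h2]
    exact Submodule.smul_mem _ _ h1
  obtain ⟨h1, hhI⟩ := p.mem_idealAsModule.1 hh
  obtain ⟨_, heI⟩ := p.mem_idealAsModule.1 heI
  obtain ⟨k, hk⟩ := LieAlgebra.nilpotent_ad_of_nilpotent_algebra ℂ I
  let h' : I := ⟨⟨h, h1⟩, hhI⟩
  let e' : I := ⟨⟨e, hep⟩, heI⟩
  have hb : ⁅h', e'⁆ = β.1 ⟨h, hH⟩ • e' := Subtype.ext (Subtype.ext hlie)
  have hpow : ∀ m : ℕ, (LieAlgebra.ad ℂ I h' ^ m) e' = (β.1 ⟨h, hH⟩) ^ m • e' := by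
    intro m
    induction m with
    | zero => simp
    | succ m ih =>
      rw [pow_succ', Module.End.mul_apply, ih, map_smul, LieAlgebra.ad_apply, hb, smul_smul,
        pow_succ]
  have h0 := hpow k
  rw [hk h', LinearMap.zero_apply] at h0
  have := smul_eq_zero.1 h0.symm
  rcases this with h3 | h3
  · exact pow_ne_zero k hβ h3
  · exact he0 (congrArg (fun z : I => ((z : p.carrier) : g)) h3)

lemma rootSpace_le_of_mem {N : LieSubmodule ℂ H g} {α : H.root} {x : g} (hx : x ∈ N)
    (hα : x ∈ rootSpace H α.1) (hx0 : x ≠ 0) : rootSpace H α.1 ≤ N := by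
  intro y hy
  obtain ⟨r, hr⟩ := (finrank_eq_one_iff_of_nonzero' (⟨x, hα⟩ : rootSpace H α.1)
    (by simpa using hx0)).1 (finrank_rootSpace_eq_one α.1 (LieSubalgebra.isNonZero_coe_root α))
    ⟨y, hy⟩
  have : y = r • x := (congrArg Subtype.val hr).symm
  rw [this]
  exact N.smul_mem r hx

/-- The sum of the root spaces of the roots `α` such that `α` but not `-α` is a root of the
parabolic subalgebra. -/
def unipotentPart : Submodule ℂ g :=
  ⨆ α : H.root, ⨆ _ : ¬ (rootSpace H (negRoot α).1).toSubmodule ≤ p.carrier.toSubmodule,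
    ⨆ _ : (rootSpace H α.1).toSubmodule ≤ p.carrier.toSubmodule, (rootSpace H α.1).toSubmodule

lemma idealAsModule_le {I : LieIdeal ℂ p.carrier} (hI : LieRing.IsNilpotent I) :
    (p.idealAsModule I).toSubmodule ≤ p.unipotentPart := by
  have key := eq_iSup_inf_genWeightSpace ℂ H g (p.idealAsModule I)
  rw [key, LieSubmodule.iSup_toSubmodule]
  refine iSup_le fun χ => ?_
  rintro x ⟨hxI, hxχ⟩
  by_cases hx0 : x = 0
  · rw [hx0]; exact Submodule.zero_mem _
  by_cases hχ : χ.IsZero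
  · exfalso
    apply hx0
    refine p.eq_zero_of_mem_cartan hI ?_ hxI
    have : x ∈ rootSpace H (0 : H → ℂ) := by rw [← hχ.eq]; exact hxχ
    rwa [rootSpace_zero_eq ℂ g H] at this
  · let α : H.root := ⟨χ, by simpa using hχ⟩
    have hle : rootSpace H α.1 ≤ p.idealAsModule I :=
      rootSpace_le_of_mem (α := α) hxI hxχ hx0
    have hlep : (rootSpace H α.1).toSubmodule ≤ p.carrier.toSubmodule := fun y hy =>
      (p.mem_idealAsModule.1 (hle hy)).1
    have hneg : ¬ (rootSpace H (negRoot α).1).toSubmodule ≤ p.carrier.toSubmodule := by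
      intro hn
      obtain ⟨h, e, f, ht, he, hf⟩ := exists_isSl2Triple_of_weight_isNonZero hχ
      have hmem : h ∈ p.idealAsModule I := by
        rw [← ht.lie_e_f, ← lie_skew]
        exact neg_mem (p.lie_mem_idealAsModule (hn hf) (hle he))
      refine ht.h_ne_zero (p.eq_zero_of_mem_cartan hI ?_ hmem)
      rw [ht.h_eq_coroot hχ he hf]
      exact (coroot χ).2
    refine Submodule.mem_iSup_of_mem α (Submodule.mem_iSup_of_mem hneg
      (Submodule.mem_iSup_of_mem hlep ?_))
    exact hxχ

lemma nil_le : p.nil.toSubmodule ≤ p.unipotentPart := by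
  intro x hx
  obtain ⟨h, hx⟩ := p.mem_nil.1 hx
  have : (nilradical p.carrier).toSubmodule ≤
      p.unipotentPart.comap p.carrier.toSubmodule.subtype := by
    rw [nilradical, LieSubmodule.sSup_toSubmodule]
    refine sSup_le ?_
    rintro _ ⟨I, hI, rfl⟩ y hy
    exact p.idealAsModule_le hI ⟨y, hy, rfl⟩
  exact this hx

/-- The Killing form of `g` vanishes on the nilradical of a parabolic subalgebra. -/
lemma killingForm_nil {x y : g} (hx : x ∈ p.nil) (hy : y ∈ p.nil) : killingForm ℂ g x y = 0 := by
  suffices h : p.unipotentPart ≤ (LinearMap.BilinForm.orthogonal (killingForm ℂ g)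
      p.unipotentPart) from
    LinearMap.BilinForm.mem_orthogonal_iff.1 (h (p.nil_le hy)) x (p.nil_le hx)
  refine iSup_le fun α => iSup₂_le fun hα hα' u hu => ?_
  rw [LinearMap.BilinForm.mem_orthogonal_iff]
  suffices h : p.unipotentPart ≤ LinearMap.ker ((killingForm ℂ g).flip u) from fun v hv => h hv
  refine iSup_le fun β => iSup₂_le fun hβ hβ' v hv => ?_
  refine killingForm_apply_eq_zero_of_mem_rootSpace_of_add_ne_zero ℂ g H hv hu ?_
  intro h0
  have : negRoot α = β := by
    apply Subtype.ext
    apply DFunLike.coe_injective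
    change -(α.1 : H → ℂ) = β.1
    exact (eq_neg_of_add_eq_zero_left h0).symm
  exact hα (this ▸ hβ')

/-- The derived subalgebra `[n, n]` is stable under the Cartan subalgebra. -/
def derivedAsModule : LieSubmodule ℂ H g where
  __ := (⁅(⊤ : LieIdeal ℂ p.nil), (⊤ : LieIdeal ℂ p.nil)⁆ : LieIdeal ℂ p.nil).toSubmodule.map
    p.nil.toSubmodule.subtype
  lie_mem := by
    rintro h _ ⟨y, hy, rfl⟩
    change y ∈ ⁅(⊤ : LieIdeal ℂ p.nil), (⊤ : LieIdeal ℂ p.nil)⁆ at hy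
    rw [← LieSubmodule.mem_toSubmodule, LieSubmodule.lieIdeal_oper_eq_linear_span'] at hy
    induction hy using Submodule.span_induction with
    | mem y hy =>
      obtain ⟨u, -, v, -, rfl⟩ := hy
      have hp := p.cartan_le h.2
      refine ⟨⁅(⟨⁅(h : g), (u : g)⁆, p.lie_mem_nil hp u.2⟩ : p.nil), v⁆ +
        ⁅u, (⟨⁅(h : g), (v : g)⁆, p.lie_mem_nil hp v.2⟩ : p.nil)⁆, ?_, ?_⟩
      · exact add_mem (LieSubmodule.lie_mem_lie (LieSubmodule.mem_top _) (LieSubmodule.mem_top _))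
          (LieSubmodule.lie_mem_lie (LieSubmodule.mem_top _) (LieSubmodule.mem_top _))
      · exact (leibniz_lie (h : g) (u : g) (v : g)).symm
    | zero => rw [map_zero, lie_zero]; exact Submodule.zero_mem _
    | add u v _ _ hu hv => rw [map_add, lie_add]; exact Submodule.add_mem _ hu hv
    | smul r u _ hu => rw [map_smul, lie_smul]; exact Submodule.smul_mem _ r hu

end ProperParabolic

/-! ### The one-dimensional module -/

/-- A choice of a non-zero element `X_α` in every root space. -/
structure RootVectors (H : LieSubalgebra ℂ g) [H.IsCartanSubalgebra] where
  vec : H.root → g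
  mem : ∀ α, vec α ∈ rootSpace H α.1
  ne_zero : ∀ α, vec α ≠ 0

namespace RootVectors

variable (X : RootVectors H)

/-- The coefficient of `X_α` in an element of `g`, with respect to the root space decomposition. It
is computed by pairing with `X_{-α}`. -/
def coeff (α : H.root) : g →ₗ[ℂ] ℂ :=
  (killingForm ℂ g (X.vec (negRoot α)) (X.vec α))⁻¹ • killingForm ℂ g (X.vec (negRoot α))

lemma killingForm_ne_zero (α : H.root) :
    killingForm ℂ g (X.vec (negRoot α)) (X.vec α) ≠ 0 := by
  intro h0
  have h1 : X.vec α ∈ LinearMap.ker (killingForm ℂ g) := by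
    refine mem_ker_killingForm_of_mem_rootSpace_of_forall_rootSpace_neg ℂ g H (X.mem α) ?_
    intro y hy
    have hy' : y ∈ rootSpace H (negRoot α).1 := hy
    obtain ⟨r, hr⟩ := (finrank_eq_one_iff_of_nonzero'
      (⟨X.vec (negRoot α), X.mem _⟩ : rootSpace H (negRoot α).1)
      (by simpa using X.ne_zero (negRoot α))).1
      (finrank_rootSpace_eq_one _ (LieSubalgebra.isNonZero_coe_root (negRoot α))) ⟨y, hy'⟩
    have hyr : y = r • X.vec (negRoot α) := (congrArg Subtype.val hr).symm
    rw [hyr, map_smul, LieModule.traceForm_comm, h0, smul_zero]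
  rw [IsKilling.ker_killingForm_eq_bot] at h1
  exact X.ne_zero α (by simpa using h1)

lemma coeff_self (α : H.root) : X.coeff α (X.vec α) = 1 := by
  simpa [coeff] using inv_mul_cancel₀ (X.killingForm_ne_zero α)

lemma coeff_eq_zero {α : H.root} {χ : H → ℂ} (hχ : χ ≠ α.1) {x : g} (hx : x ∈ rootSpace H χ) :
    X.coeff α x = 0 := by
  have : killingForm ℂ g (X.vec (negRoot α)) x = 0 := by
    refine killingForm_apply_eq_zero_of_mem_rootSpace_of_add_ne_zero ℂ g H (X.mem _) hx ?_
    intro h0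
    apply hχ
    change -(α.1 : H → ℂ) + χ = 0 at h0
    exact (neg_add_eq_zero.1 h0).symm
  simp [coeff, this]

lemma coeff_vec_of_ne {α β : H.root} (h : β ≠ α) : X.coeff α (X.vec β) = 0 :=
  X.coeff_eq_zero (fun h' => h (Subtype.ext (DFunLike.coe_injective h'))) (X.mem β)

variable {b : (rootSystem H).Base} (p : ProperParabolic b)

lemma coeff_lie {α : H.root} (hα : α ∈ p.rootsZero) (x y : p.nil) :
    X.coeff α ⁅(x : g), (y : g)⁆ = 0 := by
  have hmem : ⁅(x : g), (y : g)⁆ ∈ p.derivedAsModule :=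
    ⟨⁅x, y⁆, LieSubmodule.lie_mem_lie (LieSubmodule.mem_top _) (LieSubmodule.mem_top _), rfl⟩
  have key := eq_iSup_inf_genWeightSpace ℂ H g p.derivedAsModule
  suffices h : p.derivedAsModule.toSubmodule ≤ LinearMap.ker (X.coeff α) from h hmem
  rw [key, LieSubmodule.iSup_toSubmodule]
  refine iSup_le fun χ => ?_
  rintro z ⟨⟨w, hw, rfl⟩, hz⟩
  by_cases hχ : χ = α.1
  · subst hχ
    by_cases hw0 : w = 0
    · rw [hw0]; simp
    · exfalso
      exact hα.2 ⟨w, hw, hw0, hz⟩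
  · exact X.coeff_eq_zero (fun h' => hχ (DFunLike.coe_injective h')) hz

end RootVectors
end Parabolic

/-- Strong genericity of a multiset of elements of `ℂ^ℤ`, given as a family `Q`: all the
`ℤ`-translates `(Q k (i + n))_i` of all members together with all the `(i Q k i)_i` form a linearly
independent family. -/
def StronglyGeneric {ι : Type*} (Q : ι → ℤ → ℂ) : Prop :=
  LinearIndependent ℂ (Sum.elim
    (fun (k : ι × ℤ) (i : ℤ) => Q k.1 (i + k.2))
    (fun (k : ι) (i : ℤ) => (i : ℂ) * Q k i))

/-- The linear functional on a loop algebra with `x ⊗ t ^ i ↦ a i * f x`. -/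
def loopFunctional {L : Type*} [LieRing L] [LieAlgebra ℂ L] (a : ℤ → ℂ) (f : L →ₗ[ℂ] ℂ) :
    Loop L →ₗ[ℂ] ℂ :=
  TensorProduct.lift ((AddMonoidAlgebra.basis ℤ ℂ).constr ℂ fun i => a i • f)

lemma loopFunctional_loopElt {L : Type*} [LieRing L] [LieAlgebra ℂ L] (a : ℤ → ℂ) (f : L →ₗ[ℂ] ℂ)
    (x : L) (i : ℤ) : loopFunctional a f (loopElt i x) = a i * f x := by
  change ((AddMonoidAlgebra.basis ℤ ℂ).constr ℂ fun i => a i • f)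
    (AddMonoidAlgebra.single i (1 : ℂ)) x = _
  have h := (AddMonoidAlgebra.basis ℤ ℂ).constr_basis ℂ (fun i => a i • f) i
  have h2 : (AddMonoidAlgebra.basis ℤ ℂ) i = AddMonoidAlgebra.single i (1 : ℂ) := by simp
  rw [h2] at h
  rw [h, LinearMap.smul_apply, smul_eq_mul]

section Induction

/-- The tensor product `B ⊗_A V` over a possibly noncommutative algebra `A`, where `B` is a right
`A`-module through `φ : A → B` and `V` is the left `A`-module given by `ρ`: the quotient of
`B ⊗_ℂ V` by all the `(u φ(a)) ⊗ v - u ⊗ (a v)`. It is a left `B`-module. -/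
abbrev TensorOver {A B V : Type*} [Ring A] [Algebra ℂ A] [Ring B] [Algebra ℂ B] [AddCommGroup V]
    [Module ℂ V] (φ : A →ₐ[ℂ] B) (ρ : A →ₐ[ℂ] Module.End ℂ V) : Type _ :=
  (B ⊗[ℂ] V) ⧸ Submodule.span B
    {z : B ⊗[ℂ] V | ∃ (u : B) (a : A) (v : V), z = (u * φ a) ⊗ₜ[ℂ] v - u ⊗ₜ[ℂ] (ρ a v)}

attribute [local instance] LieRing.ofAssociativeRing

/-- The algebra `U_θ`, the quotient of the universal enveloping algebra of the affine Lie algebra by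
the two-sided ideal generated by `c - θ`. -/
abbrev UTheta (g : Type*) [LieRing g] [LieAlgebra ℂ g] (θ : ℂ) : Type _ :=
  RingQuot fun x y : UniversalEnvelopingAlgebra ℂ (Affine g) =>
    x = UniversalEnvelopingAlgebra.ι ℂ (Affine.c g) ∧ y = algebraMap ℂ _ θ

variable {g : Type*} [LieRing g] [LieAlgebra ℂ g] [FiniteDimensional ℂ g]
  [LieAlgebra.IsSimple ℂ g] {H : LieSubalgebra ℂ g} [H.IsCartanSubalgebra]
  {b : (rootSystem H).Base} (p : ProperParabolic b)

/-- The inclusion `L(n) → L(g)`. -/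
def loopIncl : Loop p.nil →ₗ[ℂ] Loop g :=
  LinearMap.lTensor (AddMonoidAlgebra ℂ ℤ) p.nil.toSubmodule.subtype

lemma loopIncl_loopElt (x : p.nil) (i : ℤ) : loopIncl p (loopElt i x) = loopElt i (x : g) := rfl

lemma loopIncl_lie (x y : Loop p.nil) : loopIncl p ⁅x, y⁆ = ⁅loopIncl p x, loopIncl p y⁆ := by
  induction x using loop_induction with
  | h0 => simp
  | hadd x x' h h' => simp only [add_lie, map_add, h, h']
  | hs x i =>
    induction y using loop_induction with
    | h0 => simp
    | hadd y y' h h' => simp only [lie_add, map_add, h, h']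
    | hs y j => simp only [loopElt_lie, loopIncl_loopElt, LieSubalgebra.coe_bracket]

lemma loopCocycle_loopIncl (x y : Loop p.nil) :
    loopCocycle g (loopIncl p x) (loopIncl p y) = 0 := by
  induction x using loop_induction with
  | h0 => simp
  | hadd x x' h h' => simp only [map_add, LinearMap.add_apply, h, h', add_zero]
  | hs x i =>
    induction y using loop_induction with
    | h0 => simp
    | hadd y y' h h' => simp only [map_add, h, h', add_zero]
    | hs y j =>
      rw [loopIncl_loopElt, loopIncl_loopElt, loopCocycle_loopElt, p.killingForm_nil x.2 y.2]
      simp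

/-- The inclusion of `L(n)` in the affine Lie algebra. -/
def loopInclAffine : Loop p.nil →ₗ⁅ℂ⁆ Affine g where
  toFun x := ⟨loopIncl p x, 0, 0⟩
  map_add' x y := by ext <;> simp
  map_smul' r x := by ext <;> simp
  map_lie' {x y} := by
    ext
    · simp [loopIncl_lie]
    · simp
    · simp [loopCocycle_loopIncl]

/-- The algebra homomorphism `U(L(n)) → U_θ` induced by the inclusion of `L(n)` in the affine Lie
algebra. -/
def envelopingIncl (θ : ℂ) : UniversalEnvelopingAlgebra ℂ (Loop p.nil) →ₐ[ℂ] UTheta g θ :=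
  (RingQuot.mkAlgHom ℂ _).comp (UniversalEnvelopingAlgebra.lift ℂ
    ((UniversalEnvelopingAlgebra.ι ℂ).comp (loopInclAffine p)))

variable (X : RootVectors H) (Λ : p.rootsZero → ℤ → ℂ)

/-- The linear functional on `L(n)` given by `X_α ⊗ t ^ j ↦ Λ(α)_j` for `α` in `Φ_n⁰` and by
`X_α ⊗ t ^ j ↦ 0` for the other roots `α` of `n`. -/
def whittakerFunctional : Loop p.nil →ₗ[ℂ] ℂ :=
  ∑ᶠ α : p.rootsZero, loopFunctional (Λ α) (X.coeff α.1 ∘ₗ p.nil.toSubmodule.subtype)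

lemma whittakerFunctional_loopElt (x : p.nil) (j : ℤ) :
    whittakerFunctional p X Λ (loopElt j x) =
      ∑ᶠ α : p.rootsZero, Λ α j * X.coeff α.1 (x : g) := by
  have := Fintype.ofFinite p.rootsZero
  rw [whittakerFunctional, finsum_eq_sum_of_fintype, finsum_eq_sum_of_fintype,
    LinearMap.sum_apply]
  exact Finset.sum_congr rfl fun α _ => loopFunctional_loopElt _ _ _ _

lemma whittakerFunctional_lie (x y : Loop p.nil) : whittakerFunctional p X Λ ⁅x, y⁆ = 0 := by
  induction x using loop_induction with
  | h0 => simp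
  | hadd x x' h h' => simp only [add_lie, map_add, h, h', add_zero]
  | hs x i =>
    induction y using loop_induction with
    | h0 => simp
    | hadd y y' h h' => simp only [lie_add, map_add, h, h', add_zero]
    | hs y j =>
      rw [loopElt_lie, whittakerFunctional_loopElt]
      refine finsum_eq_zero_of_forall_eq_zero fun α => ?_
      rw [LieSubalgebra.coe_bracket, X.coeff_lie p α.2 x y, mul_zero]

/-- The Lie algebra homomorphism `L(n) → ℂ` by which `L(n)` acts on the one-dimensional module
`ℂ_Λ`. -/
def whittakerCharacter : Loop p.nil →ₗ⁅ℂ⁆ ℂ where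
  __ := whittakerFunctional p X Λ
  map_lie' {x y} := by
    rw [LieRing.of_associative_ring_bracket, mul_comm, sub_self]
    exact whittakerFunctional_lie p X Λ x y

/-- The element `X_α ⊗ t ^ j` acts by `Λ(α)_j`, for `α` in `Φ_n⁰`. -/
lemma whittakerCharacter_loopElt (α : p.rootsZero) (hα : X.vec α.1 ∈ p.nil) (j : ℤ) :
    whittakerCharacter p X Λ (loopElt j ⟨X.vec α.1, hα⟩) = Λ α j := by
  refine (whittakerFunctional_loopElt p X Λ ⟨X.vec α.1, hα⟩ j).trans ?_
  rw [finsum_eq_single _ α, X.coeff_self, mul_one]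
  intro β hβ
  rw [X.coeff_vec_of_ne (fun h => hβ (Subtype.ext h.symm)), mul_zero]

/-- The root vectors of the roots appearing in `n` lie in `n`. -/
lemma vec_mem_nil {α : H.root} (hα : α ∈ p.roots) : X.vec α ∈ p.nil := by
  obtain ⟨x, hx, hx0, hxα⟩ := hα
  obtain ⟨r, hr⟩ := (finrank_eq_one_iff_of_nonzero' (⟨x, hxα⟩ : rootSpace H α.1)
    (by simpa using hx0)).1 (finrank_rootSpace_eq_one α.1 (LieSubalgebra.isNonZero_coe_root α))
    ⟨X.vec α, X.mem α⟩
  have : X.vec α = r • x := (congrArg Subtype.val hr).symm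
  rw [this]
  exact p.nil.smul_mem r hx

/-- The one-dimensional `U(L(n))`-module `ℂ_Λ`. -/
def whittakerRep : UniversalEnvelopingAlgebra ℂ (Loop p.nil) →ₐ[ℂ] Module.End ℂ ℂ :=
  (Algebra.lmul ℂ ℂ).comp (UniversalEnvelopingAlgebra.lift ℂ (whittakerCharacter p X Λ))

/-- The induced Whittaker module `M(Λ, θ) = U_θ ⊗_{U(L(n))} ℂ_Λ`. -/
abbrev WhittakerModule (θ : ℂ) : Type _ :=
  TensorOver (envelopingIncl p θ) (whittakerRep p X Λ)

end Induction

end WhittakerInduction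

end

/-!
# Simplicity of strongly generic Whittaker modules

The induced module is generated by a vector `w` on which `L(n)` acts by a character `ψ`. The proof
shows that `w` is non-zero and that every non-zero submodule contains `w`.

The parabolic subalgebra is `g_{≥ 0}` for a grading `g = ⨁ g_k`, given by an element of the Cartan
subalgebra, for which `n = g_{≥ 1}` is generated by `g_1` and `Φ_n⁰` is the set of the roots of
degree one (`ProperParabolic.nil_eq_grOn`, `ProperParabolic.mem_rootsZero_iff`). Since `g` is simple,
an element of `g_k` with `k ≤ 0` which commutes with `g_1` is zero
(`ProperParabolic.eq_zero_of_lie_gr_one`).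

*Submodules contain `w`.* As for finite `W`-algebras, give `g_{-k} ⊗ ℂ[t, t⁻¹]` the Kazhdan weight
`k + 1`, and `d` the weight one. The module is filtered by the weights of the words, in the basis
elements of `L(g_{≤ 0}) ⊕ ℂ d`, which are applied to `w`. For `x` in `g_1 ⊗ ℂ[t, t⁻¹]` the operator
`x - ψ(x)` lowers the filtration by one, and on symbols, which are polynomials in the basis
elements, it is a derivation. It sends a variable `y` of weight one to the scalar `ψ([x, y])`, and a
variable `y` of higher weight to the linear form `[x, y]`. The common kernel of these derivations
consists of the constants (`MvPolynomial.eq_C_of_forall_mkDerivation_eq_zero`): for the variables of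
higher weight take `x = e ⊗ t ^ n`, with `n` so large that `[x, y]` involves new variables
(`ProperParabolic.eq_zero_of_weight_ne_one`); for those of weight one, linear independence of the
functions `ψ([x, y])` of `x` is what strong genericity says (`StronglyGeneric.eq_zero`). So an element
of least filtration degree in a non-zero submodule is a multiple of `w`
(`KazhdanData.w_mem_of_ne_bot`). The same argument shows by induction on the degree that a symbol is
determined by its vector, so that the Poincaré–Birkhoff–Witt theorem is not needed.

*`w` is non-zero.* It suffices to construct some module of level `θ` with a non-zero Whittaker vector
for `ψ` (`exists_whittaker_vector`). If a Lie algebra is the direct sum of two subalgebras `N` and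
`Q`, a character of `N` extends to an action on `U(Q)`, on which `Q` acts by left multiplication
(`exists_induced_of_isCompl`). This is applied to `N = L(n)` and `Q = L(g_{≤ 0}) ⊕ ℂ d ⊕ ℂ c`. The
quotient of `U(Q)` by `c - θ` is non-zero, because `Q` acts on the vacuum module of level `θ`, which
is obtained in the same way from `N = g[t] ⊕ ℂ d ⊕ ℂ c` and `Q = t⁻¹ g[t⁻¹]` (`exists_vacuum`).
-/

open scoped TensorProduct

noncomputable section

/-! ### Derivations of polynomial algebras without non-trivial common constants -/

namespace MvPolynomial

/-- A polynomial over a field of characteristic zero all of whose partial derivatives vanish is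
constant. -/
lemma eq_C_of_pderiv_eq_zero {σ k : Type*} [Field k] [CharZero k] {f : MvPolynomial σ k}
    (h : ∀ i, pderiv i f = 0) : f = C (coeff 0 f) := by
  classical
  ext s
  rw [coeff_C]
  split_ifs with hs
  · rw [hs]
  · obtain ⟨i, hi⟩ : ∃ i, s i ≠ 0 := by
      by_contra! hc
      exact hs (Finsupp.ext fun i => (hc i).symm)
    have h1 := congrArg (coeff (s - Finsupp.single i 1)) (h i)
    have h2 : s - Finsupp.single i 1 + Finsupp.single i 1 = s :=
      tsub_add_cancel_of_le (by simpa [Nat.one_le_iff_ne_zero] using hi)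
    rw [coeff_pderiv, h2, coeff_zero] at h1
    exact (mul_eq_zero.1 h1).resolve_right (Nat.cast_add_one_ne_zero _)

lemma mkDerivation_eq_sum {σ k : Type*} [Field k] (d : σ → MvPolynomial σ k)
    {f : MvPolynomial σ k} {S : Finset σ} (hS : f.vars ⊆ S) :
    mkDerivation k d f = ∑ i ∈ S, pderiv i f * d i := by
  classical
  have h1 : ∀ i ∉ S, pderiv i f = 0 := fun i hi =>
    pderiv_eq_zero_of_notMem_vars fun h => hi (hS h)
  let D' : Derivation k (MvPolynomial σ k) (MvPolynomial σ k) :=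
    ∑ i ∈ S, d i • pderiv i
  have h2 : mkDerivation k d f = D' f := by
    refine derivation_eq_of_forall_mem_vars fun i hi => ?_
    have : (⇑D' : _ → _) = ∑ i ∈ S, ⇑(d i • pderiv (R := k) i) := by
      change (Derivation.coeFnAddMonoidHom D' : _ → _) = _
      rw [map_sum]; rfl
    rw [mkDerivation_X, this, Finset.sum_apply, Finset.sum_eq_single i]
    · simp
    · intro j _ hj
      simp [pderiv_X_of_ne hj.symm]
    · intro h; exact absurd (hS hi) h
  have : (⇑D' : _ → _) = ∑ i ∈ S, ⇑(d i • pderiv (R := k) i) := by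
    change (Derivation.coeFnAddMonoidHom D' : _ → _) = _
    rw [map_sum]; rfl
  rw [h2, this, Finset.sum_apply]
  exact Finset.sum_congr rfl fun i _ => by simp [mul_comm]

/-- A criterion for the common constants of a family of derivations `D t` to be scalars. The
variables are divided in two kinds: `D t` sends a variable of the first kind (`p i`) to a scalar
and a variable of the second kind to a linear form. The second hypothesis says that, even if only
those `t` are used that send a given finite set of variables of the second kind to linear forms in
fresh variables, no linear combination of these variables is killed. -/
lemma eq_C_of_forall_mkDerivation_eq_zero {σ k T : Type*} [Field k] [CharZero k] (p : σ → Prop)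
    (d : T → σ → MvPolynomial σ k) (β : T → σ → k) (α : T → σ → σ →₀ k)
    (hβ : ∀ t i, p i → d t i = C (β t i))
    (hα : ∀ t i, ¬ p i → d t i = (α t i).sum fun j a => a • X j)
    (h1 : ∀ (S : Finset σ) (a : σ → k), (∀ i ∈ S, p i) → (∀ t, ∑ i ∈ S, a i * β t i = 0) →
      ∀ i ∈ S, a i = 0)
    (h2 : ∀ (S S' : Finset σ) (a : σ → k), (∀ i ∈ S, ¬ p i) →
      (∀ t, (∀ i ∈ S, Disjoint (α t i).support S') → ∑ i ∈ S, a i • α t i = 0) →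
      ∀ i ∈ S, a i = 0)
    {f : MvPolynomial σ k} (hf : ∀ t, mkDerivation k (d t) f = 0) : f = C (coeff 0 f) := by
  classical
  have hD : ∀ t, ∑ i ∈ f.vars with p i, pderiv i f * d t i +
      ∑ i ∈ f.vars with ¬ p i, pderiv i f * d t i = 0 := fun t => by
    rw [Finset.sum_filter_add_sum_filter_not, ← mkDerivation_eq_sum (d t) subset_rfl, hf]
  have hvars : ∀ i j, j ∉ f.vars → pderiv j (pderiv i f) = 0 := fun i j hj => by
    ext s
    have h3 := congrArg (coeff (s + Finsupp.single i 1)) (pderiv_eq_zero_of_notMem_vars hj)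
    rw [coeff_pderiv, coeff_zero, mul_eq_zero] at h3
    have h4 := h3.resolve_right (Nat.cast_add_one_ne_zero _)
    rw [coeff_pderiv, coeff_pderiv, add_right_comm, h4, zero_mul, zero_mul, coeff_zero]
  -- Variables of the second kind do not occur: differentiate by a fresh variable.
  have hnot : ∀ i ∈ f.vars.filter (fun i => ¬ p i), pderiv i f = 0 := by
    intro i hi
    ext s
    refine h2 (f.vars.filter fun i => ¬ p i) f.vars (fun i => coeff s (pderiv i f)) (by simp)
      (fun t ht => ?_) i hi
    ext j
    rw [Finsupp.finsetSum_apply, Finsupp.zero_apply]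
    by_cases hj : j ∈ f.vars
    · refine Finset.sum_eq_zero fun i hi => ?_
      have : α t i j = 0 := Finsupp.notMem_support_iff.1 fun h =>
        Finset.disjoint_left.1 (ht i hi) h hj
      simp [this]
    · have h3 := congrArg (fun q => coeff s (pderiv j q)) (hD t)
      simp only [map_add, map_sum, pderiv_mul, hvars _ j hj, zero_mul, zero_add, map_zero,
        coeff_zero, coeff_add] at h3
      rw [Finset.sum_eq_zero, coeff_zero, zero_add, coeff_sum] at h3
      · rw [← h3]
        refine Finset.sum_congr rfl fun i hi => ?_
        rw [hα t i (Finset.mem_filter.1 hi).2, Finsupp.smul_apply, smul_eq_mul]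
        have : pderiv j ((α t i).sum fun j a => a • (X j : MvPolynomial σ k)) = C (α t i j) := by
          rw [Finsupp.sum, map_sum, Finset.sum_eq_single j]
          · simp [smul_eq_C_mul]
          · intro l _ hl
            simp [pderiv_X_of_ne hl]
          · intro hl
            simp [Finsupp.notMem_support_iff.1 hl]
        rw [this, mul_comm (pderiv i f), coeff_C_mul, mul_comm]
      · intro i hi
        rw [hβ t i (Finset.mem_filter.1 hi).2, pderiv_C, mul_zero]
  refine eq_C_of_pderiv_eq_zero fun i => ?_
  by_cases hi : i ∈ f.vars
  swap
  · exact pderiv_eq_zero_of_notMem_vars hi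
  by_cases hpi : p i
  swap
  · exact hnot i (Finset.mem_filter.2 ⟨hi, hpi⟩)
  ext s
  refine h1 (f.vars.filter p) (fun i => coeff s (pderiv i f)) (by simp) (fun t => ?_) i
    (Finset.mem_filter.2 ⟨hi, hpi⟩)
  have h3 := congrArg (coeff s) (hD t)
  rw [Finset.sum_eq_zero (s := f.vars.filter fun i => ¬ p i), add_zero, coeff_sum,
    coeff_zero] at h3
  · rw [← h3]
    refine Finset.sum_congr rfl fun i hi => ?_
    rw [hβ t i (Finset.mem_filter.1 hi).2, mul_comm (pderiv i f), coeff_C_mul, mul_comm]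
  · intro i hi
    rw [hnot i hi, zero_mul]

end MvPolynomial

namespace WhittakerInduction

/-! ### The Kazhdan filtration of a module generated by a Whittaker vector -/

/-- A representation `ρ` of a Lie algebra `L` with a Whittaker vector `w`, together with a Kazhdan
filtration: an increasing filtration `K` of `L` with `[K r, K s] ⊆ K (r + s - 1)`, such that
`K 0` acts on `w` by the scalars `ψ`, with `ψ` zero on `K (-1)`. The elements `y i`, of weight
`wt i ≥ 1`, span `L` modulo `K 0` compatibly with the filtration. The elements `x t` of `K 0` are
the ones used to lower the degree; the linear form `α t i` describes `[x t, y i]` modulo lower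
terms if the weight of `y i` is not one. -/
structure KazhdanData (k L M I T : Type*) [Field k] [LieRing L] [LieAlgebra k L]
    [AddCommGroup M] [Module k M] where
  ρ : L →ₗ[k] Module.End k M
  ρ_lie : ∀ x y m, ρ ⁅x, y⁆ m = ρ x (ρ y m) - ρ y (ρ x m)
  w : M
  K : ℤ → Submodule k L
  K_mono : Monotone K
  K_exhaustive : ∀ z, ∃ r, z ∈ K r
  K_lie : ∀ {r s u v}, u ∈ K r → v ∈ K s → ⁅u, v⁆ ∈ K (r + s - 1)
  y : I → L
  wt : I → ℤ
  one_le_wt : ∀ i, 1 ≤ wt i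
  y_mem : ∀ i, y i ∈ K (wt i)
  K_le : ∀ r, K r ≤ Submodule.span k (y '' {i | wt i ≤ r}) ⊔ K 0
  ψ : L →ₗ[k] k
  ρ_w : ∀ z ∈ K 0, ρ z w = ψ z • w
  ψ_eq_zero : ∀ z ∈ K (-1), ψ z = 0
  x : T → L
  x_mem : ∀ t, x t ∈ K 0
  α : T → I → I →₀ k
  wt_of_α : ∀ t i, wt i ≠ 1 → ∀ j ∈ (α t i).support, wt j = wt i - 1
  lie_x_y : ∀ t i, wt i ≠ 1 → ⁅x t, y i⁆ - (α t i).sum (fun j a => a • y j) ∈ K (wt i - 2)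

namespace KazhdanData

variable {k L M I T : Type*} [Field k] [LieRing L] [LieAlgebra k L]
  [AddCommGroup M] [Module k M] (D : KazhdanData k L M I T)

/-- The vector `y i₁ ⋯ y iₙ w`. -/
def word (l : List I) : M := l.foldr (fun i m => D.ρ (D.y i) m) D.w

@[simp] lemma word_nil : D.word [] = D.w := rfl

@[simp] lemma word_cons (i : I) (l : List I) : D.word (i :: l) = D.ρ (D.y i) (D.word l) := rfl

/-- The total weight of a word. -/
def wordWt (l : List I) : ℤ := (l.map D.wt).sum

@[simp] lemma wordWt_nil : D.wordWt [] = 0 := rfl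

@[simp] lemma wordWt_cons (i : I) (l : List I) : D.wordWt (i :: l) = D.wt i + D.wordWt l := by
  simp [wordWt]

lemma wordWt_nonneg (l : List I) : 0 ≤ D.wordWt l := by
  induction l with
  | nil => simp
  | cons i l ih => have := D.one_le_wt i; simp; omega

/-- The Kazhdan filtration of the module. -/
def F (m : ℤ) : Submodule k M := Submodule.span k (D.word '' {l | D.wordWt l ≤ m})

lemma F_mono {m m' : ℤ} (h : m ≤ m') : D.F m ≤ D.F m' :=
  Submodule.span_mono (Set.image_mono fun _ hl => le_trans hl h)

lemma word_mem (l : List I) : D.word l ∈ D.F (D.wordWt l) :=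
  Submodule.subset_span ⟨l, le_refl (D.wordWt l), rfl⟩

lemma word_mem_of_le {l : List I} {m : ℤ} (h : D.wordWt l ≤ m) : D.word l ∈ D.F m :=
  D.F_mono h (D.word_mem l)

lemma F_eq_bot {m : ℤ} (hm : m < 0) : D.F m = ⊥ := by
  rw [F, Submodule.span_eq_bot]
  rintro _ ⟨l, hl, rfl⟩
  have := D.wordWt_nonneg l
  simp only [Set.mem_ofPred_eq] at hl
  omega

lemma map_mem_of_word {f : M →ₗ[k] M} {m : ℤ} {N : Submodule k M}
    (h : ∀ l, D.wordWt l ≤ m → f (D.word l) ∈ N) {v : M} (hv : v ∈ D.F m) : f v ∈ N := by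
  have : D.F m ≤ N.comap f := by
    rw [F, Submodule.span_le]
    rintro _ ⟨l, hl, rfl⟩
    exact h l hl
  exact this hv

lemma ρ_y_mem (i : I) {m m' : ℤ} {v : M} (hv : v ∈ D.F m) (h : m + D.wt i ≤ m') :
    D.ρ (D.y i) v ∈ D.F m' :=
  D.map_mem_of_word (fun l hl => by
    rw [← D.word_cons]
    exact D.word_mem_of_le (by simp; omega)) hv

lemma ρ_word_mem (l : List I) : ∀ {r : ℤ} {z : L}, z ∈ D.K r →
    D.ρ z (D.word l) ∈ D.F (D.wordWt l + r) := by
  induction l with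
  | nil =>
    intro r z hz
    have key : ∀ {r : ℤ} {z : L}, r ≤ 0 → z ∈ D.K r → D.ρ z D.w ∈ D.F r := by
      intro r z hr hz
      rw [D.ρ_w z (D.K_mono hr hz)]
      rcases hr.eq_or_lt with rfl | hr
      · exact Submodule.smul_mem _ _ (D.word_mem [])
      · rw [D.ψ_eq_zero z (D.K_mono (by omega) hz), zero_smul]
        exact Submodule.zero_mem _
    rw [wordWt_nil, zero_add, word_nil]
    rcases le_or_gt r 0 with hr | hr
    · exact key hr hz
    · have h : Submodule.span k (D.y '' {i | D.wt i ≤ r}) ⊔ D.K 0 ≤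
          (D.F r).comap (D.ρ.flip D.w) := by
        refine sup_le ?_ fun z hz => D.F_mono hr.le (key le_rfl hz)
        rw [Submodule.span_le]
        rintro _ ⟨i, hi, rfl⟩
        exact D.word_mem_of_le (l := [i]) (by simpa using hi)
      exact h (D.K_le r hz)
  | cons i l ih =>
    intro r z hz
    have key : ∀ {r : ℤ} {z : L}, z ∈ D.K r → D.ρ z (D.word (i :: l)) ∈
        D.F (D.wordWt (i :: l) + r) := by
      intro r z hz
      have h1 : D.ρ z (D.word (i :: l)) =
          D.ρ ⁅z, D.y i⁆ (D.word l) + D.ρ (D.y i) (D.ρ z (D.word l)) := by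
        rw [D.ρ_lie, word_cons]; abel
      rw [h1]
      refine add_mem (D.F_mono ?_ (ih (D.K_lie hz (D.y_mem i)))) (D.ρ_y_mem i (ih hz) ?_) <;>
      · simp; omega
    exact key hz

/-- The filtrations of the algebra and of the module are compatible. -/
lemma ρ_mem {r m m' : ℤ} {z : L} (hz : z ∈ D.K r) {v : M} (hv : v ∈ D.F m) (h : m + r ≤ m') :
    D.ρ z v ∈ D.F m' :=
  D.map_mem_of_word (fun l hl => D.F_mono (by omega) (D.ρ_word_mem l hz)) hv

lemma ρ_sub_ψ_word_mem {z : L} (hz : z ∈ D.K 0) (l : List I) :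
    D.ρ z (D.word l) - D.ψ z • D.word l ∈ D.F (D.wordWt l - 1) := by
  induction l with
  | nil => simp [D.ρ_w z hz]
  | cons i l ih =>
    have h1 : D.ρ z (D.word (i :: l)) - D.ψ z • D.word (i :: l) = D.ρ ⁅z, D.y i⁆ (D.word l) +
        D.ρ (D.y i) (D.ρ z (D.word l) - D.ψ z • D.word l) := by
      rw [D.ρ_lie, word_cons, map_sub, map_smul]; abel
    rw [h1]
    refine add_mem (D.ρ_mem (D.K_lie hz (D.y_mem i)) (D.word_mem l) ?_) (D.ρ_y_mem i ih ?_) <;>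
    · simp; omega

lemma ρ_sub_ψ_mem {z : L} (hz : z ∈ D.K 0) {m m' : ℤ} {v : M} (hv : v ∈ D.F m)
    (h : m - 1 ≤ m') : D.ρ z v - D.ψ z • v ∈ D.F m' :=
  D.map_mem_of_word (f := D.ρ z - D.ψ z • LinearMap.id)
    (fun l hl => D.F_mono (by omega) (D.ρ_sub_ψ_word_mem hz l)) hv

lemma word_sub_word_mem_of_perm {l l' : List I} (h : l.Perm l') :
    D.word l - D.word l' ∈ D.F (D.wordWt l - 1) := by
  induction h with
  | nil => simp
  | cons i h ih =>
    rw [word_cons, word_cons, ← map_sub]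
    exact D.ρ_y_mem i ih (by simp; omega)
  | swap i j l =>
    rw [word_cons, word_cons, word_cons, word_cons, ← D.ρ_lie]
    exact D.ρ_mem (D.K_lie (D.y_mem j) (D.y_mem i)) (D.word_mem l) (by simp; omega)
  | @trans l₁ l₂ l₃ h1 h2 ih1 ih2 =>
    rw [← sub_add_sub_cancel _ (D.word l₂)]
    refine add_mem ih1 ?_
    have : D.wordWt l₁ = D.wordWt l₂ := (h1.map D.wt).sum_eq
    rwa [this]

open MvPolynomial

/-- The linear map from polynomials to the module, sending a monomial to the product of its
variables, in an arbitrary order, applied to the Whittaker vector. -/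
def symb : MvPolynomial I k →ₗ[k] M :=
  (basisMonomials I k).constr k fun s => D.word s.toMultiset.toList

lemma symb_monomial (s : I →₀ ℕ) : D.symb (monomial s 1) = D.word s.toMultiset.toList := by
  have := (basisMonomials I k).constr_basis k (fun s => D.word s.toMultiset.toList) s
  rwa [coe_basisMonomials] at this

lemma mon_toList (s : I →₀ ℕ) :
    ((s.toMultiset.toList.map X).prod : MvPolynomial I k) = monomial s 1 := by
  rw [← Multiset.prod_coe, ← Multiset.map_coe, Multiset.coe_toList, Finsupp.toMultiset_map,
    Finsupp.prod_toMultiset, Finsupp.prod_mapDomain_index (by simp) (by simp [pow_add]),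
    monomial_eq, map_one, one_mul]

lemma exists_perm_mon (l : List I) : ∃ s : I →₀ ℕ, l.Perm s.toMultiset.toList ∧
    (l.map X).prod = (monomial s 1 : MvPolynomial I k) := by
  classical
  refine ⟨Multiset.toFinsupp (l : Multiset I), ?_⟩
  have h : l.Perm (Multiset.toFinsupp (l : Multiset I)).toMultiset.toList := by
    rw [← Multiset.coe_eq_coe, Multiset.coe_toList, Multiset.toFinsupp_toMultiset]
  exact ⟨h, by rw [← mon_toList, (h.map X).prod_eq]⟩

lemma symb_mon_sub_word_mem (l : List I) :
    D.symb (l.map X).prod - D.word l ∈ D.F (D.wordWt l - 1) := by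
  obtain ⟨s, hs, hm⟩ := exists_perm_mon (k := k) l
  rw [hm, symb_monomial, ← neg_sub (D.word l)]
  exact neg_mem (D.word_sub_word_mem_of_perm hs)

lemma isWeightedHomogeneous_mon (l : List I) :
    IsWeightedHomogeneous D.wt ((l.map X).prod : MvPolynomial I k) (D.wordWt l) := by
  induction l with
  | nil => simpa using isWeightedHomogeneous_one k D.wt
  | cons i l ih =>
    rw [List.map_cons, List.prod_cons, wordWt_cons]
    exact (isWeightedHomogeneous_X k D.wt i).mul ih

lemma weight_eq_wordWt (s : I →₀ ℕ) : Finsupp.weight D.wt s = D.wordWt s.toMultiset.toList := by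
  have h := D.isWeightedHomogeneous_mon (k := k) s.toMultiset.toList
  rw [mon_toList] at h
  exact h (d := s) (by classical simp [coeff_monomial])

/-- The weighted homogeneous polynomials are spanned by monomials. -/
lemma mem_of_isWeightedHomogeneous {N : Submodule k (MvPolynomial I k)} {m : ℤ}
    (h : ∀ l : List I, D.wordWt l = m → (l.map X).prod ∈ N) {f : MvPolynomial I k}
    (hf : IsWeightedHomogeneous D.wt f m) : f ∈ N := by
  rw [← f.support_sum_monomial_coeff]
  refine Submodule.sum_mem _ fun s hs => ?_
  have h1 : (monomial s (coeff s f) : MvPolynomial I k) = coeff s f • monomial s 1 := by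
    rw [smul_monomial, smul_eq_mul, mul_one]
  rw [h1, ← mon_toList]
  refine Submodule.smul_mem _ _ (h _ ?_)
  rw [← D.weight_eq_wordWt]
  exact hf (mem_support_iff.1 hs)

lemma symb_X_mul_sub_mem (i : I) {f : MvPolynomial I k} {m m' : ℤ}
    (hf : IsWeightedHomogeneous D.wt f m) (h : m + D.wt i - 1 ≤ m') :
    D.symb (X i * f) - D.ρ (D.y i) (D.symb f) ∈ D.F m' := by
  refine D.mem_of_isWeightedHomogeneous (N := (D.F m').comap
    (D.symb ∘ₗ LinearMap.mulLeft k (X i) - D.ρ (D.y i) ∘ₗ D.symb)) (fun l hl => ?_) hf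
  simp only [Submodule.mem_comap, LinearMap.sub_apply, LinearMap.comp_apply,
    LinearMap.mulLeft_apply]
  have h1 := D.symb_mon_sub_word_mem (i :: l)
  have h2 := D.ρ_y_mem i (D.symb_mon_sub_word_mem l) (m' := m') (by omega)
  rw [List.map_cons, List.prod_cons] at h1
  have h3 := sub_mem (D.F_mono (by simp; omega) h1) h2
  rw [map_sub, word_cons] at h3
  convert h3 using 1
  abel

lemma exists_isWeightedHomogeneous {v : M} {m : ℤ} (hv : v ∈ D.F m) :
    ∃ f, IsWeightedHomogeneous D.wt f m ∧ v - D.symb f ∈ D.F (m - 1) := by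
  induction hv using Submodule.span_induction with
  | mem v hv =>
    obtain ⟨l, hl, rfl⟩ := hv
    rcases (show D.wordWt l ≤ m from hl).eq_or_lt with rfl | hl
    · refine ⟨_, D.isWeightedHomogeneous_mon l, ?_⟩
      rw [← neg_sub (D.symb _)]
      exact neg_mem (D.symb_mon_sub_word_mem l)
    · exact ⟨0, isWeightedHomogeneous_zero k D.wt m, by
        simpa using D.word_mem_of_le (by omega)⟩
  | zero => exact ⟨0, isWeightedHomogeneous_zero k D.wt m, by simp⟩
  | add u v _ _ hu hv =>
    obtain ⟨f, hf, hf'⟩ := hu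
    obtain ⟨f', hg, hg'⟩ := hv
    refine ⟨f + f', hf.add hg, ?_⟩
    rw [map_add, add_sub_add_comm]
    exact add_mem hf' hg'
  | smul a v _ hv =>
    obtain ⟨f, hf, hf'⟩ := hv
    refine ⟨a • f, (weightedHomogeneousSubmodule k D.wt m).smul_mem a hf, ?_⟩
    rw [map_smul, ← smul_sub]
    exact Submodule.smul_mem _ _ hf'

open Classical in
/-- The image of the variable `X i` under the derivation induced by `x t` on the associated graded
module. -/
def lower (t : T) (i : I) : MvPolynomial I k :=
  if D.wt i = 1 then C (D.ψ ⁅D.x t, D.y i⁆) else (D.α t i).sum fun j a => a • X j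

lemma isWeightedHomogeneous_lower (t : T) (i : I) :
    IsWeightedHomogeneous D.wt (D.lower t i) (D.wt i - 1) := by
  rw [lower]
  split_ifs with h
  · rw [h, sub_self]
    exact isWeightedHomogeneous_C _ _
  · refine Submodule.sum_mem (weightedHomogeneousSubmodule k D.wt (D.wt i - 1)) fun j hj => ?_
    refine Submodule.smul_mem _ _ ?_
    rw [← D.wt_of_α t i h j hj]
    exact isWeightedHomogeneous_X k D.wt j

lemma isWeightedHomogeneous_mkDerivation (t : T) {f : MvPolynomial I k} {m : ℤ}
    (hf : IsWeightedHomogeneous D.wt f m) :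
    IsWeightedHomogeneous D.wt (mkDerivation k (D.lower t) f) (m - 1) := by
  refine D.mem_of_isWeightedHomogeneous (N := (weightedHomogeneousSubmodule k D.wt (m - 1)).comap
    (mkDerivation k (D.lower t)).toLinearMap) (fun l hl => ?_) hf
  change IsWeightedHomogeneous D.wt (mkDerivation k (D.lower t) (l.map X).prod) (m - 1)
  clear hf
  subst hl
  induction l with
  | nil => simpa using isWeightedHomogeneous_zero k D.wt _
  | cons i l ih =>
    rw [List.map_cons, List.prod_cons, Derivation.leibniz, mkDerivation_X, smul_eq_mul,
      smul_eq_mul]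
    refine IsWeightedHomogeneous.add ?_ ?_
    · convert (isWeightedHomogeneous_X k D.wt i).mul ih using 1
      simp; omega
    · convert (D.isWeightedHomogeneous_mon l).mul (D.isWeightedHomogeneous_lower t i) using 1
      simp; omega

lemma ρ_lie_sub_symb_mem (t : T) (i : I) (l : List I) :
    D.ρ ⁅D.x t, D.y i⁆ (D.word l) - D.symb ((l.map X).prod * D.lower t i) ∈
      D.F (D.wt i + D.wordWt l - 2) := by
  have hlie := D.K_lie (D.x_mem t) (D.y_mem i)
  rw [lower]
  split_ifs with h
  · rw [h] at hlie ⊢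
    have h1 := D.ρ_sub_ψ_word_mem (z := ⁅D.x t, D.y i⁆) (D.K_mono (by omega) hlie) l
    have h2 := Submodule.smul_mem _ (D.ψ ⁅D.x t, D.y i⁆) (D.symb_mon_sub_word_mem l)
    rw [mul_comm, C_mul', map_smul]
    rw [smul_sub] at h2
    have h3 := D.F_mono (m' := 1 + D.wordWt l - 2) (by omega) (sub_mem h1 h2)
    convert h3 using 1
    abel
  · have h1 := D.ρ_mem (D.lie_x_y t i h) (D.word_mem l)
      (m' := D.wt i + D.wordWt l - 2) (by omega)
    rw [map_sub, LinearMap.sub_apply] at h1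
    rw [← sub_add_sub_cancel _ (D.ρ ((D.α t i).sum fun j a => a • D.y j) (D.word l))]
    refine add_mem h1 ?_
    rw [Finsupp.sum, Finsupp.sum, map_sum, LinearMap.sum_apply, Finset.mul_sum, map_sum,
      ← Finset.sum_sub_distrib]
    refine Submodule.sum_mem _ fun j hj => ?_
    rw [map_smul, LinearMap.smul_apply, mul_smul_comm, map_smul, ← smul_sub]
    refine Submodule.smul_mem _ _ ?_
    have h2 := D.symb_mon_sub_word_mem (j :: l)
    have h3 := D.wt_of_α t i h j hj
    rw [List.map_cons, List.prod_cons, mul_comm, word_cons] at h2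
    rw [← neg_sub (D.symb _)]
    exact neg_mem (D.F_mono (by simp; omega) h2)

/-- On the associated graded module, the operator `x t - ψ (x t)` is the derivation given by
`lower t`. -/
lemma ρ_word_sub_symb_mem (t : T) (l : List I) :
    D.ρ (D.x t) (D.word l) - D.ψ (D.x t) • D.word l -
      D.symb (mkDerivation k (D.lower t) (l.map X).prod) ∈ D.F (D.wordWt l - 2) := by
  induction l with
  | nil => simp [D.ρ_w _ (D.x_mem t)]
  | cons i l ih =>
    have h1 := D.ρ_lie_sub_symb_mem t i l
    have h2 := D.ρ_y_mem i ih (m' := D.wt i + D.wordWt l - 2) (by omega)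
    have h3 := D.symb_X_mul_sub_mem i
      (D.isWeightedHomogeneous_mkDerivation t (D.isWeightedHomogeneous_mon l))
      (m' := D.wt i + D.wordWt l - 2) (by omega)
    rw [List.map_cons, List.prod_cons, Derivation.leibniz, mkDerivation_X, smul_eq_mul,
      smul_eq_mul, map_add, word_cons, wordWt_cons]
    have h4 := sub_mem (add_mem h1 h2) h3
    simp only [D.ρ_lie, map_sub, map_smul] at h4
    convert h4 using 1
    abel

lemma ρ_symb_sub_symb_mem (t : T) {f : MvPolynomial I k} {m : ℤ}
    (hf : IsWeightedHomogeneous D.wt f m) :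
    D.ρ (D.x t) (D.symb f) - D.ψ (D.x t) • D.symb f -
      D.symb (mkDerivation k (D.lower t) f) ∈ D.F (m - 2) := by
  rw [← f.support_sum_monomial_coeff]
  simp only [map_sum, Finset.smul_sum]
  rw [← Finset.sum_sub_distrib, ← Finset.sum_sub_distrib]
  refine Submodule.sum_mem _ fun s hs => ?_
  have h1 : (monomial s (coeff s f) : MvPolynomial I k) = coeff s f • monomial s 1 := by
    rw [smul_monomial, smul_eq_mul, mul_one]
  have h2 := D.ρ_word_sub_symb_mem t s.toMultiset.toList
  rw [mon_toList, ← symb_monomial, ← weight_eq_wordWt, hf (mem_support_iff.1 hs)] at h2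
  rw [h1]
  simp only [Derivation.map_smul, map_smul]
  rw [smul_comm, ← smul_sub, ← smul_sub]
  exact Submodule.smul_mem _ _ h2

/-- The ordered monomials are linearly independent in the associated graded module. -/
lemma eq_zero_of_symb_mem (hw : D.w ≠ 0)
    (hD : ∀ f : MvPolynomial I k, (∀ t, mkDerivation k (D.lower t) f = 0) → f = C (coeff 0 f))
    (n : ℕ) : ∀ {m : ℤ}, m < n → ∀ {f : MvPolynomial I k},
    IsWeightedHomogeneous D.wt f m → D.symb f ∈ D.F (m - 1) → f = 0 := by
  induction n with
  | zero =>
    intro m hm f hf _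
    ext s
    by_contra hs
    have h1 := hf (d := s) hs
    rw [weight_eq_wordWt] at h1
    have := D.wordWt_nonneg s.toMultiset.toList
    rw [Nat.cast_zero] at hm
    omega
  | succ n ih =>
    intro m hm f hf hs
    have h1 : f = C (coeff 0 f) := by
      refine hD f fun t => ih (m := m - 1) (by push_cast at hm; omega)
        (D.isWeightedHomogeneous_mkDerivation t hf) ?_
      have h2 := D.ρ_symb_sub_symb_mem t hf
      have h3 := D.ρ_sub_ψ_mem (D.x_mem t) hs (m' := m - 2) (by omega)
      have h4 := sub_mem h3 h2
      rw [sub_sub_cancel] at h4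
      exact D.F_mono (by omega) h4
    by_contra hf0
    have hc : coeff 0 f ≠ 0 := fun h => hf0 (by rw [h1, h, C_0])
    have hm0 : m = 0 := by simpa using (hf (d := 0) hc).symm
    have h5 : D.symb f = coeff 0 f • D.w := by
      conv_lhs => rw [h1]
      have : (C (coeff 0 f) : MvPolynomial I k) = coeff 0 f • monomial 0 1 := by
        rw [smul_monomial, smul_eq_mul, mul_one]; rfl
      rw [this, map_smul, symb_monomial]
      simp
    rw [D.F_eq_bot (by omega), Submodule.mem_bot, h5, smul_eq_zero] at hs
    exact hs.elim hc hw

/-- A non-zero submodule contains the Whittaker vector: an element of least degree of the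
submodule has degree zero, since otherwise some `x t - ψ (x t)` lowers its degree. -/
lemma w_mem_of_ne_bot (hw : D.w ≠ 0)
    (hD : ∀ f : MvPolynomial I k, (∀ t, mkDerivation k (D.lower t) f = 0) → f = C (coeff 0 f))
    (hgen : ∀ N : Submodule k M, (∀ z, ∀ v ∈ N, D.ρ z v ∈ N) → D.w ∈ N → N = ⊤)
    {N : Submodule k M} (hN : ∀ z, ∀ v ∈ N, D.ρ z v ∈ N) (hN0 : N ≠ ⊥) : D.w ∈ N := by
  have hF : ∀ v : M, ∃ n : ℕ, v ∈ D.F n := by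
    have : (⨆ n : ℕ, D.F n) = ⊤ := by
      have hdir : Directed (· ≤ ·) fun n : ℕ => D.F n :=
        Monotone.directed_le fun a b h => D.F_mono (by exact_mod_cast h)
      refine hgen _ (fun z v hv => ?_) (Submodule.mem_iSup_of_mem 0 (D.word_mem []))
      obtain ⟨n, hn⟩ := (Submodule.mem_iSup_of_directed _ hdir).1 hv
      obtain ⟨r, hr⟩ := D.K_exhaustive z
      exact Submodule.mem_iSup_of_mem (n + r.toNat)
        (D.ρ_mem hr hn (by push_cast; have := Int.self_le_toNat r; omega))
    intro v
    have hdir : Directed (· ≤ ·) fun n : ℕ => D.F n :=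
      Monotone.directed_le fun a b h => D.F_mono (by exact_mod_cast h)
    exact (Submodule.mem_iSup_of_directed _ hdir).1 (by rw [this]; trivial)
  classical
  have hex : ∃ n : ℕ, ∃ v ∈ N, v ≠ 0 ∧ v ∈ D.F n := by
    obtain ⟨v, hv, hv0⟩ := (Submodule.ne_bot_iff N).1 hN0
    obtain ⟨n, hn⟩ := hF v
    exact ⟨n, v, hv, hv0, hn⟩
  obtain ⟨v, hv, hv0, hvF⟩ := Nat.find_spec hex
  have hmin : ∀ u ∈ N, u ∈ D.F ((Nat.find hex : ℤ) - 1) → u = 0 := by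
    intro u hu huF
    by_contra hu0
    rcases Nat.eq_zero_or_pos (Nat.find hex) with h0 | hpos
    · rw [D.F_eq_bot (by omega)] at huF
      exact hu0 (by simpa using huF)
    · refine Nat.find_min hex (Nat.sub_lt hpos one_pos) ⟨u, hu, hu0, ?_⟩
      rwa [Nat.cast_pred hpos]
  set m : ℤ := (Nat.find hex : ℤ)
  obtain ⟨f, hf, hvf⟩ := D.exists_isWeightedHomogeneous hvF
  have h1 : f = C (coeff 0 f) := by
    refine hD f fun t => D.eq_zero_of_symb_mem hw hD (Nat.find hex) (m := m - 1)
      (by omega) (D.isWeightedHomogeneous_mkDerivation t hf) ?_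
    have h2 : D.ρ (D.x t) v - D.ψ (D.x t) • v = 0 :=
      hmin _ (sub_mem (hN _ _ hv) (N.smul_mem _ hv))
        (D.ρ_sub_ψ_mem (D.x_mem t) hvF (by omega))
    have h3 := D.ρ_sub_ψ_mem (D.x_mem t) hvf (m' := m - 2) (by omega)
    have h4 := add_mem h3 (D.ρ_symb_sub_symb_mem t hf)
    have h5 := neg_mem h4
    have h6 : -(D.ρ (D.x t) (v - D.symb f) - D.ψ (D.x t) • (v - D.symb f) +
        (D.ρ (D.x t) (D.symb f) - D.ψ (D.x t) • D.symb f -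
          D.symb (mkDerivation k (D.lower t) f))) = D.symb (mkDerivation k (D.lower t) f) -
        (D.ρ (D.x t) v - D.ψ (D.x t) • v) := by
      rw [map_sub, smul_sub]; abel
    rw [h6, h2, sub_zero] at h5
    exact D.F_mono (by omega) h5
  have hf0 : f ≠ 0 := by
    rintro rfl
    rw [map_zero, sub_zero] at hvf
    exact hv0 (hmin v hv hvf)
  have hc : coeff 0 f ≠ 0 := fun h => hf0 (by rw [h1, h, C_0])
  have hm0 : m = 0 := by simpa using (hf (d := 0) hc).symm
  rw [hm0, F] at hvF
  have h7 : D.F 0 ≤ k ∙ D.w := by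
    rw [F, Submodule.span_le]
    rintro _ ⟨l, hl, rfl⟩
    cases l with
    | nil => exact Submodule.mem_span_singleton_self _
    | cons i l =>
      have := D.one_le_wt i
      have := D.wordWt_nonneg l
      simp only [wordWt_cons, Set.mem_ofPred_eq] at hl
      omega
  obtain ⟨a, rfl⟩ := Submodule.mem_span_singleton.1 (h7 hvF)
  have ha : a ≠ 0 := by rintro rfl; exact hv0 (zero_smul _ _)
  have := N.smul_mem a⁻¹ hv
  rwa [smul_smul, inv_mul_cancel₀ ha, one_smul] at this

end KazhdanData

end WhittakerInduction

namespace WhittakerInduction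

attribute [local instance] LieRing.ofAssociativeRing

/-! ### Modules induced from a subalgebra with a complementary subalgebra -/

section Induced

variable {k L : Type*} [Field k] [LieRing L] [LieAlgebra k L] (Q : LieSubalgebra k L)

/-- The action of a subalgebra `Q` of `L` on the linear maps from `L` to the enveloping algebra of
`Q`, where `Q` acts on `L` by the bracket and on its enveloping algebra by left multiplication. -/
def homAction : Q →ₗ⁅k⁆ Module.End k (L →ₗ[k] UniversalEnvelopingAlgebra k Q) where
  toFun q :=
    { toFun := fun φ => LinearMap.mulLeft k (UniversalEnvelopingAlgebra.ι k q) ∘ₗ φ -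
        φ ∘ₗ (LieAlgebra.ad k L (q : L) : L →ₗ[k] L)
      map_add' := fun φ φ' => by ext x; simp [mul_add]; abel
      map_smul' := fun r φ => by ext x; simp [smul_sub] }
  map_add' q q' := by ext φ x; simp [add_mul]; abel
  map_smul' r q := by ext φ x; simp [smul_sub]
  map_lie' {q q'} := by
    ext φ x
    simp only [LieRing.of_associative_ring_bracket, LinearMap.coe_mk, AddHom.coe_mk,
      LinearMap.sub_apply, LinearMap.comp_apply, LinearMap.mulLeft_apply, LieAlgebra.ad_apply,
      Module.End.mul_apply, LieHom.map_lie, LieSubalgebra.coe_bracket, map_sub, sub_mul, mul_assoc]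
    abel

lemma homAction_apply (q : Q) (φ : L →ₗ[k] UniversalEnvelopingAlgebra k Q) (x : L) :
    homAction Q q φ x = UniversalEnvelopingAlgebra.ι k q * φ x - φ ⁅(q : L), x⁆ := rfl

/-- Induction on the elements of an enveloping algebra. -/
lemma enveloping_induction {G : Type*} [LieRing G] [LieAlgebra k G]
    {P : UniversalEnvelopingAlgebra k G → Prop} (h1 : P 1) (hadd : ∀ u v, P u → P v → P (u + v))
    (hsmul : ∀ (r : k) u, P u → P (r • u))
    (hmul : ∀ q u, P u → P (UniversalEnvelopingAlgebra.ι k q * u))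
    (u : UniversalEnvelopingAlgebra k G) : P u := by
  have h0 : P 0 := by simpa using hsmul 0 1 h1
  -- The elements whose left multiplication preserves `P` form a subalgebra.
  let S : Subalgebra k (UniversalEnvelopingAlgebra k G) :=
    { carrier := {a | ∀ u, P u → P (a * u)}
      mul_mem' := fun {a b} ha hb u hu => by rw [mul_assoc]; exact ha _ (hb _ hu)
      add_mem' := fun {a b} ha hb u hu => by rw [add_mul]; exact hadd _ _ (ha _ hu) (hb _ hu)
      algebraMap_mem' := fun r u hu => by rw [← Algebra.smul_def]; exact hsmul _ _ hu }
  let f : G →ₗ⁅k⁆ S :=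
    { toFun := fun q => ⟨UniversalEnvelopingAlgebra.ι k q, hmul q⟩
      map_add' := fun q q' => Subtype.ext (map_add _ _ _)
      map_smul' := fun r q => Subtype.ext (map_smul _ _ _)
      map_lie' := fun {q q'} => Subtype.ext (LieHom.map_lie _ _ _) }
  have h2 : S.val.comp (UniversalEnvelopingAlgebra.lift k f) =
      AlgHom.id k (UniversalEnvelopingAlgebra k G) := by
    apply UniversalEnvelopingAlgebra.hom_ext
    ext q
    change ((UniversalEnvelopingAlgebra.lift k f (UniversalEnvelopingAlgebra.ι k q) : S) :
      UniversalEnvelopingAlgebra k G) = UniversalEnvelopingAlgebra.ι k q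
    rw [UniversalEnvelopingAlgebra.lift_ι_apply]
    rfl
  have h3 := (UniversalEnvelopingAlgebra.lift k f u).2 1 h1
  have h4 : ((UniversalEnvelopingAlgebra.lift k f u : S) : UniversalEnvelopingAlgebra k G) = u :=
    DFunLike.congr_fun h2 u
  rwa [h4, mul_one] at h3

lemma enveloping_nontrivial (G : Type*) [LieRing G] [LieAlgebra k G] :
    Nontrivial (UniversalEnvelopingAlgebra k G) :=
  (UniversalEnvelopingAlgebra.lift k (0 : G →ₗ⁅k⁆ k)).toRingHom.domain_nontrivial

variable {Q} (φ₁ : L →ₗ[k] UniversalEnvelopingAlgebra k Q)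

/-- The map `x ↦ x u` for `u` in the enveloping algebra of `Q`, if `φ₁` is the map `x ↦ x 1`. -/
def orbitMap : UniversalEnvelopingAlgebra k Q →ₗ[k] L →ₗ[k] UniversalEnvelopingAlgebra k Q :=
  (UniversalEnvelopingAlgebra.lift k (homAction Q)).toLinearMap.flip φ₁

lemma orbitMap_one : orbitMap φ₁ 1 = φ₁ := by
  simp [orbitMap]

lemma orbitMap_ι_mul (q : Q) (u : UniversalEnvelopingAlgebra k Q) (x : L) :
    orbitMap φ₁ (UniversalEnvelopingAlgebra.ι k q * u) x =
      UniversalEnvelopingAlgebra.ι k q * orbitMap φ₁ u x - orbitMap φ₁ u ⁅(q : L), x⁆ := by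
  rw [← homAction_apply]
  simp only [orbitMap, LinearMap.flip_apply, AlgHom.toLinearMap_apply, map_mul,
    Module.End.mul_apply, UniversalEnvelopingAlgebra.lift_ι_apply]

lemma orbitMap_coe (h : ∀ q : Q, φ₁ q = UniversalEnvelopingAlgebra.ι k q) (q : Q)
    (u : UniversalEnvelopingAlgebra k Q) :
    orbitMap φ₁ u q = UniversalEnvelopingAlgebra.ι k q * u := by
  induction u using enveloping_induction generalizing q with
  | h1 => rw [orbitMap_one, h, mul_one]
  | hadd u v hu hv => rw [map_add, LinearMap.add_apply, hu, hv, mul_add]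
  | hsmul r u hu => rw [map_smul, LinearMap.smul_apply, hu, mul_smul_comm]
  | hmul q' u hu =>
    have h1 : ⁅(q' : L), (q : L)⁆ = ((⁅q', q⁆ : Q) : L) := rfl
    rw [orbitMap_ι_mul, hu, h1, hu, LieHom.map_lie, LieRing.of_associative_ring_bracket,
      sub_mul, mul_assoc, mul_assoc, sub_sub_cancel]

/-- Let `N` and `Q` be complementary subalgebras of `L`. For every character `χ` of `N`, the left
regular representation of `Q` on its enveloping algebra extends to `L`, with `N` acting on `1`
by `χ`. The action is forced by `x q u = q x u + [x, q] u`; it is well defined because the linear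
maps `x ↦ x u` form the `Q`-submodule of `Hom(L, U(Q))` generated by `x ↦ x 1`. -/
theorem exists_induced_of_isCompl {N Q : LieSubalgebra k L}
    (hNQ : IsCompl N.toSubmodule Q.toSubmodule) (χ : N →ₗ[k] k)
    (hχ : ∀ x y : N, χ ⁅x, y⁆ = 0) :
    ∃ ρ : L →ₗ⁅k⁆ Module.End k (UniversalEnvelopingAlgebra k Q),
      (∀ (q : Q) u, ρ q u = UniversalEnvelopingAlgebra.ι k q * u) ∧
      ∀ x : N, ρ x 1 = χ x • 1 := by
  let φ₁ : L →ₗ[k] UniversalEnvelopingAlgebra k Q :=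
    LinearMap.ofIsCompl hNQ (LinearMap.toSpanSingleton k _ 1 ∘ₗ χ)
      (UniversalEnvelopingAlgebra.ι k : Q →ₗ⁅k⁆ UniversalEnvelopingAlgebra k Q).toLinearMap
  have hQ : ∀ q : Q, φ₁ q = UniversalEnvelopingAlgebra.ι k q :=
    LinearMap.ofIsCompl_apply_right hNQ
  have hN : ∀ x : N, φ₁ x = χ x • 1 := LinearMap.ofIsCompl_apply_left hNQ
  have hmul : ∀ (q : Q) u x, orbitMap φ₁ (UniversalEnvelopingAlgebra.ι k q * u) x =
      UniversalEnvelopingAlgebra.ι k q * orbitMap φ₁ u x + orbitMap φ₁ u ⁅x, (q : L)⁆ := by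
    intro q u x
    rw [orbitMap_ι_mul, ← lie_skew x (q : L), map_neg, sub_eq_add_neg]
  have hcoe := orbitMap_coe φ₁ hQ
  have hlie : ∀ u x y, orbitMap φ₁ u ⁅x, y⁆ =
      orbitMap φ₁ (orbitMap φ₁ u y) x - orbitMap φ₁ (orbitMap φ₁ u x) y := by
    have key : ∀ (q : Q) u x, orbitMap φ₁ u ⁅x, (q : L)⁆ =
        orbitMap φ₁ (orbitMap φ₁ u q) x - orbitMap φ₁ (orbitMap φ₁ u x) q := by
      intro q u x
      rw [hcoe q u, hmul, hcoe, add_sub_cancel_left]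
    have key' : ∀ (q : Q) u x, orbitMap φ₁ u ⁅(q : L), x⁆ =
        orbitMap φ₁ (orbitMap φ₁ u x) q - orbitMap φ₁ (orbitMap φ₁ u q) x := by
      intro q u x
      rw [← lie_skew, map_neg, key, neg_sub]
    intro u
    induction u using enveloping_induction with
    | h1 =>
      intro x y
      obtain ⟨x, hx, q, hq, rfl⟩ := Submodule.mem_sup.1
        (show x ∈ N.toSubmodule ⊔ Q.toSubmodule by rw [hNQ.sup_eq_top]; trivial)
      obtain ⟨y, hy, r, hr, rfl⟩ := Submodule.mem_sup.1
        (show y ∈ N.toSubmodule ⊔ Q.toSubmodule by rw [hNQ.sup_eq_top]; trivial)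
      have h1 : orbitMap φ₁ 1 ⁅x, y⁆ =
          orbitMap φ₁ (orbitMap φ₁ 1 y) x - orbitMap φ₁ (orbitMap φ₁ 1 x) y := by
        have h2 := hN ⁅(⟨x, hx⟩ : N), (⟨y, hy⟩ : N)⁆
        rw [hχ, zero_smul] at h2
        have h3 := hN ⟨x, hx⟩
        have h4 := hN ⟨y, hy⟩
        simp only [LieSubalgebra.coe_bracket] at h2 h3 h4
        rw [orbitMap_one, h3, h4, map_smul, map_smul, LinearMap.smul_apply, LinearMap.smul_apply,
          orbitMap_one, h3, h4, smul_comm, sub_self, h2]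
      have h2 := key ⟨r, hr⟩ 1 x
      have h3 := key' ⟨q, hq⟩ 1 y
      have h4 := key ⟨r, hr⟩ 1 q
      simp only [add_lie, lie_add, map_add, LinearMap.add_apply, h1, h2, h3, h4]
      abel
    | hadd u v hu hv => intro x y; simp only [map_add, LinearMap.add_apply, hu, hv]; abel
    | hsmul r u hu =>
      intro x y; simp only [map_smul, LinearMap.smul_apply, hu, smul_sub]
    | hmul q u hu =>
      intro x y
      simp only [hmul, map_add, LinearMap.add_apply]
      have h1 : ⁅⁅x, y⁆, (q : L)⁆ = ⁅⁅x, (q : L)⁆, y⁆ + ⁅x, ⁅y, (q : L)⁆⁆ := by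
        rw [lie_lie, ← lie_skew ⁅x, (q : L)⁆ y]; abel
      rw [h1, map_add, hu ⁅x, (q : L)⁆ y, hu x ⁅y, (q : L)⁆, hu x y, mul_sub]
      abel
  refine ⟨⟨(orbitMap φ₁).flip, fun {x y} => ?_⟩, hcoe, fun x => ?_⟩
  · ext u
    exact hlie u x y
  · change orbitMap φ₁ 1 x = _
    rw [orbitMap_one, hN]

end Induced

end WhittakerInduction

namespace WhittakerInduction

open LieAlgebra LieModule LieAlgebra.IsKilling

/-! ### Brackets of root spaces -/

section RootSpaces

variable {g : Type*} [LieRing g] [LieAlgebra ℂ g] [FiniteDimensional ℂ g] [IsKilling ℂ g]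
  {H : LieSubalgebra ℂ g} [H.IsCartanSubalgebra]

lemma exists_eq_smul_of_mem_rootSpace {α : H.root} {x y : g} (hx : x ∈ rootSpace H α.1)
    (hx0 : x ≠ 0) (hy : y ∈ rootSpace H α.1) : ∃ r : ℂ, y = r • x := by
  obtain ⟨r, hr⟩ := (finrank_eq_one_iff_of_nonzero' (⟨x, hx⟩ : rootSpace H α.1)
    (by simpa using hx0)).1 (finrank_rootSpace_eq_one α.1 (LieSubalgebra.isNonZero_coe_root α))
    ⟨y, hy⟩
  exact ⟨r, (congrArg Subtype.val hr).symm⟩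

/-- If `α`, `β` and `α + β` are roots, then `[g_α, g_β] = g_{α + β}`: the root string through `β`
in the direction of `α` is an irreducible module over the corresponding `sl₂`. -/
lemma exists_lie_eq_of_mem_rootSpace {α β γ : H.root}
    (h : (γ.1 : H → ℂ) = (α.1 : H → ℂ) + (β.1 : H → ℂ)) {z : g} (hz : z ∈ rootSpace H γ.1) :
    ∃ x ∈ rootSpace H α.1, ∃ y ∈ rootSpace H β.1, ⁅x, y⁆ = z := by
  have hα : (-α.1).IsNonZero := by simpa using LieSubalgebra.isNonZero_coe_root α
  obtain ⟨v, hv, hv0⟩ := (chainTop (-α.1) β.1).exists_ne_zero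
  obtain ⟨h', e, f, isSl2, he, hf⟩ := exists_isSl2Triple_of_weight_isNonZero hα
  obtain rfl := isSl2.h_eq_coroot hα he hf
  have prim : isSl2.HasPrimitiveVectorWith v (chainLength (-α.1) β.1 : ℂ) :=
    have := lie_mem_genWeightSpace_of_mem_genWeightSpace he hv
    ⟨hv0, (chainLength_smul _ _ hv).symm, by rwa [genWeightSpace_add_chainTop _ _ hα] at this⟩
  set n := chainTopCoeff (-α.1) β.1 with hn
  have hβ : -(n • ((-α.1 : Weight ℂ H g) : H → ℂ)) + chainTop (-α.1) β.1 = (β.1 : H → ℂ) := by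
    rw [coe_chainTop', ← hn]; simp
  have hγ : -((n + 1) • ((-α.1 : Weight ℂ H g) : H → ℂ)) + chainTop (-α.1) β.1 =
      (γ.1 : H → ℂ) := by
    rw [coe_chainTop', ← hn, h, add_smul]; simp
  have hlen : n + 1 ≤ chainLength (-α.1) β.1 := by
    by_contra! hlt
    have := rootSpace_neg_nsmul_add_chainTop_of_lt (-α.1) β.1 hα hlt
    rw [hγ] at this
    exact γ.1.genWeightSpace_ne_bot' this
  have h1 : ∀ m : ℕ, (toEnd ℂ g g f ^ m) v ∈
      rootSpace H (-(m • ((-α.1 : Weight ℂ H g) : H → ℂ)) + chainTop (-α.1) β.1) := by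
    intro m
    rw [← smul_neg]
    exact toEnd_pow_apply_mem hf hv m
  have hy := h1 n
  rw [hβ] at hy
  have hz' := h1 (n + 1)
  rw [hγ] at hz'
  obtain ⟨r, rfl⟩ := exists_eq_smul_of_mem_rootSpace hz'
    (prim.pow_toEnd_f_ne_zero_of_eq_nat rfl hlen) hz
  have hf' : f ∈ rootSpace H α.1 := by simpa using hf
  refine ⟨r • f, Submodule.smul_mem _ _ hf', _, hy, ?_⟩
  rw [smul_lie, pow_succ']
  rfl

end RootSpaces

/-! ### The grading attached to a parabolic subalgebra -/

section Grading

variable {g : Type*} [LieRing g] [LieAlgebra ℂ g]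

/-- The eigenspace of `ad z` for an integral eigenvalue. -/
def adEigenspace (z : g) (k : ℤ) : Submodule ℂ g :=
  Module.End.eigenspace (LieAlgebra.ad ℂ g z : Module.End ℂ g) (k : ℂ)

lemma mem_adEigenspace {z x : g} {k : ℤ} : x ∈ adEigenspace z k ↔ ⁅z, x⁆ = (k : ℂ) • x := by
  rw [adEigenspace, Module.End.mem_eigenspace_iff, LieAlgebra.ad_apply]

lemma lie_mem_adEigenspace {z x y : g} {j k : ℤ} (hx : x ∈ adEigenspace z j)
    (hy : y ∈ adEigenspace z k) : ⁅x, y⁆ ∈ adEigenspace z (j + k) := by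
  rw [mem_adEigenspace] at *
  rw [leibniz_lie, hx, hy, smul_lie, lie_smul, ← add_smul]
  push_cast; rfl

lemma iSupIndep_adEigenspace (z : g) : iSupIndep (adEigenspace z) :=
  (Module.End.eigenspaces_iSupIndep (LieAlgebra.ad ℂ g z : Module.End ℂ g)).comp Int.cast_injective

lemma killingForm_lie (x y u : g) : killingForm ℂ g ⁅x, y⁆ u = killingForm ℂ g x ⁅y, u⁆ :=
  LieModule.traceForm_apply_lie_apply ℂ g g x y u

/-- Eigenspaces of `ad z` are orthogonal for the Killing form unless their eigenvalues add up to
zero. -/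
lemma killingForm_adEigenspace {z x y : g} {j k : ℤ} (hx : x ∈ adEigenspace z j)
    (hy : y ∈ adEigenspace z k) (h : j + k ≠ 0) : killingForm ℂ g x y = 0 := by
  rw [mem_adEigenspace] at hx hy
  have h1 := killingForm_lie x z y
  rw [← lie_skew, hx, hy] at h1
  simp only [map_neg, map_smul, LinearMap.neg_apply, LinearMap.smul_apply, smul_eq_mul] at h1
  have h2 : ((j + k : ℤ) : ℂ) * killingForm ℂ g x y = 0 := by
    push_cast; linear_combination -h1
  exact (mul_eq_zero.1 h2).resolve_left (by exact_mod_cast h)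

/-- The sum of the eigenspaces of `ad z` for the eigenvalues in a set of integers. -/
def adEigensum (z : g) (s : Set ℤ) : Submodule ℂ g := ⨆ k ∈ s, adEigenspace z k

lemma adEigenspace_le {z : g} {s : Set ℤ} {k : ℤ} (hk : k ∈ s) :
    adEigenspace z k ≤ adEigensum z s := le_iSup₂_of_le k hk le_rfl

lemma adEigensum_le {z : g} {s : Set ℤ} {N : Submodule ℂ g} (h : ∀ k ∈ s, adEigenspace z k ≤ N) :
    adEigensum z s ≤ N := iSup₂_le h

lemma adEigensum_mono {z : g} {s t : Set ℤ} (h : s ⊆ t) : adEigensum z s ≤ adEigensum z t :=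
  adEigensum_le fun _ hk => adEigenspace_le (h hk)

lemma disjoint_adEigensum (z : g) {s t : Set ℤ} (h : Disjoint s t) :
    Disjoint (adEigensum z s) (adEigensum z t) :=
  (iSupIndep_adEigenspace z).disjoint_biSup_biSup h

lemma adEigensum_union (z : g) (s t : Set ℤ) :
    adEigensum z (s ∪ t) = adEigensum z s ⊔ adEigensum z t := iSup_union

lemma lie_mem_adEigensum {z x y : g} {s t u : Set ℤ} (h : ∀ j ∈ s, ∀ k ∈ t, j + k ∈ u)
    (hx : x ∈ adEigensum z s) (hy : y ∈ adEigensum z t) : ⁅x, y⁆ ∈ adEigensum z u := by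
  have h1 : adEigensum z s ≤
      (adEigensum z u).comap ((LieAlgebra.ad ℂ g y : Module.End ℂ g)) := by
    refine adEigensum_le fun j hj x hx => ?_
    have h2 : adEigensum z t ≤
        (adEigensum z u).comap ((LieAlgebra.ad ℂ g x : Module.End ℂ g)) :=
      adEigensum_le fun k hk y hy => adEigenspace_le (h j hj k hk) (lie_mem_adEigenspace hx hy)
    rw [Submodule.mem_comap, LieAlgebra.ad_apply, ← lie_skew]
    exact neg_mem (h2 hy)
  rw [← lie_skew]
  exact neg_mem (h1 hx)

lemma mem_adEigenspace_zero_of_mem_cartan {H : LieSubalgebra ℂ g} [IsLieAbelian H] (z : H) {x : g}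
    (hx : x ∈ H) : x ∈ adEigenspace (z : g) 0 := by
  rw [mem_adEigenspace, Int.cast_zero, zero_smul]
  exact congrArg Subtype.val (trivial_lie_zero H H z ⟨x, hx⟩)

end Grading

end WhittakerInduction

namespace WhittakerInduction

open LieAlgebra LieModule LieAlgebra.IsKilling

namespace ProperParabolic

variable {g : Type*} [LieRing g] [LieAlgebra ℂ g] [FiniteDimensional ℂ g]
  [LieAlgebra.IsSimple ℂ g] {H : LieSubalgebra ℂ g} [H.IsCartanSubalgebra]
  {b : (rootSystem H).Base} (p : ProperParabolic b)

open Classical in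
lemma exists_gradingElt : ∃ z : H, ∀ i ∈ b.support,
    i.1 z = if rootSpace H (negRoot i).1 ≤ p.carrier.toSubmodule then (0 : ℂ) else 1 := by
  let F : Module.Dual ℂ (Module.Dual ℂ H) := b.toWeightBasis.constr ℂ fun i =>
    if rootSpace H (negRoot i.1).1 ≤ p.carrier.toSubmodule then (0 : ℂ) else 1
  refine ⟨(Module.evalEquiv ℂ H).symm F, fun i hi => ?_⟩
  have h1 := b.toWeightBasis.constr_basis ℂ (fun i : b.support =>
    if rootSpace H (negRoot i.1).1 ≤ p.carrier.toSubmodule then (0 : ℂ) else 1) ⟨i, hi⟩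
  have h2 : Module.evalEquiv ℂ H ((Module.evalEquiv ℂ H).symm F) = F :=
    LinearEquiv.apply_symm_apply _ _
  rw [← h1]
  refine (?_ : _ = Module.evalEquiv ℂ H ((Module.evalEquiv ℂ H).symm F)
    (b.toWeightBasis ⟨i, hi⟩)).trans (by rw [h2])
  rw [Module.evalEquiv_apply, Module.Dual.eval_apply, RootPairing.Base.toWeightBasis_apply]
  rfl

/-- The grading element of a parabolic subalgebra: the element of the Cartan subalgebra on which a
simple root takes the value `0` or `1`, according to whether it is a root of the Levi factor. -/
def gradingElt : H := p.exists_gradingElt.choose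

/-- The homogeneous component of degree `k` of the grading of `g` given by a parabolic
subalgebra. -/
def gr (k : ℤ) : Submodule ℂ g := adEigenspace (p.gradingElt : g) k

/-- The sum of the homogeneous components of degree in a given set. -/
def grOn (s : Set ℤ) : Submodule ℂ g := adEigensum (p.gradingElt : g) s

open Classical in
lemma apply_gradingElt {i : H.root} (hi : i ∈ b.support) : i.1 p.gradingElt =
    if rootSpace H (negRoot i).1 ≤ p.carrier.toSubmodule then (0 : ℂ) else 1 :=
  p.exists_gradingElt.choose_spec i hi

lemma apply_eq_add {i j k : H.root}
    (h : (rootSystem H).root k = (rootSystem H).root i + (rootSystem H).root j) :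
    (k.1 : H → ℂ) = (i.1 : H → ℂ) + (j.1 : H → ℂ) := by
  ext x
  exact LinearMap.congr_fun h x

lemma exists_nat_of_isPos {α : H.root} (hα : b.IsPos α) :
    b.IsPos α ∧ ∃ n : ℕ, α.1 p.gradingElt = n := by
  refine hα.induction_on_add (p := fun α => b.IsPos α ∧ ∃ n : ℕ, α.1 p.gradingElt = n)
    (fun i hi => ⟨RootPairing.Base.isPos_of_mem_support hi, ?_⟩) ?_
  · rw [p.apply_gradingElt hi]
    split_ifs
    · exact ⟨0, by simp⟩
    · exact ⟨1, by simp⟩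
  · rintro i j k h ⟨hi, n, hn⟩ hj
    refine ⟨hi.add (RootPairing.Base.isPos_of_mem_support hj) h, ?_⟩
    have hk := congrFun (apply_eq_add h) p.gradingElt
    rw [Pi.add_apply, hn, p.apply_gradingElt hj] at hk
    rw [hk]
    split_ifs
    · exact ⟨n, by simp⟩
    · exact ⟨n + 1, by simp⟩

lemma negRoot_apply (α : H.root) (x : H) : (negRoot α).1 x = -α.1 x := by
  simp [negRoot]

lemma exists_deg (α : H.root) : ∃ n : ℤ, α.1 p.gradingElt = n := by
  rcases isPos_or_neg (b := b) α with h | h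
  · obtain ⟨-, n, hn⟩ := p.exists_nat_of_isPos h
    exact ⟨n, by simpa using hn⟩
  · obtain ⟨-, n, hn⟩ := p.exists_nat_of_isPos h
    rw [negRoot_apply] at hn
    exact ⟨-n, by push_cast; rw [← hn, neg_neg]⟩

/-- The degree of a root. -/
def deg (α : H.root) : ℤ := (p.exists_deg α).choose

lemma apply_eq_deg (α : H.root) : α.1 p.gradingElt = p.deg α := (p.exists_deg α).choose_spec

lemma deg_nonneg {α : H.root} (hα : b.IsPos α) : 0 ≤ p.deg α := by
  obtain ⟨-, n, hn⟩ := p.exists_nat_of_isPos hα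
  rw [apply_eq_deg] at hn
  have : p.deg α = n := by exact_mod_cast hn
  omega

lemma deg_negRoot (α : H.root) : p.deg (negRoot α) = -p.deg α := by
  have := negRoot_apply α p.gradingElt
  rw [apply_eq_deg, apply_eq_deg] at this
  exact_mod_cast this

lemma deg_add {i j k : H.root}
    (h : (rootSystem H).root k = (rootSystem H).root i + (rootSystem H).root j) :
    p.deg k = p.deg i + p.deg j := by
  have := congrFun (apply_eq_add h) p.gradingElt
  rw [Pi.add_apply, apply_eq_deg, apply_eq_deg, apply_eq_deg] at this
  exact_mod_cast this

lemma deg_of_mem_support {i : H.root} (hi : i ∈ b.support) :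
    (rootSpace H (negRoot i).1 ≤ p.carrier.toSubmodule ∧ p.deg i = 0) ∨
    (¬ (rootSpace H (negRoot i).1 ≤ p.carrier.toSubmodule) ∧ p.deg i = 1) := by
  have := p.apply_gradingElt hi
  rw [apply_eq_deg] at this
  split_ifs at this with h
  · exact Or.inl ⟨h, by exact_mod_cast this⟩
  · exact Or.inr ⟨h, by exact_mod_cast this⟩

lemma rootSpace_le_gr (α : H.root) : rootSpace H α.1 ≤ p.gr (p.deg α) := by
  intro x hx
  rw [gr, mem_adEigenspace, ← apply_eq_deg]
  exact lie_eq_smul_of_mem_rootSpace hx p.gradingElt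

lemma cartan_le_gr : H.toSubmodule ≤ p.gr 0 := fun _ hx =>
  mem_adEigenspace_zero_of_mem_cartan p.gradingElt hx

lemma lie_mem_gr {x y : g} {j k : ℤ} (hx : x ∈ p.gr j) (hy : y ∈ p.gr k) :
    ⁅x, y⁆ ∈ p.gr (j + k) := lie_mem_adEigenspace hx hy

lemma lie_mem_grOn {x y : g} {s t u : Set ℤ} (h : ∀ j ∈ s, ∀ k ∈ t, j + k ∈ u)
    (hx : x ∈ p.grOn s) (hy : y ∈ p.grOn t) : ⁅x, y⁆ ∈ p.grOn u := lie_mem_adEigensum h hx hy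

lemma gr_le_grOn {s : Set ℤ} {k : ℤ} (hk : k ∈ s) : p.gr k ≤ p.grOn s := adEigenspace_le hk

lemma grOn_le {s : Set ℤ} {N : Submodule ℂ g} (h : ∀ k ∈ s, p.gr k ≤ N) : p.grOn s ≤ N :=
  adEigensum_le h

lemma eq_zero_of_mem_grOn {s t : Set ℤ} (h : Disjoint s t) {x : g} (hs : x ∈ p.grOn s)
    (ht : x ∈ p.grOn t) : x = 0 :=
  Submodule.disjoint_def.1 (disjoint_adEigensum _ h) x hs ht

/-- The part of degree `k` spanned by root spaces and, for `k = 0`, the Cartan subalgebra. -/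
def rootPart (k : ℤ) : Submodule ℂ g :=
  (⨆ α : H.root, ⨆ _ : p.deg α = k, (rootSpace H α.1).toSubmodule) ⊔
    ⨆ _ : k = 0, H.toSubmodule

lemma rootPart_le (k : ℤ) : p.rootPart k ≤ p.gr k := by
  refine sup_le (iSup₂_le fun α hα => ?_) (iSup_le fun hk => ?_)
  · rw [← hα]; exact p.rootSpace_le_gr α
  · rw [hk]; exact p.cartan_le_gr

lemma iSup_rootPart : ⨆ k, p.rootPart k = ⊤ := by
  rw [eq_top_iff, ← LieSubmodule.top_toSubmodule (R := ℂ) (L := H) (M := g),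
    ← cartan_sup_iSup_rootSpace_eq_top (K := ℂ) (L := g) H, LieSubmodule.sup_toSubmodule,
    LieSubmodule.iSup_toSubmodule]
  refine sup_le ?_ (iSup_le fun χ => ?_)
  · exact le_iSup_of_le 0 (le_sup_of_le_right (le_iSup_of_le rfl le_rfl))
  · rw [LieSubmodule.iSup_toSubmodule]
    refine iSup_le fun hχ => ?_
    exact le_iSup_of_le (p.deg ⟨χ, by simpa using hχ⟩) (le_sup_of_le_left
      (le_iSup₂_of_le ⟨χ, by simpa using hχ⟩ rfl le_rfl))

lemma gr_eq_rootPart (k : ℤ) : p.gr k = p.rootPart k := by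
  have h := ((iSupIndep_adEigenspace (p.gradingElt : g)).le_iff_eq_of_iSup_eq_top
    p.iSup_rootPart).1 p.rootPart_le
  exact (congrFun h k).symm

lemma gr_le {k : ℤ} {N : Submodule ℂ g}
    (h : ∀ α : H.root, p.deg α = k → (rootSpace H α.1).toSubmodule ≤ N)
    (h0 : k = 0 → H.toSubmodule ≤ N) : p.gr k ≤ N := by
  rw [gr_eq_rootPart]
  exact sup_le (iSup₂_le h) (iSup_le h0)

lemma grOn_univ : p.grOn Set.univ = ⊤ := by
  rw [eq_top_iff, ← p.iSup_rootPart]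
  exact iSup_le fun k => (p.rootPart_le k).trans (p.gr_le_grOn (Set.mem_univ k))

lemma isCompl_grOn {s t : Set ℤ} (h : IsCompl s t) : IsCompl (p.grOn s) (p.grOn t) := by
  refine ⟨disjoint_adEigensum _ h.disjoint, codisjoint_iff.2 ?_⟩
  rw [grOn, grOn, ← adEigensum_union]
  have : s ∪ t = Set.univ := h.sup_eq_top
  rw [this]
  exact p.grOn_univ

lemma exists_lie_of_add {i j k : H.root}
    (h : (k.1 : H → ℂ) = (i.1 : H → ℂ) + (j.1 : H → ℂ)) {N : Submodule ℂ g}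
    (hN : ∀ x ∈ rootSpace H i.1, ∀ y ∈ rootSpace H j.1, ⁅x, y⁆ ∈ N) :
    rootSpace H k.1 ≤ N := by
  intro z hz
  obtain ⟨x, hx, y, hy, rfl⟩ := exists_lie_eq_of_mem_rootSpace h hz
  exact hN x hx y hy

lemma negRoot_le_of_deg_eq_zero {α : H.root} (hα : b.IsPos α) :
    b.IsPos α ∧ (p.deg α = 0 → (rootSpace H (negRoot α).1).toSubmodule ≤ p.carrier.toSubmodule) := by
  refine hα.induction_on_add (p := fun α => b.IsPos α ∧ (p.deg α = 0 →
    (rootSpace H (negRoot α).1).toSubmodule ≤ p.carrier.toSubmodule))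
    (fun i hi => ⟨RootPairing.Base.isPos_of_mem_support hi, fun h0 => ?_⟩) ?_
  · rcases p.deg_of_mem_support hi with h | h
    · exact h.1
    · omega
  · rintro i j k h ⟨hi, hi'⟩ hj
    have hjpos := RootPairing.Base.isPos_of_mem_support hj
    refine ⟨hi.add hjpos h, fun hk => ?_⟩
    have h1 := p.deg_add h
    have h2 := p.deg_nonneg hi
    have h3 := p.deg_nonneg hjpos
    have h4 := hi' (by omega)
    have h5 : (rootSpace H (negRoot j).1).toSubmodule ≤ p.carrier.toSubmodule := by
      rcases p.deg_of_mem_support hj with h | h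
      · exact h.1
      · omega
    refine exists_lie_of_add (i := negRoot i) (j := negRoot j) ?_
      fun x hx y hy => p.carrier.lie_mem (h4 hx) (h5 hy)
    ext x
    rw [Pi.add_apply, negRoot_apply, negRoot_apply, negRoot_apply, congrFun (apply_eq_add h) x,
      Pi.add_apply, neg_add]

lemma deg_eq_zero_of_negRoot_le {α : H.root} (hα : b.IsPos α) :
    b.IsPos α ∧ ((rootSpace H (negRoot α).1).toSubmodule ≤ p.carrier.toSubmodule →
      p.deg α = 0) := by
  refine hα.induction_on_add (p := fun α => b.IsPos α ∧
    ((rootSpace H (negRoot α).1).toSubmodule ≤ p.carrier.toSubmodule → p.deg α = 0))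
    (fun i hi => ⟨RootPairing.Base.isPos_of_mem_support hi, fun h0 => ?_⟩) ?_
  · rcases p.deg_of_mem_support hi with h | h
    · exact h.2
    · exact absurd h0 h.1
  · rintro i j k h ⟨hi, hi'⟩ hj
    have hjpos := RootPairing.Base.isPos_of_mem_support hj
    refine ⟨hi.add hjpos h, fun hk => ?_⟩
    have hx : ∀ x, k.1 x = i.1 x + j.1 x := fun x => congrFun (apply_eq_add h) x
    have h1 : rootSpace H (negRoot j).1 ≤ p.carrier.toSubmodule := by
      refine exists_lie_of_add (i := negRoot k) (j := i) ?_
        fun x hx y hy => p.carrier.lie_mem (hk hx) (p.rootSpace_le_of_isPos hi hy)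
      ext x
      rw [Pi.add_apply, negRoot_apply, negRoot_apply, hx]; ring
    have h2 : rootSpace H (negRoot i).1 ≤ p.carrier.toSubmodule := by
      refine exists_lie_of_add (i := negRoot k) (j := j) ?_
        fun x hx y hy => p.carrier.lie_mem (hk hx) (p.rootSpace_le_of_isPos hjpos hy)
      ext x
      rw [Pi.add_apply, negRoot_apply, negRoot_apply, hx]; ring
    rw [p.deg_add h, hi' h2]
    rcases p.deg_of_mem_support hj with h | h
    · omega
    · exact absurd h1 h.1

lemma negRoot_negRoot (α : H.root) : negRoot (negRoot α) = α := by
  apply Subtype.ext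
  simp [negRoot]

/-- The roots of the parabolic subalgebra are the roots of non-negative degree. -/
lemma rootSpace_le_iff (α : H.root) :
    (rootSpace H α.1).toSubmodule ≤ p.carrier.toSubmodule ↔ 0 ≤ p.deg α := by
  rcases isPos_or_neg (b := b) α with h | h
  · exact ⟨fun _ => p.deg_nonneg h, fun _ _ hx => p.rootSpace_le_of_isPos h hx⟩
  · have h1 := (p.negRoot_le_of_deg_eq_zero h).2
    have h2 := (p.deg_eq_zero_of_negRoot_le h).2
    have h3 := p.deg_nonneg h
    rw [negRoot_negRoot] at h1 h2
    rw [deg_negRoot] at h1 h2 h3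
    exact ⟨fun h => by have := h2 h; omega, fun h => h1 (by omega)⟩

lemma gr_le_carrier {k : ℤ} (hk : 0 ≤ k) : p.gr k ≤ p.carrier.toSubmodule :=
  p.gr_le (fun α hα => (p.rootSpace_le_iff α).2 (by omega)) fun _ => p.cartan_le

lemma grOn_le_carrier {s : Set ℤ} (hs : ∀ k ∈ s, 0 ≤ k) : p.grOn s ≤ p.carrier.toSubmodule :=
  p.grOn_le fun k hk => p.gr_le_carrier (hs k hk)

lemma exists_gr_neg_ne_bot : ∃ k < 0, p.gr k ≠ ⊥ := by
  by_contra! h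
  apply p.ne_top
  rw [eq_top_iff]
  intro x _
  have h1 : (⊤ : Submodule ℂ g) ≤ p.carrier.toSubmodule := by
    rw [← p.grOn_univ]
    refine p.grOn_le fun k _ => ?_
    rcases lt_or_ge k 0 with hk | hk
    · rw [h k hk]; exact bot_le
    · exact p.gr_le_carrier hk
  exact h1 trivial

lemma carrier_le : p.carrier.toSubmodule ≤ p.grOn (Set.Ici 0) := by
  intro x hx
  let P : LieSubmodule ℂ H g :=
    { p.carrier.toSubmodule with
      lie_mem := fun {h m} hm => p.carrier.lie_mem (p.cartan_le h.2) hm }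
  have key := eq_iSup_inf_genWeightSpace ℂ H g P
  have h1 : P.toSubmodule ≤ p.grOn (Set.Ici 0) := by
    rw [key, LieSubmodule.iSup_toSubmodule]
    refine iSup_le fun χ => ?_
    rintro x ⟨hxP, hxχ⟩
    by_cases hx0 : x = 0
    · rw [hx0]; exact Submodule.zero_mem _
    by_cases hχ : χ.IsZero
    · refine p.gr_le_grOn (k := 0) (by simp) (p.cartan_le_gr ?_)
      have : x ∈ rootSpace H (0 : H → ℂ) := by rw [← hχ.eq]; exact hxχ
      rwa [rootSpace_zero_eq ℂ g H] at this
    · let α : H.root := ⟨χ, by simpa using hχ⟩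
      have hle : rootSpace H α.1 ≤ P := rootSpace_le_of_mem (α := α) hxP hxχ hx0
      exact p.gr_le_grOn (k := p.deg α) ((p.rootSpace_le_iff α).1 hle) (p.rootSpace_le_gr α hxχ)
  exact h1 hx

lemma nil_le_grOn : p.nil.toSubmodule ≤ p.grOn (Set.Ici 1) := by
  refine p.nil_le.trans (iSup_le fun α => iSup₂_le fun hα hα' => ?_)
  rw [rootSpace_le_iff] at hα hα'
  rw [deg_negRoot] at hα
  exact (p.rootSpace_le_gr α).trans (p.gr_le_grOn (Set.mem_Ici.2 (by omega)))

lemma exists_grOn_eq_bot : ∃ n : ℕ, p.grOn (Set.Ici (n : ℤ)) = ⊥ := by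
  have hfin : {k | p.gr k ≠ ⊥}.Finite :=
    WellFoundedGT.finite_ne_bot_of_iSupIndep (iSupIndep_adEigenspace (p.gradingElt : g))
  obtain ⟨N, hN⟩ := hfin.bddAbove
  refine ⟨(N + 1).toNat, ?_⟩
  rw [eq_bot_iff]
  refine p.grOn_le fun k hk => ?_
  by_contra hne
  have h1 := hN (show k ∈ {k | p.gr k ≠ ⊥} from fun h => hne h.le)
  have h2 : ((N + 1).toNat : ℤ) ≤ k := hk
  have := Int.self_le_toNat (N + 1)
  omega

/-- The nilradical is the part of positive degree. -/
lemma nil_eq_grOn : p.nil.toSubmodule = p.grOn (Set.Ici 1) := by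
  refine le_antisymm p.nil_le_grOn fun x hx => ?_
  let I : LieIdeal ℂ p.carrier :=
    { (p.grOn (Set.Ici 1)).comap p.carrier.toSubmodule.subtype with
      lie_mem := fun {y m} hm => p.lie_mem_grOn (s := Set.Ici 0) (t := Set.Ici 1)
        (fun j hj k hk => by simp only [Set.mem_Ici] at *; omega) (p.carrier_le y.2) hm }
  have hxp : x ∈ p.carrier :=
    p.grOn_le_carrier (s := Set.Ici 1) (fun k hk => by simp only [Set.mem_Ici] at hk; omega) hx
  have hI : LieRing.IsNilpotent I := by
    rw [LieAlgebra.isNilpotent_iff_forall (R := ℂ)]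
    intro u
    obtain ⟨n, hn⟩ := p.exists_grOn_eq_bot
    refine ⟨n, LinearMap.ext fun v => ?_⟩
    have h1 : ∀ m : ℕ, (((LieAlgebra.ad ℂ I u ^ m) v : I) : p.carrier).1 ∈
        p.grOn (Set.Ici ((m : ℤ) + 1)) := by
      intro m
      induction m with
      | zero =>
        have := v.2
        change ((v : p.carrier) : g) ∈ p.grOn (Set.Ici 1) at this
        simpa using this
      | succ m ih =>
        rw [pow_succ', Module.End.mul_apply]
        exact p.lie_mem_grOn (s := Set.Ici 1) (t := Set.Ici ((m : ℤ) + 1))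
          (fun j hj k hk => by simp only [Set.mem_Ici] at *; push_cast; omega) u.2 ih
    have h2 : (((LieAlgebra.ad ℂ I u ^ n) v : I) : p.carrier).1 ∈ p.grOn (Set.Ici (n : ℤ)) :=
      adEigensum_mono (Set.Ici_subset_Ici.2 (by omega)) (h1 n)
    rw [hn, Submodule.mem_bot] at h2
    exact Subtype.ext (Subtype.ext h2)
  refine p.mem_nil.2 ⟨hxp, ?_⟩
  have h3 : I ≤ nilradical p.carrier := le_sSup hI
  exact h3 hx

/-- The part of positive degree is generated, as a Lie algebra, by the part of degree one. -/
lemma grOn_le_lieSpan :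
    p.grOn (Set.Ici 1) ≤ (LieSubalgebra.lieSpan ℂ g (p.gr 1 : Set g)).toSubmodule := by
  set T := LieSubalgebra.lieSpan ℂ g (p.gr 1 : Set g)
  have hT1 : p.gr 1 ≤ T.toSubmodule := LieSubalgebra.subset_lieSpan
  have hT0 : ∀ x ∈ p.gr 0, ∀ y ∈ T, ⁅x, y⁆ ∈ T := by
    intro x hx y hy
    induction hy using LieSubalgebra.lieSpan_induction with
    | mem y hy => exact hT1 (by simpa using p.lie_mem_gr hx hy)
    | zero => simp
    | add u v _ _ hu hv => rw [lie_add]; exact add_mem hu hv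
    | smul a u _ hu => rw [lie_smul]; exact T.smul_mem a hu
    | lie u v hu' hv' hu hv =>
      rw [leibniz_lie]
      exact add_mem (T.lie_mem hu hv') (T.lie_mem hu' hv)
  have key : ∀ α : H.root, b.IsPos α → b.IsPos α ∧
      (1 ≤ p.deg α → (rootSpace H α.1).toSubmodule ≤ T.toSubmodule) := by
    intro α hα
    refine hα.induction_on_add (p := fun α => b.IsPos α ∧
      (1 ≤ p.deg α → (rootSpace H α.1).toSubmodule ≤ T.toSubmodule))
      (fun i hi => ⟨RootPairing.Base.isPos_of_mem_support hi, fun h1 => ?_⟩) ?_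
    · have : p.deg i = 1 := by rcases p.deg_of_mem_support hi with h | h <;> omega
      exact (this ▸ p.rootSpace_le_gr i).trans hT1
    · rintro i j k h ⟨hi, hi'⟩ hj
      have hjpos := RootPairing.Base.isPos_of_mem_support hj
      refine ⟨hi.add hjpos h, fun hk => ?_⟩
      have h1 := p.deg_add h
      have h2 := p.deg_nonneg hi
      by_cases hk1 : p.deg k = 1
      · exact (hk1 ▸ p.rootSpace_le_gr k).trans hT1
      have hi1 : 1 ≤ p.deg i := by rcases p.deg_of_mem_support hj with h | h <;> omega
      refine exists_lie_of_add (apply_eq_add h) fun x hx y hy => ?_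
      rcases p.deg_of_mem_support hj with h | h
      · rw [← lie_skew]
        exact neg_mem (hT0 y (h.2 ▸ p.rootSpace_le_gr j hy) x (hi' hi1 hx))
      · exact T.lie_mem (hi' hi1 hx) (hT1 (h.2 ▸ p.rootSpace_le_gr j hy))
  refine p.grOn_le fun k hk => p.gr_le (fun α hα => ?_) fun h0 => ?_
  · have hk' : 1 ≤ k := hk
    refine (key α ?_).2 (by omega)
    rcases isPos_or_neg (b := b) α with h | h
    · exact h
    · have := p.deg_nonneg h
      rw [deg_negRoot] at this
      omega
  · have hk' : 1 ≤ k := hk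
    omega

/-- The Killing form is a perfect pairing of the components of opposite degrees. -/
lemma eq_zero_of_killingForm_gr {k : ℤ} {y : g} (hy : y ∈ p.gr k)
    (h : ∀ x ∈ p.gr (-k), killingForm ℂ g x y = 0) : y = 0 := by
  have h1 : y ∈ LinearMap.ker (killingForm ℂ g) := by
    rw [LinearMap.mem_ker]
    ext x
    rw [LinearMap.zero_apply, LieModule.traceForm_comm]
    have h2 : p.grOn Set.univ ≤ LinearMap.ker ((killingForm ℂ g).flip y) := by
      refine p.grOn_le fun j _ x hx => ?_
      change killingForm ℂ g x y = 0
      by_cases hj : j = -k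
      · exact h x (hj ▸ hx)
      · exact killingForm_adEigenspace hx hy (by omega)
    rw [grOn_univ] at h2
    exact h2 trivial
  rw [IsKilling.ker_killingForm_eq_bot] at h1
  simpa using h1

/-- An element of degree zero commuting with the components of non-zero degree is zero, since such
elements form an ideal. -/
lemma eq_zero_of_lie_gr {y : g} (hy : y ∈ p.gr 0) (h : ∀ j ≠ 0, ∀ x ∈ p.gr j, ⁅x, y⁆ = 0) :
    y = 0 := by
  let N : Submodule ℂ g :=
    { carrier := {y | y ∈ p.gr 0 ∧ ∀ j ≠ 0, ∀ x ∈ p.gr j, ⁅x, y⁆ = 0}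
      add_mem' := fun {u v} hu hv => ⟨add_mem hu.1 hv.1, fun j hj x hx => by
        rw [lie_add, hu.2 j hj x hx, hv.2 j hj x hx, add_zero]⟩
      zero_mem' := ⟨Submodule.zero_mem _, fun j hj x hx => lie_zero x⟩
      smul_mem' := fun r u hu => ⟨Submodule.smul_mem _ _ hu.1, fun j hj x hx => by
        rw [lie_smul, hu.2 j hj x hx, smul_zero]⟩ }
  have hN : ∀ a : g, ∀ u ∈ N, ⁅a, u⁆ ∈ N := by
    intro a u hu
    have h1 : p.grOn Set.univ ≤ N.comap (LieAlgebra.ad ℂ g u : Module.End ℂ g) := by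
      refine p.grOn_le fun j _ a ha => ?_
      rw [Submodule.mem_comap, LieAlgebra.ad_apply, ← lie_skew]
      refine neg_mem ?_
      by_cases hj : j = 0
      · subst hj
        refine ⟨by simpa using p.lie_mem_gr ha hu.1, fun i hi x hx => ?_⟩
        have h2 := p.lie_mem_gr hx ha
        rw [add_zero] at h2
        rw [leibniz_lie, hu.2 i hi _ h2, hu.2 i hi x hx, lie_zero, add_zero]
      · rw [hu.2 j hj a ha]; exact Submodule.zero_mem _
    rw [grOn_univ] at h1
    have h3 : ⁅u, a⁆ ∈ N := h1 (Submodule.mem_top (x := a))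
    rw [← lie_skew]
    exact neg_mem h3
  let I : LieIdeal ℂ g := { N with lie_mem := fun {a u} hu => hN a u hu }
  rcases LieAlgebra.IsSimple.eq_bot_or_eq_top (R := ℂ) I with hI | hI
  · have h1 : y ∈ I := ⟨hy, h⟩
    rw [hI] at h1
    simpa using h1
  · exfalso
    obtain ⟨k, hk, hne⟩ := p.exists_gr_neg_ne_bot
    obtain ⟨x, hx, hx0⟩ := (Submodule.ne_bot_iff _).1 hne
    have h1 : x ∈ I := by rw [hI]; trivial
    have h2 : x ∈ p.gr 0 := h1.1
    exact hx0 (p.eq_zero_of_mem_grOn (s := {k}) (t := {0}) (by simpa using hk.ne)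
      (p.gr_le_grOn (Set.mem_singleton k) hx) (p.gr_le_grOn (Set.mem_singleton 0) h2))

/-- An element of non-positive degree commuting with the part of degree one is zero. -/
lemma eq_zero_of_lie_gr_one {k : ℤ} (hk : k ≤ 0) {y : g} (hy : y ∈ p.gr k)
    (h : ∀ x ∈ p.gr 1, ⁅x, y⁆ = 0) : y = 0 := by
  have h0 : ∀ x ∈ LieSubalgebra.lieSpan ℂ g (p.gr 1 : Set g), ⁅x, y⁆ = 0 := by
    intro x hx
    induction hx using LieSubalgebra.lieSpan_induction with
    | mem x hx => exact h x hx
    | zero => simp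
    | add u v _ _ hu hv => rw [add_lie, hu, hv, add_zero]
    | smul a u _ hu => rw [smul_lie, hu, smul_zero]
    | lie u v _ _ hu hv => rw [lie_lie, hu, hv, lie_zero, lie_zero, sub_zero]
  have h1 : ∀ j, 1 ≤ j → ∀ x ∈ p.gr j, ⁅x, y⁆ = 0 := fun j hj x hx =>
    h0 x (p.grOn_le_lieSpan (p.gr_le_grOn (Set.mem_Ici.2 hj) hx))
  rcases hk.lt_or_eq with hk | rfl
  · refine p.eq_zero_of_killingForm_gr hy fun x hx => ?_
    have h2 := killingForm_lie (p.gradingElt : g) x y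
    rw [h1 (-k) (by omega) x hx, map_zero, mem_adEigenspace.1 hx, map_smul,
      LinearMap.smul_apply, smul_eq_mul] at h2
    exact (mul_eq_zero.1 h2).resolve_left (by exact_mod_cast (by omega : -k ≠ 0))
  · refine p.eq_zero_of_lie_gr hy fun j hj x hx => ?_
    rcases lt_or_gt_of_ne hj with hj | hj
    · have h2 := p.lie_mem_gr hx hy
      rw [add_zero] at h2
      refine p.eq_zero_of_killingForm_gr h2 fun u hu => ?_
      rw [← lie_skew, map_neg, ← killingForm_lie, h1 (-j) (by omega) u hu, map_zero,
        LinearMap.zero_apply, neg_zero]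
    · exact h1 j hj x hx

lemma mem_roots_iff {α : H.root} : α ∈ p.roots ↔ 1 ≤ p.deg α := by
  have hnil : ∀ x : g, x ∈ p.nil ↔ x ∈ p.grOn (Set.Ici 1) := fun x => by
    rw [← nil_eq_grOn]; rfl
  constructor
  · rintro ⟨x, hx, hx0, hxα⟩
    by_contra h
    rw [hnil] at hx
    exact hx0 (p.eq_zero_of_mem_grOn (by simpa using h) hx
      (p.gr_le_grOn (Set.mem_singleton (p.deg α)) (p.rootSpace_le_gr α hxα)))
  · intro h
    obtain ⟨x, hx, hx0⟩ := α.1.exists_ne_zero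
    exact ⟨x, (hnil x).2 (p.gr_le_grOn (Set.mem_Ici.2 h) (p.rootSpace_le_gr α hx)), hx0, hx⟩

lemma derivedAsModule_le : p.derivedAsModule.toSubmodule ≤ p.grOn (Set.Ici 2) := by
  rintro _ ⟨y, hy, rfl⟩
  change y ∈ ⁅(⊤ : LieIdeal ℂ p.nil), (⊤ : LieIdeal ℂ p.nil)⁆ at hy
  rw [← LieSubmodule.mem_toSubmodule, LieSubmodule.lieIdeal_oper_eq_linear_span'] at hy
  induction hy using Submodule.span_induction with
  | mem y hy =>
    obtain ⟨u, -, v, -, rfl⟩ := hy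
    exact p.lie_mem_grOn (fun j hj k hk => by simp only [Set.mem_Ici] at *; omega)
      (p.nil_le_grOn u.2) (p.nil_le_grOn v.2)
  | zero => rw [map_zero]; exact Submodule.zero_mem _
  | add u v _ _ hu hv => rw [map_add]; exact Submodule.add_mem _ hu hv
  | smul r u _ hu => rw [map_smul]; exact Submodule.smul_mem _ r hu

lemma gr_le_derivedAsModule {k : ℤ} (hk : 2 ≤ k) : p.gr k ≤ p.derivedAsModule.toSubmodule := by
  have hnil : ∀ {x : g}, x ∈ p.grOn (Set.Ici 1) → x ∈ p.nil := fun {x} hx => by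
    rw [← nil_eq_grOn] at hx; exact hx
  have h1 : ∀ x ∈ LieSubalgebra.lieSpan ℂ g (p.gr 1 : Set g), x ∈ p.grOn (Set.Ici 1) ∧
      x ∈ p.gr 1 ⊔ p.derivedAsModule.toSubmodule := by
    intro x hx
    induction hx using LieSubalgebra.lieSpan_induction with
    | mem x hx => exact ⟨p.gr_le_grOn (by simp) hx, Submodule.mem_sup_left hx⟩
    | zero => exact ⟨Submodule.zero_mem _, Submodule.zero_mem _⟩
    | add u v _ _ hu hv => exact ⟨add_mem hu.1 hv.1, add_mem hu.2 hv.2⟩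
    | smul a u _ hu => exact ⟨Submodule.smul_mem _ a hu.1, Submodule.smul_mem _ a hu.2⟩
    | lie u v _ _ hu hv =>
      refine ⟨p.lie_mem_grOn (fun j hj k hk => by simp only [Set.mem_Ici] at *; omega) hu.1 hv.1,
        Submodule.mem_sup_right ?_⟩
      exact ⟨⁅(⟨u, hnil hu.1⟩ : p.nil), (⟨v, hnil hv.1⟩ : p.nil)⁆,
        LieSubmodule.lie_mem_lie (LieSubmodule.mem_top _) (LieSubmodule.mem_top _), rfl⟩
  intro x hx
  obtain ⟨a, ha, d, hd, rfl⟩ := Submodule.mem_sup.1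
    (h1 x (p.grOn_le_lieSpan (p.gr_le_grOn (Set.mem_Ici.2 (by omega)) hx))).2
  have h2 : a ∈ p.grOn (Set.Ici 2) := by
    rw [← add_sub_cancel_right a d]
    exact sub_mem (p.gr_le_grOn (Set.mem_Ici.2 hk) hx) (p.derivedAsModule_le hd)
  have h3 : a = 0 := p.eq_zero_of_mem_grOn (s := {1}) (t := Set.Ici 2) (by simp)
    (p.gr_le_grOn (Set.mem_singleton 1) ha) h2
  rwa [h3, zero_add]

/-- The roots which appear in the nilradical but not in its derived algebra are the roots of degree
one. -/
lemma mem_rootsZero_iff {α : H.root} : α ∈ p.rootsZero ↔ p.deg α = 1 := by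
  constructor
  · rintro ⟨h1, h2⟩
    rw [mem_roots_iff] at h1
    by_contra h
    obtain ⟨x, hx, hx0⟩ := α.1.exists_ne_zero
    obtain ⟨u, hu, hux⟩ := p.gr_le_derivedAsModule (k := p.deg α) (by omega)
      (p.rootSpace_le_gr α hx)
    refine h2 ⟨u, hu, fun h0 => hx0 ?_, ?_⟩
    · rw [← hux, h0]; rfl
    · rw [← hux] at hx
      exact hx
  · intro h
    refine ⟨p.mem_roots_iff.2 h.ge, ?_⟩
    rintro ⟨u, hu, hu0, huα⟩
    have h1 := p.derivedAsModule_le ⟨u, hu, rfl⟩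
    have h2 := p.eq_zero_of_mem_grOn (s := {1}) (t := Set.Ici 2) (by simp)
      (p.gr_le_grOn (Set.mem_singleton 1) (h ▸ p.rootSpace_le_gr α huα)) h1
    exact hu0 (Subtype.ext h2)

end ProperParabolic

end WhittakerInduction

namespace WhittakerInduction

open LieAlgebra LieModule LieAlgebra.IsKilling

attribute [local instance] LieRing.ofAssociativeRing

/-! ### Graded subspaces of loop algebras and of affine Lie algebras -/

section Loops

variable {g : Type*} [LieRing g] [LieAlgebra ℂ g]

/-- The coefficient of `t ^ i` in an element of a loop algebra. -/
def loopCoeff (i : ℤ) : Loop g →ₗ[ℂ] g :=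
  Finsupp.lapply i ∘ₗ (LoopAlgebra.toFinsupp ℂ ℤ g).toLinearMap

lemma loopCoeff_loopElt (i j : ℤ) (x : g) :
    loopCoeff j (loopElt i x) = if i = j then x else 0 := by
  change LoopAlgebra.toFinsupp ℂ ℤ g (AddMonoidAlgebra.single i (1 : ℂ) ⊗ₜ[ℂ] x) j = _
  rw [LoopAlgebra.toFinsupp_single_tmul, Finsupp.single_apply]

lemma exists_eq_sum_loopElt (a : Loop g) :
    ∃ s : Finset ℤ, a = ∑ i ∈ s, loopElt i (loopCoeff i a) := by
  have h := (LoopAlgebra.toFinsupp ℂ ℤ g).symm_apply_apply a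
  refine ⟨(LoopAlgebra.toFinsupp ℂ ℤ g a).support, ?_⟩
  conv_lhs => rw [← h, ← Finsupp.sum_single (LoopAlgebra.toFinsupp ℂ ℤ g a)]
  rw [Finsupp.sum, map_sum]
  exact Finset.sum_congr rfl fun i _ => LoopAlgebra.toFinsupp_symm_single ℂ ℤ g i _

lemma eq_zero_of_loopCoeff {a : Loop g} (h : ∀ i, loopCoeff i a = 0) : a = 0 := by
  obtain ⟨s, hs⟩ := exists_eq_sum_loopElt a
  rw [hs]
  exact Finset.sum_eq_zero fun i _ => by rw [h, map_zero]

/-- The sum of the subspaces `S i ⊗ t ^ i` of a loop algebra. -/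
def loopSpan (S : ℤ → Submodule ℂ g) : Submodule ℂ (Loop g) :=
  ⨆ i, (S i).map (loopElt i)

variable {S T U : ℤ → Submodule ℂ g}

lemma loopElt_mem {i : ℤ} {x : g} (hx : x ∈ S i) : loopElt i x ∈ loopSpan S :=
  Submodule.mem_iSup_of_mem i ⟨x, hx, rfl⟩

lemma loopSpan_le {N : Submodule ℂ (Loop g)} (h : ∀ i, ∀ x ∈ S i, loopElt i x ∈ N) :
    loopSpan S ≤ N := by
  refine iSup_le fun i => ?_
  rintro _ ⟨x, hx, rfl⟩
  exact h i x hx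

lemma loopSpan_mono (h : ∀ i, S i ≤ T i) : loopSpan S ≤ loopSpan T :=
  loopSpan_le fun i _ hx => loopElt_mem (h i hx)

lemma loopCoeff_mem {a : Loop g} (ha : a ∈ loopSpan S) (i : ℤ) : loopCoeff i a ∈ S i := by
  have : loopSpan S ≤ (S i).comap (loopCoeff i) := by
    refine loopSpan_le fun j x hx => ?_
    rw [Submodule.mem_comap, loopCoeff_loopElt]
    split_ifs with h
    · exact h ▸ hx
    · exact Submodule.zero_mem _
  exact this ha

lemma isCompl_loopSpan (h : ∀ i, IsCompl (S i) (T i)) : IsCompl (loopSpan S) (loopSpan T) := by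
  constructor
  · rw [Submodule.disjoint_def]
    intro a hS hT
    exact eq_zero_of_loopCoeff fun i =>
      Submodule.disjoint_def.1 (h i).disjoint _ (loopCoeff_mem hS i) (loopCoeff_mem hT i)
  · rw [codisjoint_iff, eq_top_iff]
    intro a _
    induction a using loop_induction with
    | h0 => exact Submodule.zero_mem _
    | hadd a a' h h' => exact add_mem (h trivial) (h' trivial)
    | hs x i =>
      obtain ⟨u, hu, v, hv, rfl⟩ := Submodule.mem_sup.1
        (show x ∈ S i ⊔ T i by rw [(h i).sup_eq_top]; trivial)
      rw [map_add]
      exact Submodule.add_mem_sup (loopElt_mem hu) (loopElt_mem hv)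

lemma lie_mem_loopSpan (h : ∀ i j, ∀ x ∈ S i, ∀ y ∈ T j, ⁅x, y⁆ ∈ U (i + j)) {a a' : Loop g}
    (ha : a ∈ loopSpan S) (ha' : a' ∈ loopSpan T) : ⁅a, a'⁆ ∈ loopSpan U := by
  have h1 : loopSpan S ≤
      (loopSpan U).comap (LieAlgebra.ad ℂ (Loop g) a' : Module.End ℂ (Loop g)) := by
    refine loopSpan_le fun i x hx => ?_
    have h2 : loopSpan T ≤
        (loopSpan U).comap (LieAlgebra.ad ℂ (Loop g) (loopElt i x) : Module.End ℂ (Loop g)) := by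
      refine loopSpan_le fun j y hy => ?_
      rw [Submodule.mem_comap, LieAlgebra.ad_apply, loopElt_lie]
      exact loopElt_mem (h i j x hx y hy)
    rw [Submodule.mem_comap, LieAlgebra.ad_apply, ← lie_skew]
    exact neg_mem (h2 ha')
  rw [← lie_skew]
  exact neg_mem (h1 ha)

lemma loopDeriv_mem {a : Loop g} (ha : a ∈ loopSpan S) : loopDeriv g a ∈ loopSpan S := by
  have h1 : loopSpan S ≤ (loopSpan S).comap (loopDeriv g) := by
    refine loopSpan_le fun i x hx => ?_
    rw [Submodule.mem_comap, loopDeriv_loopElt]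
    exact Submodule.smul_mem _ _ (loopElt_mem hx)
  exact h1 ha

lemma loopCocycle_eq_zero
    (h : ∀ i : ℤ, ∀ x ∈ S i, ∀ y ∈ T (-i), (i : ℂ) * killingForm ℂ g x y = 0) {a a' : Loop g}
    (ha : a ∈ loopSpan S) (ha' : a' ∈ loopSpan T) : loopCocycle g a a' = 0 := by
  have h1 : loopSpan S ≤ LinearMap.ker (loopCocycle g a') := by
    refine loopSpan_le fun i x hx => ?_
    have h2 : loopSpan T ≤ LinearMap.ker (loopCocycle g (loopElt i x)) := by
      refine loopSpan_le fun j y hy => ?_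
      rw [LinearMap.mem_ker, loopCocycle_loopElt]
      split_ifs with hij
      · subst hij
        exact h (-j) x hx y (by rwa [neg_neg])
      · rfl
    have h3 := loopCocycle_skew (loopElt i x) a'
    rw [LinearMap.mem_ker.1 (h2 ha'), zero_add] at h3
    exact LinearMap.mem_ker.2 h3
  have h4 := loopCocycle_skew a a'
  rwa [LinearMap.mem_ker.1 (h1 ha), add_zero] at h4

/-- The subalgebra of the affine Lie algebra consisting of a graded subalgebra of the loop algebra
and of `d` and `c`. -/
def affineSub (S : ℤ → Submodule ℂ g) (hS : ∀ i j, ∀ x ∈ S i, ∀ y ∈ S j, ⁅x, y⁆ ∈ S (i + j)) :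
    LieSubalgebra ℂ (Affine g) where
  carrier := {x | x.loop ∈ loopSpan S}
  add_mem' {_ _} hx hy := (loopSpan S).add_mem hx hy
  zero_mem' := (loopSpan S).zero_mem
  smul_mem' r _ hx := (loopSpan S).smul_mem r hx
  lie_mem' {_ _} hx hy := (loopSpan S).sub_mem ((loopSpan S).add_mem (lie_mem_loopSpan hS hx hy)
    ((loopSpan S).smul_mem _ (loopDeriv_mem hy))) ((loopSpan S).smul_mem _ (loopDeriv_mem hx))

/-- A graded subalgebra of the loop algebra on which the cocycle vanishes, as a subalgebra of the
affine Lie algebra. -/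
def loopSub (S : ℤ → Submodule ℂ g) (hS : ∀ i j, ∀ x ∈ S i, ∀ y ∈ S j, ⁅x, y⁆ ∈ S (i + j))
    (hκ : ∀ i : ℤ, ∀ x ∈ S i, ∀ y ∈ S (-i), (i : ℂ) * killingForm ℂ g x y = 0) :
    LieSubalgebra ℂ (Affine g) where
  carrier := {x | x.loop ∈ loopSpan S ∧ x.dCoeff = 0 ∧ x.cCoeff = 0}
  add_mem' hx hy := ⟨add_mem hx.1 hy.1, by simp [hx.2.1, hy.2.1], by simp [hx.2.2, hy.2.2]⟩
  zero_mem' := ⟨Submodule.zero_mem _, rfl, rfl⟩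
  smul_mem' r _ hx := ⟨Submodule.smul_mem _ r hx.1, by simp [hx.2.1], by simp [hx.2.2]⟩
  lie_mem' {x y} hx hy := ⟨sub_mem (add_mem (lie_mem_loopSpan hS hx.1 hy.1)
    (Submodule.smul_mem _ _ (loopDeriv_mem hy.1))) (Submodule.smul_mem _ _ (loopDeriv_mem hx.1)),
    rfl, loopCocycle_eq_zero hκ hx.1 hy.1⟩

lemma isCompl_affineSub_loopSub (h : ∀ i, IsCompl (S i) (T i))
    {hS : ∀ i j, ∀ x ∈ S i, ∀ y ∈ S j, ⁅x, y⁆ ∈ S (i + j)}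
    {hT : ∀ i j, ∀ x ∈ T i, ∀ y ∈ T j, ⁅x, y⁆ ∈ T (i + j)}
    {hκ : ∀ i : ℤ, ∀ x ∈ T i, ∀ y ∈ T (-i), (i : ℂ) * killingForm ℂ g x y = 0} :
    IsCompl (affineSub S hS).toSubmodule (loopSub T hT hκ).toSubmodule := by
  have hc := isCompl_loopSpan h
  constructor
  · rw [Submodule.disjoint_def]
    rintro x hx ⟨hxT, hd, hc'⟩
    ext
    · exact Submodule.disjoint_def.1 hc.disjoint _ hx hxT
    · exact hd
    · exact hc'
  · rw [codisjoint_iff, eq_top_iff]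
    intro x _
    obtain ⟨u, hu, v, hv, huv⟩ := Submodule.mem_sup.1
      (show x.loop ∈ loopSpan S ⊔ loopSpan T by rw [hc.sup_eq_top]; trivial)
    have : x = ⟨u, x.dCoeff, x.cCoeff⟩ + ⟨v, 0, 0⟩ := by
      ext
      · exact huv.symm
      · simp
      · simp
    rw [this]
    exact Submodule.add_mem_sup (show _ ∈ affineSub S hS from hu)
      (show _ ∈ loopSub T hT hκ from ⟨hv, rfl, rfl⟩)

end Loops

/-! ### The existence of Whittaker vectors of arbitrary level -/

/-- If `c` acts by `θ` on the unit of the enveloping algebra of a subalgebra, it acts by `θ`. -/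
lemma central_smul {g : Type*} [LieRing g] [LieAlgebra ℂ g] {Q : LieSubalgebra ℂ (Affine g)}
    {ρ : Affine g →ₗ⁅ℂ⁆ Module.End ℂ (UniversalEnvelopingAlgebra ℂ Q)}
    (hρ : ∀ (q : Q) u, ρ q u = UniversalEnvelopingAlgebra.ι ℂ q * u) {θ : ℂ}
    (h1 : ρ (Affine.c g) 1 = θ • 1) (u : UniversalEnvelopingAlgebra ℂ Q) :
    ρ (Affine.c g) u = θ • u := by
  induction u using enveloping_induction with
  | h1 => exact h1
  | hadd u v hu hv => rw [map_add, hu, hv, smul_add]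
  | hsmul r u hu => rw [map_smul, hu, smul_comm]
  | hmul q u hu =>
    have h2 := LieHom.map_lie ρ (Affine.c g) q
    rw [Affine.c_lie, map_zero, LieRing.of_associative_ring_bracket, eq_comm, sub_eq_zero] at h2
    have h3 := LinearMap.congr_fun h2 u
    rw [Module.End.mul_apply, Module.End.mul_apply, hρ, hρ, hu, mul_smul_comm] at h3
    exact h3

/-- The vacuum module of level `θ`: it is induced from the character of `g[t] ⊕ ℂ d ⊕ ℂ c`
with `c ↦ θ`. -/
theorem exists_vacuum (g : Type*) [LieRing g] [LieAlgebra ℂ g] (θ : ℂ) :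
    ∃ (Q : LieSubalgebra ℂ (Affine g))
      (ρ : Affine g →ₗ⁅ℂ⁆ Module.End ℂ (UniversalEnvelopingAlgebra ℂ Q)),
      ∀ u, ρ (Affine.c g) u = θ • u := by
  classical
  let S : ℤ → Submodule ℂ g := fun i => if 0 ≤ i then ⊤ else ⊥
  let T : ℤ → Submodule ℂ g := fun i => if 0 ≤ i then ⊥ else ⊤
  have hST : ∀ i, IsCompl (S i) (T i) := fun i => by
    by_cases hi : 0 ≤ i
    · simpa [S, T, hi] using isCompl_top_bot
    · simpa [S, T, hi] using isCompl_bot_top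
  have hS0 : ∀ {i : ℤ} {x : g}, i < 0 → x ∈ S i → x = 0 := fun {i x} hi hx => by
    simpa [S, not_le.2 hi] using hx
  have hT0 : ∀ {i : ℤ} {x : g}, 0 ≤ i → x ∈ T i → x = 0 := fun {i x} hi hx => by
    simpa [T, hi] using hx
  have hS : ∀ i j, ∀ x ∈ S i, ∀ y ∈ S j, ⁅x, y⁆ ∈ S (i + j) := by
    intro i j x hx y hy
    rcases lt_or_ge i 0 with hi | hi
    · rw [hS0 hi hx, zero_lie]; exact Submodule.zero_mem _
    rcases lt_or_ge j 0 with hj | hj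
    · rw [hS0 hj hy, lie_zero]; exact Submodule.zero_mem _
    simp [S, add_nonneg hi hj]
  have hT : ∀ i j, ∀ x ∈ T i, ∀ y ∈ T j, ⁅x, y⁆ ∈ T (i + j) := by
    intro i j x hx y hy
    rcases lt_or_ge i 0 with hi | hi
    swap
    · rw [hT0 hi hx, zero_lie]; exact Submodule.zero_mem _
    rcases lt_or_ge j 0 with hj | hj
    swap
    · rw [hT0 hj hy, lie_zero]; exact Submodule.zero_mem _
    simp [T, not_le.2 (add_neg hi hj)]
  have hκS : ∀ i : ℤ, ∀ x ∈ S i, ∀ y ∈ S (-i), (i : ℂ) * killingForm ℂ g x y = 0 := by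
    intro i x hx y hy
    rcases lt_trichotomy i 0 with hi | hi | hi
    · rw [hS0 hi hx]; simp
    · simp [hi]
    · rw [hS0 (neg_neg_of_pos hi) hy]; simp
  have hκT : ∀ i : ℤ, ∀ x ∈ T i, ∀ y ∈ T (-i), (i : ℂ) * killingForm ℂ g x y = 0 := by
    intro i x hx y hy
    rcases le_total 0 i with hi | hi
    · rw [hT0 hi hx]; simp
    · rw [hT0 (neg_nonneg.2 hi) hy]; simp
  let χ : affineSub S hS →ₗ[ℂ] ℂ :=
    { toFun := fun x => θ * (x : Affine g).cCoeff
      map_add' := fun x y => mul_add _ _ _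
      map_smul' := fun r x => mul_left_comm _ _ _ }
  obtain ⟨ρ, hρ, hρ1⟩ := exists_induced_of_isCompl
    (isCompl_affineSub_loopSub hST (hS := hS) (hT := hT) (hκ := hκT)) χ (fun x y => by
      change θ * loopCocycle g (x : Affine g).loop (y : Affine g).loop = 0
      rw [loopCocycle_eq_zero hκS x.2 y.2, mul_zero])
  have hc : Affine.c g ∈ affineSub S hS := (loopSpan S).zero_mem
  refine ⟨_, ρ, central_smul hρ ?_⟩
  rw [hρ1 ⟨Affine.c g, hc⟩]
  change (θ * 1) • (1 : UniversalEnvelopingAlgebra ℂ _) = _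
  rw [mul_one]

variable {g : Type*} [LieRing g] [LieAlgebra ℂ g] [FiniteDimensional ℂ g]
  [LieAlgebra.IsSimple ℂ g] {H : LieSubalgebra ℂ g} [H.IsCartanSubalgebra]
  {b : (rootSystem H).Base} (p : ProperParabolic b) (X : RootVectors H)
  (Λ : p.rootsZero → ℤ → ℂ)

/-- The extension of the Whittaker functional to the loop algebra of `g`, by zero on the other root
spaces and on the Cartan subalgebra. -/
def loopWhittaker : Loop g →ₗ[ℂ] ℂ :=
  ∑ᶠ α : p.rootsZero, loopFunctional (Λ α) (X.coeff α.1)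

lemma loopWhittaker_loopElt (x : g) (j : ℤ) :
    loopWhittaker p X Λ (loopElt j x) = ∑ᶠ α : p.rootsZero, Λ α j * X.coeff α.1 x := by
  have := Fintype.ofFinite p.rootsZero
  rw [loopWhittaker, finsum_eq_sum_of_fintype, finsum_eq_sum_of_fintype, LinearMap.sum_apply]
  exact Finset.sum_congr rfl fun α _ => loopFunctional_loopElt _ _ _ _

lemma loopWhittaker_loopIncl (a : Loop p.nil) :
    loopWhittaker p X Λ (loopIncl p a) = whittakerFunctional p X Λ a := by
  induction a using loop_induction with
  | h0 => simp
  | hadd a a' h h' => simp only [map_add, h, h']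
  | hs x i => rw [loopIncl_loopElt, loopWhittaker_loopElt, whittakerFunctional_loopElt]

lemma exists_loopIncl_eq {a : Loop g} (ha : a ∈ loopSpan fun _ => p.nil.toSubmodule) :
    ∃ a' : Loop p.nil, loopIncl p a' = a := by
  have h : loopSpan (fun _ => p.nil.toSubmodule) ≤ LinearMap.range (loopIncl p) :=
    loopSpan_le fun i x hx => ⟨loopElt i ⟨x, hx⟩, loopIncl_loopElt p ⟨x, hx⟩ i⟩
  exact h ha

lemma loopIncl_mem (a : Loop p.nil) : loopIncl p a ∈ loopSpan fun _ => p.nil.toSubmodule := by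
  induction a using loop_induction with
  | h0 => simp
  | hadd a a' h h' => rw [map_add]; exact add_mem h h'
  | hs x i => rw [loopIncl_loopElt]; exact loopElt_mem x.2

/-- There is a non-zero Whittaker vector in a module of level `θ`. The module is a quotient of the
enveloping algebra of `Q = L(g_{≤ 0}) ⊕ ℂ d ⊕ ℂ c`; it is non-zero since `Q` acts on the vacuum
module of level `θ`. -/
theorem exists_whittaker_vector (θ : ℂ) :
    ∃ (Q : LieSubalgebra ℂ (Affine g)) (R : Submodule ℂ (UniversalEnvelopingAlgebra ℂ Q))
      (ρ : Affine g →ₗ⁅ℂ⁆ Module.End ℂ (UniversalEnvelopingAlgebra ℂ Q ⧸ R))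
      (w : UniversalEnvelopingAlgebra ℂ Q ⧸ R), w ≠ 0 ∧ (∀ u, ρ (Affine.c g) u = θ • u) ∧
      ∀ a : Loop p.nil, ρ (loopInclAffine p a) w = whittakerFunctional p X Λ a • w := by
  have hcompl : IsCompl (p.grOn (Set.Iic 0)) p.nil.toSubmodule := by
    rw [p.nil_eq_grOn]
    refine p.isCompl_grOn ⟨?_, ?_⟩
    · rw [Set.disjoint_left]
      intro k hk hk'
      simp only [Set.mem_Iic, Set.mem_Ici] at hk hk'
      omega
    · rw [codisjoint_iff, eq_top_iff]
      intro k _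
      rcases le_or_gt k 0 with hk | hk
      · exact Or.inl hk
      · exact Or.inr hk
  have hS : ∀ i j : ℤ, ∀ x ∈ p.grOn (Set.Iic 0), ∀ y ∈ p.grOn (Set.Iic 0),
      ⁅x, y⁆ ∈ p.grOn (Set.Iic 0) := fun _ _ x hx y hy =>
    p.lie_mem_grOn (fun j hj k hk => by simp only [Set.mem_Iic] at *; omega) hx hy
  have hT : ∀ i j : ℤ, ∀ x ∈ p.nil.toSubmodule, ∀ y ∈ p.nil.toSubmodule,
      ⁅x, y⁆ ∈ p.nil.toSubmodule := fun _ _ x hx y hy => p.nil.lie_mem hx hy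
  have hκ : ∀ i : ℤ, ∀ x ∈ p.nil.toSubmodule, ∀ y ∈ p.nil.toSubmodule,
      (i : ℂ) * killingForm ℂ g x y = 0 := fun i x hx y hy => by
    rw [p.killingForm_nil hx hy, mul_zero]
  let N := loopSub (fun _ => p.nil.toSubmodule) hT hκ
  let Q := affineSub (fun _ => p.grOn (Set.Iic 0)) hS
  let χ : N →ₗ[ℂ] ℂ :=
    { toFun := fun x => loopWhittaker p X Λ (x : Affine g).loop
      map_add' := fun x y => map_add (loopWhittaker p X Λ) _ _
      map_smul' := fun r x => map_smul (loopWhittaker p X Λ) _ _ }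
  obtain ⟨ρ, hρ, hρ1⟩ := exists_induced_of_isCompl
    (N := N) (Q := Q) (isCompl_affineSub_loopSub fun _ => hcompl).symm χ (fun x y => by
      change loopWhittaker p X Λ (⁅(x : Affine g), (y : Affine g)⁆ : Affine g).loop = 0
      obtain ⟨a, ha⟩ := exists_loopIncl_eq p x.2.1
      obtain ⟨a', ha'⟩ := exists_loopIncl_eq p y.2.1
      rw [Affine.loop_lie, x.2.2.1, y.2.2.1, zero_smul, zero_smul, add_zero, sub_zero, ← ha,
        ← ha', ← loopIncl_lie, loopWhittaker_loopIncl, whittakerFunctional_lie])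
  -- The quotient on which `c` acts by `θ`.
  let z : Module.End ℂ (UniversalEnvelopingAlgebra ℂ Q) := ρ (Affine.c g) - θ • 1
  have hz : ∀ x u, ρ x (z u) = z (ρ x u) := by
    intro x u
    have h2 := LieHom.map_lie ρ (Affine.c g) x
    rw [Affine.c_lie, map_zero, LieRing.of_associative_ring_bracket, eq_comm, sub_eq_zero] at h2
    have h3 := LinearMap.congr_fun h2 u
    rw [Module.End.mul_apply, Module.End.mul_apply] at h3
    simp only [z, LinearMap.sub_apply, LinearMap.smul_apply, Module.End.one_apply, map_sub,
      map_smul, h3]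
  let R := LinearMap.range z
  have hR : ∀ x, R ≤ R.comap (ρ x) := by
    rintro x _ ⟨u, rfl⟩
    exact ⟨ρ x u, (hz x u).symm⟩
  let ρ' : Affine g →ₗ⁅ℂ⁆ Module.End ℂ (UniversalEnvelopingAlgebra ℂ Q ⧸ R) :=
    { toFun := fun x => R.mapQ R (ρ x) (hR x)
      map_add' := fun x y => by
        ext u
        change R.mkQ (ρ (x + y) u) = R.mkQ (ρ x u) + R.mkQ (ρ y u)
        rw [map_add, LinearMap.add_apply, map_add]
      map_smul' := fun r x => by
        ext u
        change R.mkQ (ρ (r • x) u) = r • R.mkQ (ρ x u)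
        rw [map_smul, LinearMap.smul_apply, map_smul]
      map_lie' := fun {x y} => by
        ext u
        change R.mkQ (ρ ⁅x, y⁆ u) = R.mkQ (ρ x (ρ y u)) - R.mkQ (ρ y (ρ x u))
        rw [LieHom.map_lie, LieRing.of_associative_ring_bracket, ← map_sub]
        rfl }
  have hρ' : ∀ x u, ρ' x (R.mkQ u) = R.mkQ (ρ x u) := fun x u => rfl
  refine ⟨Q, R, ρ', R.mkQ 1, ?_, ?_, ?_⟩
  · -- Apply an identity `1 = (c - θ) u` to the vacuum module.
    intro h0
    have h1 : (1 : UniversalEnvelopingAlgebra ℂ Q) ∈ R := by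
      rwa [Submodule.mkQ_apply, Submodule.Quotient.mk_eq_zero] at h0
    obtain ⟨u, hu⟩ := h1
    obtain ⟨Q', ρ₀, hρ₀⟩ := exists_vacuum g θ
    have hc : Affine.c g ∈ Q := (loopSpan _).zero_mem
    have hzu : z u = UniversalEnvelopingAlgebra.ι ℂ (⟨Affine.c g, hc⟩ : Q) * u - θ • u := by
      rw [← hρ]; rfl
    rw [hzu] at hu
    have h2 := congrArg (UniversalEnvelopingAlgebra.lift ℂ (ρ₀.comp Q.incl)) hu
    rw [map_sub, map_mul, map_smul, map_one, UniversalEnvelopingAlgebra.lift_ι_apply] at h2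
    have h3 := LinearMap.congr_fun h2 1
    rw [LinearMap.sub_apply, Module.End.mul_apply, LinearMap.smul_apply, Module.End.one_apply]
      at h3
    have h4 : ∀ v, (ρ₀.comp Q.incl) (⟨Affine.c g, hc⟩ : Q) v = θ • v := hρ₀
    rw [h4, sub_self] at h3
    have := enveloping_nontrivial (k := ℂ) Q'
    exact zero_ne_one h3
  · intro u
    obtain ⟨u, rfl⟩ := R.mkQ_surjective u
    rw [hρ', ← map_smul, ← sub_eq_zero, ← map_sub, Submodule.mkQ_apply,
      Submodule.Quotient.mk_eq_zero]
    exact ⟨u, rfl⟩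
  · intro a
    have h1 := hρ1 ⟨loopInclAffine p a, loopIncl_mem p a, rfl, rfl⟩
    rw [hρ']
    simp only at h1
    rw [h1, map_smul]
    congr 1
    exact loopWhittaker_loopIncl p X Λ a

end WhittakerInduction

namespace WhittakerInduction

open LieAlgebra LieModule LieAlgebra.IsKilling

attribute [local instance] LieRing.ofAssociativeRing

/-! ### The induced module -/

section UTheta

variable {g : Type*} [LieRing g] [LieAlgebra ℂ g] (θ : ℂ)

/-- The canonical map from the affine Lie algebra to `U_θ`. -/
def toUTheta (g : Type*) [LieRing g] [LieAlgebra ℂ g] (θ : ℂ) : Affine g →ₗ[ℂ] UTheta g θ :=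
  (RingQuot.mkAlgHom ℂ _).toLinearMap ∘ₗ (UniversalEnvelopingAlgebra.ι ℂ).toLinearMap

lemma toUTheta_apply (z : Affine g) :
    toUTheta g θ z = RingQuot.mkAlgHom ℂ _ (UniversalEnvelopingAlgebra.ι ℂ z) := rfl

lemma toUTheta_lie (z z' : Affine g) : toUTheta g θ ⁅z, z'⁆ =
    toUTheta g θ z * toUTheta g θ z' - toUTheta g θ z' * toUTheta g θ z := by
  simp only [toUTheta_apply, LieHom.map_lie, LieRing.of_associative_ring_bracket, map_sub, map_mul]

lemma toUTheta_c : toUTheta g θ (Affine.c g) = algebraMap ℂ _ θ := by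
  have h := RingQuot.mkAlgHom_rel ℂ (s := fun x y : UniversalEnvelopingAlgebra ℂ (Affine g) =>
    x = UniversalEnvelopingAlgebra.ι ℂ (Affine.c g) ∧ y = algebraMap ℂ _ θ) ⟨rfl, rfl⟩
  rw [AlgHom.commutes] at h
  exact h

lemma uTheta_induction {P : UTheta g θ → Prop} (h1 : P 1) (hadd : ∀ u v, P u → P v → P (u + v))
    (hsmul : ∀ (r : ℂ) u, P u → P (r • u)) (hmul : ∀ z u, P u → P (toUTheta g θ z * u))
    (u : UTheta g θ) : P u := by
  obtain ⟨u, rfl⟩ := RingQuot.mkAlgHom_surjective ℂ _ u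
  induction u using enveloping_induction with
  | h1 => rwa [map_one]
  | hadd u v hu hv => rw [map_add]; exact hadd _ _ hu hv
  | hsmul r u hu => rw [map_smul]; exact hsmul _ _ hu
  | hmul q u hu => rw [map_mul]; exact hmul _ _ hu

end UTheta

section Action

variable {g : Type*} [LieRing g] [LieAlgebra ℂ g] (θ : ℂ) (M : Type*) [AddCommGroup M]
  [Module (UTheta g θ) M] [Module ℂ M] [IsScalarTower ℂ (UTheta g θ) M]

/-- The action of the affine Lie algebra on a module over `U_θ`. -/
def affineAction : Affine g →ₗ[ℂ] Module.End ℂ M :=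
  (Algebra.lsmul ℂ ℂ M).toLinearMap ∘ₗ toUTheta g θ

variable {θ M}

lemma affineAction_apply (z : Affine g) (m : M) : affineAction θ M z m = toUTheta g θ z • m := rfl

lemma affineAction_c (m : M) : affineAction θ M (Affine.c g) m = θ • m := by
  rw [affineAction_apply, toUTheta_c, algebraMap_smul]

lemma smul_mem_of_affineAction {N : Submodule ℂ M} (hN : ∀ z : Affine g, ∀ v ∈ N,
    affineAction θ M z v ∈ N) (u : UTheta g θ) {v : M} (hv : v ∈ N) : u • v ∈ N := by
  induction u using uTheta_induction with
  | h1 => rwa [one_smul]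
  | hadd u u' h h' => rw [add_smul]; exact N.add_mem h h'
  | hsmul r u h => rw [smul_assoc]; exact N.smul_mem r h
  | hmul z u h => rw [mul_smul]; exact hN z _ h

end Action

section InducedModule

variable {g : Type*} [LieRing g] [LieAlgebra ℂ g] [FiniteDimensional ℂ g]
  [LieAlgebra.IsSimple ℂ g] {H : LieSubalgebra ℂ g} [H.IsCartanSubalgebra]
  {b : (rootSystem H).Base} (p : ProperParabolic b) (X : RootVectors H)
  (Λ : p.rootsZero → ℤ → ℂ) (θ : ℂ)

/-- The canonical generator of the induced module. -/
def whittakerVector : WhittakerModule p X Λ θ := Submodule.Quotient.mk (1 ⊗ₜ[ℂ] 1)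

lemma exists_smul_whittakerVector (m : WhittakerModule p X Λ θ) :
    ∃ u : UTheta g θ, m = u • whittakerVector p X Λ θ := by
  obtain ⟨z, rfl⟩ := Submodule.Quotient.mk_surjective _ m
  induction z using TensorProduct.induction_on with
  | zero => exact ⟨0, by rw [zero_smul]; rfl⟩
  | add a a' h h' =>
    obtain ⟨u, hu⟩ := h
    obtain ⟨v, hv⟩ := h'
    exact ⟨u + v, by rw [add_smul, ← hu, ← hv]; rfl⟩
  | tmul u r =>
    refine ⟨r • u, ?_⟩
    rw [whittakerVector, ← Submodule.Quotient.mk_smul, TensorProduct.smul_tmul', smul_eq_mul,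
      mul_one, TensorProduct.smul_tmul, smul_eq_mul, mul_one]

lemma envelopingIncl_ι (a : Loop p.nil) :
    envelopingIncl p θ (UniversalEnvelopingAlgebra.ι ℂ a) =
      toUTheta g θ (loopInclAffine p a) := by
  simp [envelopingIncl, toUTheta_apply]

lemma whittakerRep_ι (a : Loop p.nil) (r : ℂ) :
    whittakerRep p X Λ (UniversalEnvelopingAlgebra.ι ℂ a) r =
      whittakerFunctional p X Λ a * r := by
  rw [whittakerRep, AlgHom.comp_apply, UniversalEnvelopingAlgebra.lift_ι_apply]
  rfl

lemma toUTheta_smul_whittakerVector (a : Loop p.nil) :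
    toUTheta g θ (loopInclAffine p a) • whittakerVector p X Λ θ =
      algebraMap ℂ (UTheta g θ) (whittakerFunctional p X Λ a) • whittakerVector p X Λ θ := by
  have h : (Submodule.Quotient.mk ((1 * envelopingIncl p θ (UniversalEnvelopingAlgebra.ι ℂ a)) ⊗ₜ[ℂ]
      (1 : ℂ)) : WhittakerModule p X Λ θ) = Submodule.Quotient.mk ((1 : UTheta g θ) ⊗ₜ[ℂ]
        (whittakerRep p X Λ (UniversalEnvelopingAlgebra.ι ℂ a) 1)) :=
    (Submodule.Quotient.eq _).2 (Submodule.subset_span ⟨_, _, _, rfl⟩)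
  rw [envelopingIncl_ι, whittakerRep_ι, one_mul, ← smul_eq_mul, ← TensorProduct.smul_tmul,
    Algebra.smul_def, mul_one] at h
  rw [whittakerVector, ← Submodule.Quotient.mk_smul, ← Submodule.Quotient.mk_smul,
    TensorProduct.smul_tmul', TensorProduct.smul_tmul', smul_eq_mul, smul_eq_mul, mul_one, mul_one]
  exact h

/-- The canonical generator of the induced module is non-zero, since there is a module of level `θ`
with a non-zero Whittaker vector, to which the induced module maps. -/
lemma whittakerVector_ne_zero : whittakerVector p X Λ θ ≠ 0 := by
  obtain ⟨Q, R, ρ, w, hw, hc, hρw⟩ := exists_whittaker_vector p X Λ θ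
  let f : UTheta g θ →ₐ[ℂ] Module.End ℂ (UniversalEnvelopingAlgebra ℂ Q ⧸ R) :=
    RingQuot.liftAlgHom ℂ ⟨UniversalEnvelopingAlgebra.lift ℂ ρ, by
      rintro _ _ ⟨rfl, rfl⟩
      refine LinearMap.ext fun u => ?_
      rw [UniversalEnvelopingAlgebra.lift_ι_apply, AlgHom.commutes, hc]
      rfl⟩
  have hf : ∀ z, f (toUTheta g θ z) = ρ z := fun z => by
    rw [toUTheta_apply, RingQuot.liftAlgHom_mkAlgHom_apply, UniversalEnvelopingAlgebra.lift_ι_apply]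
  let F : UTheta g θ ⊗[ℂ] ℂ →ₗ[ℂ] UniversalEnvelopingAlgebra ℂ Q ⧸ R :=
    TensorProduct.lift ((LinearMap.lsmul ℂ _).flip.compl₁₂
      (f.toLinearMap.flip w) LinearMap.id)
  have hF : ∀ u r, F (u ⊗ₜ[ℂ] r) = r • f u w := fun u r => rfl
  have hFs : ∀ u z, F (u • z) = f u (F z) := by
    intro u z
    induction z using TensorProduct.induction_on with
    | zero => simp
    | add a a' h h' => rw [smul_add, map_add, h, h', map_add, map_add]
    | tmul v r => rw [TensorProduct.smul_tmul', hF, hF, smul_eq_mul, map_mul, map_smul]; rfl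
  have hfa : ∀ a, f (envelopingIncl p θ a) w = (whittakerRep p X Λ a 1) • w := by
    intro a
    induction a using enveloping_induction with
    | h1 => simp
    | hadd u v hu hv => simp only [map_add, LinearMap.add_apply, add_smul, hu, hv]
    | hsmul r u hu => simp only [map_smul, LinearMap.smul_apply, hu, smul_assoc]
    | hmul q u hu =>
      rw [map_mul, map_mul, map_mul, Module.End.mul_apply, Module.End.mul_apply, hu, map_smul,
        envelopingIncl_ι, hf, hρw, whittakerRep_ι, smul_smul, mul_comm]
  intro h0
  rw [whittakerVector, Submodule.Quotient.mk_eq_zero] at h0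
  have hspan : ∀ z ∈ Submodule.span (UTheta g θ) {z : UTheta g θ ⊗[ℂ] ℂ |
      ∃ (u : UTheta g θ) (a : UniversalEnvelopingAlgebra ℂ (Loop p.nil)) (v : ℂ),
        z = (u * envelopingIncl p θ a) ⊗ₜ[ℂ] v - u ⊗ₜ[ℂ] (whittakerRep p X Λ a v)}, F z = 0 := by
    intro z hz
    induction hz using Submodule.span_induction with
    | mem z hz =>
      obtain ⟨u, a, v, rfl⟩ := hz
      have hv : whittakerRep p X Λ a v = v • whittakerRep p X Λ a 1 := by
        rw [← map_smul, smul_eq_mul, mul_one]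
      rw [map_sub, hF, hF, map_mul, Module.End.mul_apply, hfa, hv, map_smul, smul_assoc, sub_self]
    | zero => exact map_zero F
    | add a a' _ _ h h' => rw [map_add, h, h', add_zero]
    | smul u a _ h => rw [hFs, h, map_zero]
  have h1 := hspan _ h0
  rw [hF, map_one, one_smul] at h1
  exact hw h1

end InducedModule

end WhittakerInduction

namespace WhittakerInduction

open LieAlgebra LieModule LieAlgebra.IsKilling

attribute [local instance] LieRing.ofAssociativeRing

/-! ### The Kazhdan filtration of the affine Lie algebra -/

variable {g : Type*} [LieRing g] [LieAlgebra ℂ g] [FiniteDimensional ℂ g]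
  [LieAlgebra.IsSimple ℂ g] {H : LieSubalgebra ℂ g} [H.IsCartanSubalgebra]
  {b : (rootSystem H).Base} (p : ProperParabolic b) (X : RootVectors H)
  (Λ : p.rootsZero → ℤ → ℂ) (θ : ℂ)

lemma RootVectors.coeff_eq_zero_of_mem_gr {α : H.root} {k : ℤ} (hk : k ≠ p.deg α) {x : g}
    (hx : x ∈ p.gr k) : X.coeff α x = 0 := by
  have h := p.rootSpace_le_gr _ (X.mem (negRoot α))
  rw [p.deg_negRoot] at h
  rw [RootVectors.coeff, LinearMap.smul_apply, killingForm_adEigenspace h hx (by omega), smul_zero]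

lemma loopWhittaker_eq_zero {s : Set ℤ} (hs : 1 ∉ s) {a : Loop g}
    (ha : a ∈ loopSpan fun _ => p.grOn s) : loopWhittaker p X Λ a = 0 := by
  have h : loopSpan (fun _ => p.grOn s) ≤ LinearMap.ker (loopWhittaker p X Λ) := by
    refine loopSpan_le fun i x hx => ?_
    have h2 : p.grOn s ≤ LinearMap.ker (loopWhittaker p X Λ ∘ₗ loopElt i) := by
      refine p.grOn_le fun k hk x hx => ?_
      rw [LinearMap.mem_ker, LinearMap.comp_apply, loopWhittaker_loopElt]
      refine finsum_eq_zero_of_forall_eq_zero fun α => ?_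
      rw [X.coeff_eq_zero_of_mem_gr p ?_ hx, mul_zero]
      rw [p.mem_rootsZero_iff.1 α.2]
      rintro rfl
      exact hs hk
    exact h2 hx
  exact h ha

namespace ProperParabolic

lemma killingForm_grOn {s t : Set ℤ} (h : ∀ j ∈ s, ∀ k ∈ t, j + k ≠ 0) {x y : g}
    (hx : x ∈ p.grOn s) (hy : y ∈ p.grOn t) : killingForm ℂ g x y = 0 := by
  have h1 : p.grOn s ≤ LinearMap.ker ((killingForm ℂ g).flip y) := by
    refine p.grOn_le fun j hj x hx => ?_
    have h2 : p.grOn t ≤ LinearMap.ker (killingForm ℂ g x) :=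
      p.grOn_le fun k hk y hy => killingForm_adEigenspace hx hy (h j hj k hk)
    exact h2 hy
  exact h1 hx

lemma grOn_mono {s t : Set ℤ} (h : s ⊆ t) : p.grOn s ≤ p.grOn t := adEigensum_mono h

lemma exists_mem_grOn (x : g) : ∃ r : ℕ, x ∈ p.grOn (Set.Ici (-(r : ℤ))) := by
  have hdir : Directed (· ≤ ·) fun r : ℕ => p.grOn (Set.Ici (-(r : ℤ))) :=
    Monotone.directed_le fun r r' h => p.grOn_mono fun k hk => by
      simp only [Set.mem_Ici] at *; omega
  have h : p.grOn Set.univ ≤ ⨆ r : ℕ, p.grOn (Set.Ici (-(r : ℤ))) :=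
    p.grOn_le fun k _ => le_iSup_of_le k.natAbs (p.gr_le_grOn (Set.mem_Ici.2 (by omega)))
  rw [grOn_univ] at h
  exact (Submodule.mem_iSup_of_directed _ hdir).1 (h trivial)

/-- The Kazhdan filtration: `gr (-k) ⊗ ℂ[t, t⁻¹]` has weight `k + 1`, the element `d` has weight one
and `c` has weight zero. -/
def kazhdan (r : ℤ) : Submodule ℂ (Affine g) where
  carrier := {z | z.loop ∈ loopSpan (fun _ => p.grOn (Set.Ici (1 - r))) ∧
    (r < 1 → z.dCoeff = 0) ∧ (r < 0 → z.cCoeff = 0)}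
  add_mem' hx hy := ⟨add_mem hx.1 hy.1, fun h => by simp [hx.2.1 h, hy.2.1 h],
    fun h => by simp [hx.2.2 h, hy.2.2 h]⟩
  zero_mem' := ⟨Submodule.zero_mem _, fun _ => rfl, fun _ => rfl⟩
  smul_mem' a _ hx := ⟨Submodule.smul_mem _ a hx.1, fun h => by simp [hx.2.1 h],
    fun h => by simp [hx.2.2 h]⟩

lemma kazhdan_mono : Monotone p.kazhdan := by
  intro r s hrs z hz
  refine ⟨loopSpan_mono (fun _ => p.grOn_mono ?_) hz.1, fun h => hz.2.1 (by omega),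
    fun h => hz.2.2 (by omega)⟩
  intro k hk
  simp only [Set.mem_Ici] at *
  omega

lemma elt_mem_kazhdan {x : g} {k r : ℤ} (hx : x ∈ p.gr k) (h : 1 - r ≤ k) (n : ℤ) :
    Affine.elt x n ∈ p.kazhdan r :=
  ⟨loopElt_mem (p.gr_le_grOn (Set.mem_Ici.2 h) hx), fun _ => rfl, fun _ => rfl⟩

lemma d_mem_kazhdan {r : ℤ} (hr : 1 ≤ r) : Affine.d g ∈ p.kazhdan r :=
  ⟨Submodule.zero_mem _, fun h => absurd h (by omega), fun _ => rfl⟩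

lemma c_mem_kazhdan {r : ℤ} (hr : 0 ≤ r) : Affine.c g ∈ p.kazhdan r :=
  ⟨Submodule.zero_mem _, fun _ => rfl, fun h => absurd h (by omega)⟩

lemma exists_mem_kazhdan (z : Affine g) : ∃ r, z ∈ p.kazhdan r := by
  have h : ∀ a : Loop g, ∃ r : ℕ, a ∈ loopSpan fun _ => p.grOn (Set.Ici (-(r : ℤ))) := by
    intro a
    induction a using loop_induction with
    | h0 => exact ⟨0, Submodule.zero_mem _⟩
    | hadd a a' h h' =>
      obtain ⟨r, hr⟩ := h
      obtain ⟨r', hr'⟩ := h'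
      have hmono : ∀ r r' : ℕ, r ≤ r' →
          p.grOn (Set.Ici (-(r : ℤ))) ≤ p.grOn (Set.Ici (-(r' : ℤ))) := fun r r' h =>
        p.grOn_mono fun k hk => by simp only [Set.mem_Ici] at *; omega
      exact ⟨max r r', add_mem (loopSpan_mono (fun _ => hmono _ _ (le_max_left _ _)) hr)
        (loopSpan_mono (fun _ => hmono _ _ (le_max_right _ _)) hr')⟩
    | hs x i =>
      obtain ⟨r, hr⟩ := p.exists_mem_grOn x
      exact ⟨r, loopElt_mem hr⟩
  obtain ⟨r, hr⟩ := h z.loop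
  refine ⟨r + 1, loopSpan_mono (fun _ => p.grOn_mono ?_) hr, fun h => ?_, fun h => ?_⟩
  · intro k hk
    simp only [Set.mem_Ici] at *
    omega
  · omega
  · omega

lemma lie_mem_kazhdan {r s : ℤ} {u v : Affine g} (hu : u ∈ p.kazhdan r) (hv : v ∈ p.kazhdan s) :
    ⁅u, v⁆ ∈ p.kazhdan (r + s - 1) := by
  have hd : ∀ {r s : ℤ} {u v : Affine g}, u ∈ p.kazhdan r → v ∈ p.kazhdan s →
      u.dCoeff • loopDeriv g v.loop ∈ loopSpan fun _ => p.grOn (Set.Ici (1 - (r + s - 1))) := by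
    intro r s u v hu hv
    by_cases hr : r < 1
    · rw [hu.2.1 hr, zero_smul]
      exact Submodule.zero_mem _
    · refine Submodule.smul_mem _ _ (loopDeriv_mem (loopSpan_mono (fun _ => p.grOn_mono ?_) hv.1))
      intro k hk
      simp only [Set.mem_Ici] at *
      omega
  refine ⟨sub_mem (add_mem (lie_mem_loopSpan ?_ hu.1 hv.1) (hd hu hv)) ?_, fun _ => rfl,
    fun h => loopCocycle_eq_zero ?_ hu.1 hv.1⟩
  · intro i j x hx y hy
    refine p.lie_mem_grOn (fun j hj k hk => ?_) hx hy
    simp only [Set.mem_Ici] at *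
    omega
  · rw [add_comm r s]
    exact hd hv hu
  · intro i x hx y hy
    rw [p.killingForm_grOn (fun j hj k hk => ?_) hx hy, mul_zero]
    simp only [Set.mem_Ici] at *
    omega

/-- A basis of the component of degree `-k`. -/
def oppBasis (k : ℕ) : Module.Basis (Fin (Module.finrank ℂ (p.gr (-(k : ℤ))))) ℂ (p.gr (-(k : ℤ))) :=
  Module.finBasis ℂ _

/-- The indices for `d`, with index `none`, and a basis of `L(g_{≤ 0})`. -/
abbrev OppIndex : Type := Option ((Σ k : ℕ, Fin (Module.finrank ℂ (p.gr (-(k : ℤ))))) × ℤ)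

/-- The basis of `L(g_{≤ 0}) ⊕ ℂ d`. -/
def oppElt : p.OppIndex → Affine g
  | none => Affine.d g
  | some (i, n) => Affine.elt (p.oppBasis i.1 i.2 : g) n

/-- The Kazhdan weights of the basis of `L(g_{≤ 0}) ⊕ ℂ d`. -/
def oppWeight : p.OppIndex → ℤ
  | none => 1
  | some (i, _) => i.1 + 1

lemma oppElt_mem (i : p.OppIndex) : p.oppElt i ∈ p.kazhdan (p.oppWeight i) := by
  rcases i with _ | ⟨i, n⟩
  · exact p.d_mem_kazhdan le_rfl
  · exact p.elt_mem_kazhdan (p.oppBasis i.1 i.2).2 (by simp [oppWeight]) n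

lemma kazhdan_le (r : ℤ) : p.kazhdan r ≤
    Submodule.span ℂ (p.oppElt '' {i | p.oppWeight i ≤ r}) ⊔ p.kazhdan 0 := by
  set N := Submodule.span ℂ (p.oppElt '' {i | p.oppWeight i ≤ r}) ⊔ p.kazhdan 0
  have hgen : ∀ i, p.oppWeight i ≤ r → p.oppElt i ∈ N := fun i hi =>
    Submodule.mem_sup_left (Submodule.subset_span ⟨i, hi, rfl⟩)
  let incl : Loop g →ₗ[ℂ] Affine g :=
    { toFun := fun a => ⟨a, 0, 0⟩
      map_add' := fun a a' => by ext <;> simp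
      map_smul' := fun s a => by ext <;> simp }
  have hloop : loopSpan (fun _ => p.grOn (Set.Ici (1 - r))) ≤ N.comap incl := by
    refine loopSpan_le fun n x hx => ?_
    have h1 : p.grOn (Set.Ici (1 - r)) ≤ N.comap (incl ∘ₗ loopElt n) := by
      refine p.grOn_le fun k hk x hx => ?_
      rw [Set.mem_Ici] at hk
      rcases le_or_gt 1 k with h | h
      · exact Submodule.mem_sup_right (p.elt_mem_kazhdan hx (by omega) n)
      · obtain ⟨k, rfl⟩ : ∃ k' : ℕ, k = -(k' : ℤ) := ⟨k.natAbs, by omega⟩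
        have h2 : Submodule.span ℂ (Set.range (p.oppBasis k)) ≤
            N.comap (incl ∘ₗ loopElt n ∘ₗ (p.gr (-(k : ℤ))).subtype) := by
          rw [Submodule.span_le]
          rintro _ ⟨a, rfl⟩
          exact hgen (some (⟨k, a⟩, n)) (by simp only [oppWeight]; omega)
        rw [Module.Basis.span_eq] at h2
        exact h2 (show (⟨x, hx⟩ : p.gr (-(k : ℤ))) ∈ ⊤ from trivial)
    exact h1 hx
  intro z hz
  have hzd : z.dCoeff • Affine.d g ∈ N := by
    rcases le_or_gt 1 r with hr | hr
    · exact N.smul_mem _ (hgen none hr)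
    · rw [hz.2.1 hr, zero_smul]
      exact N.zero_mem
  have hzc : z.cCoeff • Affine.c g ∈ N :=
    N.smul_mem _ (Submodule.mem_sup_right (p.c_mem_kazhdan le_rfl))
  have : z = incl z.loop + z.dCoeff • Affine.d g + z.cCoeff • Affine.c g := by
    ext <;> simp [incl, Affine.d, Affine.c]
  rw [this]
  exact N.add_mem (N.add_mem (hloop hz.1) hzd) hzc

/-- The bracket with an element of degree one, on the component of degree `-(k + 1)`. -/
def adLower (e : p.gr 1) (k : ℕ) : p.gr (-((k + 1 : ℕ) : ℤ)) →ₗ[ℂ] p.gr (-(k : ℤ)) :=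
  (LieAlgebra.ad ℂ g (e : g) : Module.End ℂ g).restrict fun y hy => by
    have h := p.lie_mem_gr e.2 hy
    rwa [show (1 : ℤ) + -((k + 1 : ℕ) : ℤ) = -(k : ℤ) by push_cast; ring] at h

/-- The coordinates of the bracket of `e ⊗ t ^ n`, with `e` of degree one, with a basis element
which has weight at least two. -/
def lowerCoords (t : p.gr 1 × ℤ) : p.OppIndex → p.OppIndex →₀ ℂ
  | none => 0
  | some (⟨0, _⟩, _) => 0
  | some (⟨k + 1, a⟩, m) => ((p.oppBasis k).repr (p.adLower t.1 k (p.oppBasis (k + 1) a))).mapDomain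
      fun b => some (⟨k, b⟩, t.2 + m)

lemma oppWeight_of_mem_support (t : p.gr 1 × ℤ) (i : p.OppIndex) {j : p.OppIndex}
    (hj : j ∈ (p.lowerCoords t i).support) : p.oppWeight j = p.oppWeight i - 1 := by
  classical
  match i, hj with
  | none, hj => simp [lowerCoords] at hj
  | some (⟨0, _⟩, _), hj => simp [lowerCoords] at hj
  | some (⟨k + 1, a⟩, m), hj =>
    obtain ⟨a', -, rfl⟩ := Finset.mem_image.1 (Finsupp.mapDomain_support hj)
    simp [oppWeight]

lemma lie_oppElt_sub_mem (t : p.gr 1 × ℤ) {i : p.OppIndex} (hi : p.oppWeight i ≠ 1) :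
    ⁅Affine.elt (t.1 : g) t.2, p.oppElt i⁆ - (p.lowerCoords t i).sum (fun j a => a • p.oppElt j) ∈
      p.kazhdan (p.oppWeight i - 2) := by
  match i, hi with
  | none, hi => exact absurd rfl hi
  | some (⟨0, _⟩, _), hi => exact absurd (by simp [oppWeight]) hi
  | some (⟨k + 1, a⟩, m), _ =>
    let E : p.gr (-(k : ℤ)) →ₗ[ℂ] Affine g :=
      { toFun := fun x => Affine.elt (x : g) (t.2 + m)
        map_add' := fun a a' => by ext <;> simp [Affine.elt]
        map_smul' := fun s a => by ext <;> simp [Affine.elt] }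
    have h1 : (p.lowerCoords t (some (⟨k + 1, a⟩, m))).sum (fun j a => a • p.oppElt j) =
        Affine.elt ⁅(t.1 : g), (p.oppBasis (k + 1) a : g)⁆ (t.2 + m) := by
      rw [lowerCoords, Finsupp.sum_mapDomain_index (h := fun j a => a • p.oppElt j)
        (fun _ => zero_smul _ _) (fun _ _ _ => add_smul _ _ _)]
      have h2 := congrArg E ((p.oppBasis k).linearCombination_repr
        (p.adLower t.1 k (p.oppBasis (k + 1) a)))
      rw [Finsupp.linearCombination_apply, map_finsuppSum] at h2
      simp only [map_smul] at h2
      exact h2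
    rw [h1, oppElt, Affine.elt_lie_elt, add_sub_cancel_left]
    exact Submodule.smul_mem _ _ (p.c_mem_kazhdan (by simp only [oppWeight]; push_cast; omega))

end ProperParabolic

/-- The functional by which the part of weight zero acts on the generator of the induced module. -/
def affineWhittaker : Affine g →ₗ[ℂ] ℂ where
  toFun z := loopWhittaker p X Λ z.loop + θ * z.cCoeff
  map_add' z z' := by simp only [Affine.loop_add, Affine.cCoeff_add, map_add]; ring
  map_smul' r z := by
    simp only [Affine.loop_smul, Affine.cCoeff_smul, map_smul, smul_eq_mul, RingHom.id_apply]; ring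

section Kazhdan

variable {θ} {M : Type*} [AddCommGroup M] [Module (UTheta g θ) M] [Module ℂ M]
  [IsScalarTower ℂ (UTheta g θ) M] {w : M}

lemma affineAction_of_mem_kazhdan (hw : ∀ a : Loop p.nil,
    affineAction θ M (loopInclAffine p a) w = whittakerFunctional p X Λ a • w) {z : Affine g}
    (hz : z ∈ p.kazhdan 0) : affineAction θ M z w = affineWhittaker p X Λ θ z • w := by
  have hnil : z.loop ∈ loopSpan fun _ => p.nil.toSubmodule := by
    rw [p.nil_eq_grOn]
    exact hz.1
  obtain ⟨a, ha⟩ := exists_loopIncl_eq p hnil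
  have h1 : z = loopInclAffine p a + z.cCoeff • Affine.c g := by
    ext
    · simp [Affine.c, loopInclAffine, ha]
    · simp [Affine.c, loopInclAffine, hz.2.1 zero_lt_one]
    · simp [Affine.c, loopInclAffine]
  have h2 : affineWhittaker p X Λ θ z = whittakerFunctional p X Λ a + z.cCoeff • θ := by
    rw [← loopWhittaker_loopIncl, ha, smul_eq_mul, mul_comm]
    rfl
  rw [h2, add_smul, smul_assoc, ← affineAction_c (g := g) (θ := θ), ← hw]
  conv_lhs => rw [h1]
  rw [map_add, map_smul]
  rfl

/-- The Kazhdan filtration of the affine Lie algebra given by a parabolic subalgebra, acting on a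
module of level `θ` with a Whittaker vector `w`. -/
def whittakerKazhdan (hw : ∀ a : Loop p.nil,
    affineAction θ M (loopInclAffine p a) w = whittakerFunctional p X Λ a • w) :
    KazhdanData ℂ (Affine g) M p.OppIndex (p.gr 1 × ℤ) where
  ρ := affineAction θ M
  ρ_lie z z' m := by
    simp only [affineAction_apply, toUTheta_lie, sub_smul, mul_smul]
  w := w
  K := p.kazhdan
  K_mono := p.kazhdan_mono
  K_exhaustive := p.exists_mem_kazhdan
  K_lie := p.lie_mem_kazhdan
  y := p.oppElt
  wt := p.oppWeight
  one_le_wt i := by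
    rcases i with _ | ⟨i, n⟩
    · exact le_rfl
    · simp [ProperParabolic.oppWeight]
  y_mem := p.oppElt_mem
  K_le := p.kazhdan_le
  ψ := affineWhittaker p X Λ θ
  ρ_w _ hz := affineAction_of_mem_kazhdan p X Λ hw hz
  ψ_eq_zero z hz := by
    change loopWhittaker p X Λ z.loop + θ * z.cCoeff = 0
    rw [loopWhittaker_eq_zero p X Λ (by simp) hz.1, hz.2.2 (by norm_num), mul_zero, add_zero]
  x t := Affine.elt (t.1 : g) t.2
  x_mem t := p.elt_mem_kazhdan t.1.2 (by norm_num) t.2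
  α := p.lowerCoords
  wt_of_α t i _ _ hj := p.oppWeight_of_mem_support t i hj
  lie_x_y t _ hi := p.lie_oppElt_sub_mem t hi

end Kazhdan

end WhittakerInduction

namespace WhittakerInduction

open LieAlgebra LieModule LieAlgebra.IsKilling

attribute [local instance] LieRing.ofAssociativeRing

/-! ### Invariants of the lowering derivations -/

variable {g : Type*} [LieRing g] [LieAlgebra ℂ g] [FiniteDimensional ℂ g]
  [LieAlgebra.IsSimple ℂ g] {H : LieSubalgebra ℂ g} [H.IsCartanSubalgebra]
  {b : (rootSystem H).Base} (p : ProperParabolic b) (X : RootVectors H)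
  (Λ : p.rootsZero → ℤ → ℂ) (θ : ℂ)

lemma RootVectors.eq_zero_of_coeff {x : g} (hx : x ∈ p.gr 1)
    (h : ∀ β : p.rootsZero, X.coeff β.1 x = 0) : x = 0 := by
  have h1 : p.gr (-1) ≤ LinearMap.ker ((killingForm ℂ g).flip x) := by
    refine p.gr_le (fun α hα u hu => ?_) (by norm_num)
    have hβ : p.deg (negRoot α) = 1 := by rw [p.deg_negRoot, hα, neg_neg]
    have h2 := h ⟨negRoot α, p.mem_rootsZero_iff.2 hβ⟩
    rw [RootVectors.coeff, LinearMap.smul_apply, smul_eq_mul] at h2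
    have h3 := (mul_eq_zero.1 h2).resolve_left (inv_ne_zero (X.killingForm_ne_zero _))
    rw [ProperParabolic.negRoot_negRoot] at h3
    obtain ⟨r, rfl⟩ := exists_eq_smul_of_mem_rootSpace (X.mem α) (X.ne_zero α) hu
    change killingForm ℂ g (r • X.vec α) x = 0
    rw [map_smul, LinearMap.smul_apply, h3, smul_zero]
  exact p.eq_zero_of_killingForm_gr hx h1

namespace ProperParabolic

lemma nonempty_rootsZero : Nonempty p.rootsZero := by
  by_contra hne
  rw [not_nonempty_iff] at hne
  have h1 : p.gr 1 ≤ ⊥ :=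
    p.gr_le (fun α hα => (hne.false ⟨α, p.mem_rootsZero_iff.2 hα⟩).elim) (by norm_num)
  obtain ⟨k, hk, hk'⟩ := p.exists_gr_neg_ne_bot
  refine hk' (eq_bot_iff.2 fun y hy => ?_)
  refine (Submodule.mem_bot ℂ).2 (p.eq_zero_of_lie_gr_one hk.le hy fun x hx => ?_)
  rw [(Submodule.mem_bot ℂ).1 (h1 hx), zero_lie]

end ProperParabolic

/-- Strong genericity is used here: an element of `L(g_0) ⊕ ℂ d` whose brackets with the elements of
degree one are annihilated by the Whittaker functional is zero. The elements of `L(g_0)` contribute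
translates of the `Λ(β)`, and `d` contributes the `(n Λ(β)_n)_n`. -/
lemma StronglyGeneric.eq_zero (hΛ : StronglyGeneric Λ) {z : Affine g}
    (hz : z.loop ∈ loopSpan fun _ => p.gr 0)
    (h : ∀ (e : p.gr 1) (n : ℤ), affineWhittaker p X Λ θ ⁅Affine.elt (e : g) n, z⁆ = 0) :
    z.loop = 0 ∧ z.dCoeff = 0 := by
  classical
  have := Fintype.ofFinite p.rootsZero
  obtain ⟨s, hs⟩ := exists_eq_sum_loopElt z.loop
  have hmem : ∀ m, loopCoeff m z.loop ∈ p.gr 0 := fun m => loopCoeff_mem hz m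
  have hlie : ∀ (e : p.gr 1) m, ⁅(e : g), loopCoeff m z.loop⁆ ∈ p.gr 1 := fun e m => by
    simpa using p.lie_mem_gr e.2 (hmem m)
  have hψ : ∀ (e : p.gr 1) (n : ℤ), affineWhittaker p X Λ θ ⁅Affine.elt (e : g) n, z⁆ =
      ∑ m ∈ s, ∑ β : p.rootsZero, Λ β (n + m) * X.coeff β.1 ⁅(e : g), loopCoeff m z.loop⁆ -
        z.dCoeff * (n * ∑ β : p.rootsZero, Λ β n * X.coeff β.1 (e : g)) := by
    intro e n
    have h1 : loopCocycle g (loopElt n (e : g)) z.loop = 0 := by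
      refine loopCocycle_eq_zero (S := fun _ => p.gr 1) (fun i x hx y hy => ?_) (loopElt_mem e.2) hz
      rw [killingForm_adEigenspace hx hy (by norm_num), mul_zero]
    have h2 : ⁅loopElt n (e : g), z.loop⁆ =
        ∑ m ∈ s, loopElt (n + m) ⁅(e : g), loopCoeff m z.loop⁆ := by
      conv_lhs => rw [hs, lie_sum]
      simp only [loopElt_lie]
    change loopWhittaker p X Λ (⁅Affine.elt (e : g) n, z⁆ : Affine g).loop +
      θ * loopCocycle g (loopElt n (e : g)) z.loop = _
    rw [h1, mul_zero, add_zero, Affine.loop_lie]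
    change loopWhittaker p X Λ (⁅loopElt n (e : g), z.loop⁆ + (0 : ℂ) • loopDeriv g z.loop -
      z.dCoeff • loopDeriv g (loopElt n (e : g))) = _
    rw [zero_smul, add_zero, map_sub, h2, map_sum, loopDeriv_loopElt, map_smul, map_smul,
      smul_eq_mul, smul_eq_mul]
    simp only [loopWhittaker_loopElt, finsum_eq_sum_of_fintype]
  have hcoeff : ∀ e : p.gr 1, (∀ β : p.rootsZero, ∀ m ∈ s,
      X.coeff β.1 ⁅(e : g), loopCoeff m z.loop⁆ = 0) ∧
      ∀ β : p.rootsZero, z.dCoeff * X.coeff β.1 (e : g) = 0 := by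
    intro e
    have h1 := linearIndependent_iff'.1 hΛ (((Finset.univ : Finset p.rootsZero) ×ˢ s).disjSum
      Finset.univ) (Sum.elim
        (fun q => X.coeff q.1.1 ⁅(e : g), loopCoeff q.2 z.loop⁆)
        (fun β => -(z.dCoeff * X.coeff β.1 (e : g)))) (by
      rw [Finset.sum_disjSum, Finset.sum_product_right]
      ext n
      have h2 := h e n
      rw [hψ, Finset.mul_sum, Finset.mul_sum, sub_eq_add_neg, ← Finset.sum_neg_distrib] at h2
      simp only [Sum.elim_inl, Sum.elim_inr, Pi.add_apply, Finset.sum_apply, Pi.smul_apply,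
        smul_eq_mul, Pi.zero_apply]
      rw [← h2]
      refine congrArg₂ (· + ·) (Finset.sum_congr rfl fun m _ => Finset.sum_congr rfl fun β _ => ?_)
        (Finset.sum_congr rfl fun β _ => ?_)
      · exact mul_comm _ _
      · ring)
    refine ⟨fun β m hm => h1 (Sum.inl (β, m)) (by simp [hm]), fun β => ?_⟩
    exact neg_eq_zero.1 (h1 (Sum.inr β) (by simp))
  constructor
  · rw [hs]
    refine Finset.sum_eq_zero fun m hm => ?_
    rw [p.eq_zero_of_lie_gr_one le_rfl (hmem m) fun x hx =>
      X.eq_zero_of_coeff p (hlie ⟨x, hx⟩ m) fun β => (hcoeff ⟨x, hx⟩).1 β m hm, map_zero]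
  · obtain ⟨β⟩ := p.nonempty_rootsZero
    have hβ : X.vec β.1 ∈ p.gr 1 := by
      rw [← p.mem_rootsZero_iff.1 β.2]
      exact p.rootSpace_le_gr _ (X.mem _)
    simpa [X.coeff_self] using (hcoeff ⟨_, hβ⟩).2 β

namespace ProperParabolic

lemma oppIndex_cases {i : p.OppIndex} (hi : p.oppWeight i = 1) :
    i = none ∨ ∃ a m, i = some (⟨0, a⟩, m) := by
  match i, hi with
  | none, _ => exact Or.inl rfl
  | some (⟨0, a⟩, m), _ => exact Or.inr ⟨a, m, rfl⟩
  | some (⟨k + 1, a⟩, m), hi => simp only [oppWeight] at hi; push_cast at hi; omega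

lemma gr_neg_zero : p.gr (-((0 : ℕ) : ℤ)) = p.gr 0 := by
  rw [Nat.cast_zero, neg_zero]

lemma injective_index (k : ℕ) (m : ℤ) : Function.Injective
    fun a => (some (⟨k, a⟩, m) : p.OppIndex) := fun a a' h => by
  simpa using h

lemma eq_zero_of_weight_eq_one (hΛ : StronglyGeneric Λ) {S : Finset p.OppIndex}
    {c : p.OppIndex → ℂ} (hS : ∀ i ∈ S, p.oppWeight i = 1)
    (h : ∀ t : p.gr 1 × ℤ,
      ∑ i ∈ S, c i * affineWhittaker p X Λ θ ⁅Affine.elt (t.1 : g) t.2, p.oppElt i⁆ = 0) :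
    ∀ i ∈ S, c i = 0 := by
  classical
  let N : Submodule ℂ (Affine g) :=
    { carrier := {z | z.loop ∈ loopSpan fun _ => p.gr 0}
      add_mem' := fun hx hy => (loopSpan _).add_mem hx hy
      zero_mem' := (loopSpan _).zero_mem
      smul_mem' := fun r _ hx => (loopSpan _).smul_mem r hx }
  let dLin : Affine g →ₗ[ℂ] ℂ :=
    { toFun := Affine.dCoeff
      map_add' := fun _ _ => rfl
      map_smul' := fun _ _ => rfl }
  let coeffLin : ℤ → Affine g →ₗ[ℂ] g := fun m =>
    { toFun := fun z => loopCoeff m z.loop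
      map_add' := fun _ _ => map_add _ _ _
      map_smul' := fun _ _ => map_smul _ _ _ }
  have hmem : ∀ i ∈ S, p.oppElt i ∈ N := by
    intro i hi
    obtain rfl | ⟨a, m, rfl⟩ := p.oppIndex_cases (hS i hi)
    · exact (loopSpan _).zero_mem
    · refine loopElt_mem (S := fun _ => p.gr 0) ?_
      rw [← p.gr_neg_zero]
      exact (p.oppBasis 0 a).2
  have hz : ∑ i ∈ S, c i • p.oppElt i ∈ N :=
    Submodule.sum_mem _ fun i hi => N.smul_mem _ (hmem i hi)
  obtain ⟨hl, hd⟩ := hΛ.eq_zero p X Λ θ hz fun e n => by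
    rw [lie_sum, map_sum, ← h (e, n)]
    refine Finset.sum_congr rfl fun i _ => ?_
    rw [lie_smul, map_smul, smul_eq_mul]
  intro i hi
  obtain rfl | ⟨a, m, rfl⟩ := p.oppIndex_cases (hS i hi)
  · change dLin (∑ i ∈ S, c i • p.oppElt i) = 0 at hd
    rw [map_sum, Finset.sum_eq_single_of_mem _ hi] at hd
    · rw [map_smul] at hd
      exact (mul_one (c none)).symm.trans hd
    · intro j hj hj0
      obtain rfl | ⟨a, m, rfl⟩ := p.oppIndex_cases (hS j hj)
      · exact absurd rfl hj0
      · rw [map_smul]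
        exact mul_zero _
  · have h1 : coeffLin m (∑ i ∈ S, c i • p.oppElt i) = 0 := by
      change loopCoeff m (∑ i ∈ S, c i • p.oppElt i).loop = 0
      rw [hl, map_zero]
    have hinj := p.injective_index 0 m
    rw [map_sum, ← Finset.sum_preimage _ S hinj.injOn] at h1
    · have h2 : ∑ a ∈ S.preimage _ hinj.injOn, c (some (⟨0, a⟩, m)) • p.oppBasis 0 a = 0 := by
        apply Subtype.ext
        rw [Submodule.coe_sum]
        refine Eq.trans ?_ h1
        refine Finset.sum_congr rfl fun a _ => ?_
        rw [map_smul]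
        change _ = _ • loopCoeff m (loopElt m _)
        rw [loopCoeff_loopElt, if_pos rfl]
        rfl
      exact linearIndependent_iff'.1 (p.oppBasis 0).linearIndependent _
        (fun a => c (some (⟨0, a⟩, m))) h2 a (Finset.mem_preimage.2 hi)
    · intro j hj hj0
      rw [map_smul]
      obtain rfl | ⟨a', m', rfl⟩ := p.oppIndex_cases (hS j hj)
      · change _ • loopCoeff m 0 = _
        rw [map_zero, smul_zero]
      · change _ • loopCoeff m (loopElt m' _) = _
        rw [loopCoeff_loopElt, if_neg, smul_zero]
        rintro rfl
        exact hj0 ⟨a', rfl⟩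

/-- The power of `t` in a basis element. -/
def oppDeg : p.OppIndex → ℤ
  | none => 0
  | some (_, m) => m

lemma exists_of_mem_support {t : p.gr 1 × ℤ} {i j : p.OppIndex}
    (hj : j ∈ (p.lowerCoords t i).support) :
    ∃ k a a' m, i = some (⟨k + 1, a⟩, m) ∧ j = some (⟨k, a'⟩, t.2 + m) := by
  classical
  match i, hj with
  | none, hj => simp [lowerCoords] at hj
  | some (⟨0, _⟩, _), hj => simp [lowerCoords] at hj
  | some (⟨k + 1, a⟩, m), hj =>
    obtain ⟨a', -, rfl⟩ := Finset.mem_image.1 (Finsupp.mapDomain_support hj)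
    exact ⟨k, a, a', m, rfl, rfl⟩

lemma eq_zero_of_weight_ne_one {S S' : Finset p.OppIndex} {c : p.OppIndex → ℂ}
    (hS : ∀ i ∈ S, p.oppWeight i ≠ 1)
    (h : ∀ t, (∀ i ∈ S, Disjoint (p.lowerCoords t i).support S') →
      ∑ i ∈ S, c i • p.lowerCoords t i = 0) :
    ∀ i ∈ S, c i = 0 := by
  classical
  -- The bracket with `e ⊗ t ^ n` moves `S` off `S'` for almost all `n`.
  obtain ⟨n, hn⟩ := Infinite.exists_notMem_finset
    ((S ×ˢ S').image fun q => p.oppDeg q.2 - p.oppDeg q.1)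
  have h0 : ∀ e : p.gr 1, ∑ i ∈ S, c i • p.lowerCoords (e, n) i = 0 := by
    refine fun e => h (e, n) fun i hi => Finset.disjoint_left.2 fun j hj hj' => hn ?_
    obtain ⟨k, a, a', m, rfl, rfl⟩ := p.exists_of_mem_support hj
    exact Finset.mem_image.2 ⟨_, Finset.mk_mem_product hi hj', add_sub_cancel_right n m⟩
  intro i hi
  match i, hi with
  | none, hi => exact absurd rfl (hS _ hi)
  | some (⟨0, _⟩, _), hi => exact absurd (by simp [oppWeight]) (hS _ hi)
  | some (⟨k + 1, a⟩, m), hi =>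
    have hinj := p.injective_index (k + 1) m
    let y : p.gr (-((k + 1 : ℕ) : ℤ)) :=
      ∑ a ∈ S.preimage _ hinj.injOn, c (some (⟨k + 1, a⟩, m)) • p.oppBasis (k + 1) a
    have hy : ∀ e : p.gr 1, p.adLower e k y = 0 := by
      intro e
      apply (p.oppBasis k).repr.injective
      ext a'
      have h1 := DFunLike.congr_fun (h0 e) (some (⟨k, a'⟩, n + m))
      rw [Finsupp.finsetSum_apply, ← Finset.sum_preimage _ S hinj.injOn] at h1
      · rw [map_zero]
        refine Eq.trans ?_ h1
        simp only [y, map_sum, map_smul, Finsupp.finsetSum_apply, Finsupp.smul_apply]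
        refine Finset.sum_congr rfl fun a _ => congrArg _ ?_
        exact (Finsupp.mapDomain_apply (p.injective_index k (n + m)) _ a').symm
      · intro j _ hj
        rw [Finsupp.smul_apply]
        by_contra h2
        obtain ⟨k', a₁, a₂, m', rfl, h4⟩ := p.exists_of_mem_support
          (Finsupp.mem_support_iff.2 (right_ne_zero_of_smul h2))
        simp only [Option.some.injEq, Prod.mk.injEq, add_right_inj] at h4
        obtain ⟨h5, rfl⟩ := h4
        obtain rfl : k = k' := congrArg Sigma.fst h5
        exact hj ⟨a₁, rfl⟩
    have hy0 : y = 0 := Subtype.ext (p.eq_zero_of_lie_gr_one (by omega) y.2 fun x hx =>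
      congrArg Subtype.val (hy ⟨x, hx⟩))
    exact linearIndependent_iff'.1 (p.oppBasis (k + 1)).linearIndependent _
      (fun a => c (some (⟨k + 1, a⟩, m))) hy0 a (Finset.mem_preimage.2 hi)

end ProperParabolic

/-! ### Simplicity -/

/-- A module of level `θ` which is generated by a non-zero Whittaker vector is simple. -/
theorem isSimpleModule_of_whittakerVector {M : Type*} [AddCommGroup M] [Module (UTheta g θ) M]
    (hΛ : StronglyGeneric Λ) {w : M} (hw0 : w ≠ 0)
    (hw : ∀ a : Loop p.nil, toUTheta g θ (loopInclAffine p a) • w =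
      algebraMap ℂ (UTheta g θ) (whittakerFunctional p X Λ a) • w)
    (hgen : ∀ m : M, ∃ u : UTheta g θ, m = u • w) : IsSimpleModule (UTheta g θ) M := by
  let : Module ℂ M := Module.compHom M (algebraMap ℂ (UTheta g θ))
  have : IsScalarTower ℂ (UTheta g θ) M :=
    ⟨fun r u m => by rw [Algebra.smul_def, mul_smul]; rfl⟩
  have htop : ∀ N : Submodule ℂ M, (∀ z : Affine g, ∀ v ∈ N, affineAction θ M z v ∈ N) → w ∈ N → N = ⊤ := by
    intro N hN hwN
    rw [eq_top_iff]
    intro m _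
    obtain ⟨u, rfl⟩ := hgen m
    exact smul_mem_of_affineAction hN u hwN
  let D := whittakerKazhdan p X Λ hw
  have hD : ∀ f : MvPolynomial p.OppIndex ℂ,
      (∀ t, MvPolynomial.mkDerivation ℂ (D.lower t) f = 0) →
        f = MvPolynomial.C (MvPolynomial.coeff 0 f) := by
    intro f hf
    refine MvPolynomial.eq_C_of_forall_mkDerivation_eq_zero (fun i => p.oppWeight i = 1) D.lower
      (fun t i => affineWhittaker p X Λ θ ⁅Affine.elt (t.1 : g) t.2, p.oppElt i⁆) p.lowerCoords
      (fun t i hi => if_pos hi) (fun t i hi => if_neg hi) ?_ ?_ hf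
    · exact fun S a hS h => p.eq_zero_of_weight_eq_one X Λ θ hΛ hS h
    · exact fun S S' a hS h => p.eq_zero_of_weight_ne_one hS h
  have hnt : Nontrivial M := ⟨w, 0, hw0⟩
  rw [isSimpleModule_iff]
  refine { exists_pair_ne := ⟨⊥, ⊤, bot_ne_top⟩, eq_bot_or_eq_top := fun N => ?_ }
  by_cases hN0 : N = ⊥
  · exact Or.inl hN0
  refine Or.inr ?_
  have hN : ∀ z, ∀ v ∈ N.restrictScalars ℂ, affineAction θ M z v ∈ N.restrictScalars ℂ :=
    fun z v hv => N.smul_mem _ hv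
  have hwN : w ∈ N.restrictScalars ℂ := D.w_mem_of_ne_bot hw0 hD htop hN
    fun h => hN0 ((Submodule.restrictScalars_eq_bot_iff _ _ _).1 h)
  exact (Submodule.restrictScalars_eq_top_iff _ _ _).1 (htop _ hN hwN)

end WhittakerInduction

end

theorem theorem3p1 {g : Type*} [LieRing g] [LieAlgebra ℂ g] [FiniteDimensional ℂ g]
    [LieAlgebra.IsSimple ℂ g] (H : LieSubalgebra ℂ g) [H.IsCartanSubalgebra]
    (b : (LieAlgebra.IsKilling.rootSystem H).Base) (p : WhittakerInduction.ProperParabolic b)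
    (X : WhittakerInduction.RootVectors H) (Λ : p.rootsZero → ℤ → ℂ) (θ : ℂ)
    (hΛ : WhittakerInduction.StronglyGeneric Λ) :
    IsSimpleModule (WhittakerInduction.UTheta g θ)
      (WhittakerInduction.WhittakerModule p X Λ θ) := by
  exact WhittakerInduction.isSimpleModule_of_whittakerVector p X Λ θ hΛ
    (WhittakerInduction.whittakerVector_ne_zero p X Λ θ)
    (WhittakerInduction.toUTheta_smul_whittakerVector p X Λ θ)
    (WhittakerInduction.exists_smul_whittakerVector p X Λ θ)
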